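/- **Setting.** Let $\mathfrak G\subset O(n)$ be the set of orthogonal involutions ($g^2=1$) of $\mathbb R^n$, $B$ the group of invertible real upper triangular $n\times n$ matrices, $B^+\subset B$ the subgroup with positive diagonal, $B^*$ the group of transposes of elements of $B$. A signed permutation matrix $\tilde u$ over $u\in S_n$ is one with $\tilde u e_k=\pm e_{u(k)}$. For signed permutation matrices $\tilde v,\tilde w$ over $v,w$ put $$\mathfrak X_w^v=\mathfrak G\cap B^*\tilde vB\cap B\tilde wB,\qquad \mathfrak B_{\tilde w}=\mathfrak G\cap B^+\tilde wB^+ .$$ Let $v\in S_n$ with $v^2=1$ and let $(i,j)$ be a suitable rise of $v$: $i<j$, $v(i)<v(j)$, there is no $k$ with $i<k<j$ and $v(i)<v(k)<v(j)$, and $(i,j)$ has one of the following types. Put $w=v\cdot\mathrm{co}$, where $\mathrm{co}$ is given by the type. Let $p$ be the listed sequence of positions. * $f\!f$: $v(i)=i,\ v(j)=j$; $\mathrm{co}=(i,j)$; $p=(i,j)$. * $fe$: $v(i)=i,\ j<v(j)$; $\mathrm{co}=(i,j,v(j))$; $p=(i,j,v(j))$. * $ef$: $i<v(i),\ v(j)=j$;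 $\mathrm{co}=(i,j,v(i))$; $p=(i,v(i),j)$. * $ee$ non-crossing: $i<j<v(i)<v(j)$; $\mathrm{co}=(i,j)(v(i),v(j))$; $p=(i,j,v(i),v(j))$. * $ee$ crossing: $i<v(i)<j<v(j)$; $\mathrm{co}=(i,j,v(j),v(i))$; $p=(i,v(i),j,v(j))$. * $ed$: $i<v(i),\ v(j)<j$; $\mathrm{co}=(i,j)(v(i),v(j))$; $p=(i,v(i),v(j),j)$. For signs $\epsilon,\delta\in\{\pm1\}$ and $\eta\in\{\pm1\}^n$ with $\eta_{v(k)}=\eta_k$, let $C_{\epsilon,\delta,\eta}$ be the set of matrices which map $e_k\mapsto\eta_k e_{v(k)}$ for $k\notin p$, preserve the span of the $e_k$ with $k\in p$, and there (rows and columns in the order of $p$) are one of the following matrices. In all cases but $ee$ crossing, $(c,s)$ runs through the real pairs with $c^2+s^2=1$. $$f\!f:\begin{pmatrix}c&s\\s&-c\end{pmatrix},\quad fe:\ \epsilon\begin{pmatrix}c^2&sc&s\\sc&s^2&-c\\s&-c&0\end{pmatrix},\quad ef:\ \epsilon\begin{pmatrix}0&-c&s\\-c&s^2&sc\\s&sc&c^2\end{pmatrix},$$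 $$ee\text{ non-crossing}:\begin{pmatrix}0&0&s&c\\0&0&\epsilon c&-\epsilon s\\s&\epsilon c&0&0\\c&-\epsilon s&0&0\end{pmatrix},\quad ed:\begin{pmatrix}0&c&s&0\\c&0&0&-\epsilon s\\s&0&0&\epsilon c\\0&-\epsilon s&\epsilon c&0\end{pmatrix},$$ $$ee\text{ crossing}:\begin{pmatrix}0&e&f&g\\e&\delta t&-\delta ef&-\epsilon f\\f&-\delta ef&-\delta t&\epsilon e\\g&-\epsilon f&\epsilon e&0\end{pmatrix},\ t=1-e^2,\quad e^2+f^2+g^2=1,\ f=\pm\sqrt{\tfrac{1-e^2}{1+e^2}}\,e,\ f=\epsilon\delta eg.$$ **Theorem.** 1. Let $\mathcal C=\bigcup C_{\epsilon,\delta,\eta}$ be the union over all sign choices. Then $\mathfrak X_w^v$ is the set of all elements of $\mathcal C$ that are not signed permutation matrices, and the closure of $\mathfrak X_w^v$ is $\mathcal C$. 2. Each $C=C_{\epsilon,\delta,\eta}$ is homeomorphic to a circle. It contains exactly four signed permutation matrices, namely two distinct ones $\tilde v,\tilde v'$ over $v$ and two distinct ones $\tilde w,\tilde w'$ over $w$.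 One has $C=\{\tilde v,\tilde v'\}\cup(C\cap\mathfrak B_{\tilde w})\cup(C\cap\mathfrak B_{\tilde w'})$; the sets $C\cap\mathfrak B_{\tilde w}$ and $C\cap\mathfrak B_{\tilde w'}$ are connected, and the closure of each is obtained by adding $\tilde v$ and $\tilde v'$. 3. Let $\tilde v,\tilde w$ be signed permutation matrices over $v,w$ with $\tilde v^2=\tilde w^2=1$. There is exactly one curve $C$ of the above form containing both $\tilde v$ and $\tilde w$ if and only if $\tilde v\tilde w$ is a signed covering operation, that is, it fixes $e_k$ for all $k\notin p$ and in the order $p$ it is, for some signs $\alpha,\beta,\gamma$, $$f\!f:\begin{pmatrix}0&\alpha\\-\alpha&0\end{pmatrix},\quad fe:\begin{pmatrix}0&0&\alpha\\\beta&0&0\\0&\alpha\beta&0\end{pmatrix},\quad ef:\begin{pmatrix}0&\alpha&0\\0&0&\alpha\beta\\\beta&0&0\end{pmatrix},$$ $$ee\text{ non-crossing}:\begin{pmatrix}0&-\beta&0&0\\\beta&0&0&0\\0&0&0&\alpha\\0&0&-\alpha&0\end{pmatrix},\quad ee\text{ crossing}:\begin{pmatrix}0&-\alpha\beta\gamma&0&0\\0&0&0&\gamma\\\beta&0&0&0\\0&0&\alpha&0\end{pmatrix},\quad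 ed:\begin{pmatrix}0&0&0&\alpha\\0&0&\beta&0\\0&-\beta&0&0\\-\alpha&0&0&0\end{pmatrix}.$$ If $\tilde v\tilde w$ is not of this form, no such curve contains both. -/

import Mathlib

open scoped Matrix

namespace BruhatGrassmann

/-- The orthogonal involutions of `ℝⁿ`; a subspace corresponds to the reflection across it. -/
def grassm (n : ℕ) : Set (Matrix (Fin n) (Fin n) ℝ) :=
  {g | g ∈ Matrix.orthogonalGroup (Fin n) ℝ ∧ g * g = 1}

/-- `B`: the invertible upper triangular matrices. -/
def borel (n : ℕ) : Set (Matrix (Fin n) (Fin n) ℝ) :=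
  {b | IsUnit b ∧ b.BlockTriangular id}

/-- `B⁺`: the upper triangular matrices with positive diagonal. -/
def borelPos (n : ℕ) : Set (Matrix (Fin n) (Fin n) ℝ) :=
  {b | b.BlockTriangular id ∧ ∀ k, 0 < b k k}

/-- `B*`: the transposes of the elements of `B`. -/
def borelStar (n : ℕ) : Set (Matrix (Fin n) (Fin n) ℝ) :=
  {b | bᵀ ∈ borel n}

/-- The signed permutation matrix with `e_k ↦ ε k • e_{u k}`. -/
def signedPerm {n : ℕ} (u : Equiv.Perm (Fin n)) (ε : Fin n → ℤˣ) : Matrix (Fin n) (Fin n) ℝ :=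
  Matrix.of fun a k => if a = u k then (((ε k : ℤˣ) : ℤ) : ℝ) else 0

/-- All signed permutation matrices. -/
def signedPerms (n : ℕ) : Set (Matrix (Fin n) (Fin n) ℝ) :=
  {g | ∃ (u : Equiv.Perm (Fin n)) (ε : Fin n → ℤˣ), g = signedPerm u ε}

/-- The Bruhat cell of `W`: orthogonal involutions in `B⁺ W B⁺`. -/
def bruhatCell {n : ℕ} (W : Matrix (Fin n) (Fin n) ℝ) : Set (Matrix (Fin n) (Fin n) ℝ) :=
  grassm n ∩ DoubleCoset.doubleCoset W (borelPos n) (borelPos n)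

/-- The generalized Richardson variety: orthogonal involutions in `B* V B ∩ B W B`. -/
def richardson {n : ℕ} (V W : Matrix (Fin n) (Fin n) ℝ) : Set (Matrix (Fin n) (Fin n) ℝ) :=
  grassm n ∩ DoubleCoset.doubleCoset V (borelStar n) (borel n) ∩
    DoubleCoset.doubleCoset W (borel n) (borel n)

/-- The types of suitable rises; `f`, `e`, `d` stand for fixed point, excedance, deficiency. -/
inductive RiseType
  | ff | fe | ef | eeNoncrossing | eeCrossing | ed

/-- `(i, j)` has the given type with respect to `v`. -/
def HasType {n : ℕ} (v : Equiv.Perm (Fin n)) (i j : Fin n) : RiseType → Prop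
  | .ff => v i = i ∧ v j = j
  | .fe => v i = i ∧ j < v j
  | .ef => i < v i ∧ v j = j
  | .eeNoncrossing => i < j ∧ j < v i ∧ v i < v j
  | .eeCrossing => i < v i ∧ v i < j ∧ j < v j
  | .ed => i < v i ∧ v j < j

/-- `(i, j)` is a free rise of `v` of type `τ`. -/
def IsSuitableRise {n : ℕ} (τ : RiseType) (v : Equiv.Perm (Fin n)) (i j : Fin n) : Prop :=
  i < j ∧ v i < v j ∧ (¬ ∃ k, i < k ∧ k < j ∧ v i < v k ∧ v k < v j) ∧ HasType v i j τ

/-- The covering operation of a rise; `[x, y, z].formPerm` is the cycle `x → y → z → x`. -/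
def coveringOp {n : ℕ} (v : Equiv.Perm (Fin n)) (i j : Fin n) : RiseType → Equiv.Perm (Fin n)
  | .ff => [i, j].formPerm
  | .fe => [i, j, v j].formPerm
  | .ef => [i, j, v i].formPerm
  | .eeNoncrossing => [i, j].formPerm * [v i, v j].formPerm
  | .eeCrossing => [i, j, v j, v i].formPerm
  | .ed => [i, j].formPerm * [v i, v j].formPerm

/-- The matrix which has the block `M` on the rows and columns `p 0, …, p (d-1)`
(for injective `p`), agrees with `R` on the complementary rows and columns, and is zero elsewhere. -/
def blockEmbed {d n : ℕ} (p : Fin d → Fin n) (M : Matrix (Fin d) (Fin d) ℝ)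
    (R : Matrix (Fin n) (Fin n) ℝ) : Matrix (Fin n) (Fin n) ℝ :=
  Matrix.of fun a b =>
    if (∃ x, p x = a) ∨ (∃ y, p y = b) then
      ∑ x, ∑ y, if p x = a ∧ p y = b then M x y else 0
    else R a b

/-- The explicit curve of matrices attached to a rise `(i, j)` of `v`, to the signs `ε`, `δ`
(not all of them occur for every type) and to a choice `η` of signs of `v` away from
`i`, `j`, `v i`, `v j`. -/
noncomputable def curve {n : ℕ} (v : Equiv.Perm (Fin n)) (i j : Fin n) (ε δ : ℤˣ)
    (η : Fin n → ℤˣ) : RiseType → Set (Matrix (Fin n) (Fin n) ℝ)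
  | .ff => {x | ∃ c s : ℝ, c ^ 2 + s ^ 2 = 1 ∧
      x = blockEmbed ![i, j]
        !![c, s;
           s, -c] (signedPerm v η)}
  | .fe => {x | ∃ c s : ℝ, c ^ 2 + s ^ 2 = 1 ∧
      x = blockEmbed ![i, j, v j]
        (((ε : ℤ) : ℝ) •
        !![c ^ 2, s * c, s;
           s * c, s ^ 2, -c;
           s, -c, 0]) (signedPerm v η)}
  | .ef => {x | ∃ c s : ℝ, c ^ 2 + s ^ 2 = 1 ∧
      x = blockEmbed ![i, v i, j]
        (((ε : ℤ) : ℝ) •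
        !![0, -c, s;
           -c, s ^ 2, s * c;
           s, s * c, c ^ 2]) (signedPerm v η)}
  | .eeNoncrossing => {x | ∃ c s : ℝ, c ^ 2 + s ^ 2 = 1 ∧
      x = blockEmbed ![i, j, v i, v j]
        !![0, 0, s, c;
           0, 0, (ε : ℤ) * c, -((ε : ℤ) * s);
           s, (ε : ℤ) * c, 0, 0;
           c, -((ε : ℤ) * s), 0, 0] (signedPerm v η)}
  | .eeCrossing => {x | ∃ e f g : ℝ, e ^ 2 + f ^ 2 + g ^ 2 = 1 ∧
      (f = √((1 - e ^ 2) / (1 + e ^ 2)) * e ∨ f = -√((1 - e ^ 2) / (1 + e ^ 2)) * e) ∧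
      f = (ε : ℤ) * (δ : ℤ) * e * g ∧
      x = blockEmbed ![i, v i, j, v j]
        !![0, e, f, g;
           e, (δ : ℤ) * (1 - e ^ 2), -((δ : ℤ) * e * f), -((ε : ℤ) * f);
           f, -((δ : ℤ) * e * f), -((δ : ℤ) * (1 - e ^ 2)), (ε : ℤ) * e;
           g, -((ε : ℤ) * f), (ε : ℤ) * e, 0] (signedPerm v η)}
  | .ed => {x | ∃ c s : ℝ, c ^ 2 + s ^ 2 = 1 ∧
      x = blockEmbed ![i, v i, v j, j]
        !![0, c, s, 0;
           c, 0, 0, -((ε : ℤ) * s);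
           s, 0, 0, (ε : ℤ) * c;
           0, -((ε : ℤ) * s), (ε : ℤ) * c, 0] (signedPerm v η)}

/-- The finite set of curves obtained from all sign choices. -/
def curves {n : ℕ} (τ : RiseType) (v : Equiv.Perm (Fin n)) (i j : Fin n) :
    Set (Set (Matrix (Fin n) (Fin n) ℝ)) :=
  {C | ∃ (ε δ : ℤˣ) (η : Fin n → ℤˣ), (∀ k, η (v k) = η k) ∧ C = curve v i j ε δ η τ}

/-- `S` is a signed covering operation for the rise `(i, j)` of `v`: it is the identity away from
`i`, `j`, `v i`, `v j` and has one of the following sign patterns there. -/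
def IsSignedCoveringOp {n : ℕ} (v : Equiv.Perm (Fin n)) (i j : Fin n)
    (S : Matrix (Fin n) (Fin n) ℝ) : RiseType → Prop
  | .ff => ∃ α : ℤˣ, S = blockEmbed ![i, j]
        !![0, (α : ℤ);
           -(α : ℤ), 0] 1
  | .fe => ∃ α β : ℤˣ, S = blockEmbed ![i, j, v j]
        !![0, 0, (α : ℤ);
           (β : ℤ), 0, 0;
           0, (α : ℤ) * (β : ℤ), 0] 1
  | .ef => ∃ α β : ℤˣ, S = blockEmbed ![i, v i, j]
        !![0, (α : ℤ), 0;
           0, 0, (α : ℤ) * (β : ℤ);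
           (β : ℤ), 0, 0] 1
  | .eeNoncrossing => ∃ α β : ℤˣ, S = blockEmbed ![i, j, v i, v j]
        !![0, -(β : ℤ), 0, 0;
           (β : ℤ), 0, 0, 0;
           0, 0, 0, (α : ℤ);
           0, 0, -(α : ℤ), 0] 1
  | .eeCrossing => ∃ α β γ : ℤˣ, S = blockEmbed ![i, v i, j, v j]
        !![0, -((α : ℤ) * (β : ℤ) * (γ : ℤ)), 0, 0;
           0, 0, 0, (γ : ℤ);
           (β : ℤ), 0, 0, 0;
           0, 0, (α : ℤ), 0] 1
  | .ed => ∃ α β : ℤˣ, S = blockEmbed ![i, v i, v j, j]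
        !![0, 0, 0, (α : ℤ);
           0, 0, (β : ℤ), 0;
           0, -(β : ℤ), 0, 0;
           -(α : ℤ), 0, 0, 0] 1

end BruhatGrassmann

namespace BruhatGrassmann

open DoubleCoset (doubleCoset mem_doubleCoset)

/-! ### Signed permutation matrices -/

/-! Outside the positions `p`, an element `g` of the generalized Richardson variety is pinned down
by ranks. Membership in `B* v B` bounds the rank of the upper left `a × b` corner by the number of
points of `v` in it, and membership in `B w B` bounds the rank of the rest of the first `b` columns
by the number of points of `w` there. If `v` and `w` have equally many points in the corner, the two
bounds add up to `b`. The first `b` columns of `g` are orthonormal, so the Gram matrices of the two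
parts add up to a projection of trace `b`; each trace is at most the rank, hence both bounds are
attained (`trace_le_rank`, `cornerSum_sq_eq_count`). The squares of the entries of such a corner
thus add up to its number of points, and second differences give the squares of single entries
(`entry_sq_eq`). As the rise has no point of `v` in its rectangle, this applies to all points of `v`
outside `p` (`cornersAgree_off`). Therefore `g` is a signed permutation off `p` together with a
block `M` with prescribed zeros (`exists_block_of_mem_richardson`).

The block has size at most four, and only six pairs of small permutations occur. Symmetry, `M * M =
1`, the zeros and a few incidence conditions with flags are solved by hand, and the solutions lie on
explicit circles `Φ c s` (`IsRiseModel`).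

Conversely, explicit triangular factorizations (`IsCellCircle`) put `Φ c s` into the lower-upper
coset of `v` when `c ≠ 0`, and into one of two positive cells over `w` according to the sign of `s`.
A signed permutation in a double coset lies over the permutation of that coset, with the same signs
in the case of `B⁺` (`perm_eq_of_mem_borel`, `perm_eq_of_mem_borelStar`,
`signs_eq_of_mem_borelPos`), so the points on the axes are excluded. The topological claims then
concern axes and half circles and are transported by the closed embedding `curveMap`.

For the last claim, the signs of `v` and `w` on a curve determine the curve, and being a signed
covering operation means agreement of the signs off `p` together with a finite sign condition on the
block (`covering_iff_existsUnique`). -/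

lemma signedPerm_apply {n : ℕ} (u : Equiv.Perm (Fin n)) (ε : Fin n → ℤˣ) (a k : Fin n) :
    signedPerm u ε a k = if a = u k then (((ε k : ℤˣ) : ℤ) : ℝ) else 0 := rfl

lemma unit_cast_ne_zero (x : ℤˣ) : ((x : ℤ) : ℝ) ≠ 0 := by
  exact_mod_cast x.ne_zero

lemma unit_cast_mul_self (x : ℤˣ) : ((x : ℤ) : ℝ) * ((x : ℤ) : ℝ) = 1 := by
  rcases Int.units_eq_one_or x with rfl | rfl <;> norm_num

lemma unit_cast_inj {x y : ℤˣ} : ((x : ℤ) : ℝ) = ((y : ℤ) : ℝ) ↔ x = y := by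
  rw [Int.cast_inj, Units.val_inj]

lemma exists_unit_cast {x : ℝ} (h : x ^ 2 = 1) : ∃ σ : ℤˣ, ((σ : ℤ) : ℝ) = x := by
  rcases mul_self_eq_one_iff.1 ((sq x).symm.trans h) with rfl | rfl
  · exact ⟨1, by simp⟩
  · exact ⟨-1, by simp⟩

lemma signedPerm_mulVec {n : ℕ} (u : Equiv.Perm (Fin n)) (ε : Fin n → ℤˣ) (x : Fin n → ℝ)
    (k : Fin n) : (signedPerm u ε *ᵥ x) (u k) = ((ε k : ℤ) : ℝ) * x k := by
  simp [Matrix.mulVec, dotProduct, signedPerm_apply, ite_mul]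

lemma mul_signedPerm_apply {n : ℕ} (M : Matrix (Fin n) (Fin n) ℝ) (u : Equiv.Perm (Fin n))
    (ε : Fin n → ℤˣ) (a k : Fin n) :
    (M * signedPerm u ε) a k = M a (u k) * ((ε k : ℤ) : ℝ) := by
  simp [Matrix.mul_apply, signedPerm_apply]

lemma signedPerm_mul {n : ℕ} (u u' : Equiv.Perm (Fin n)) (ε ε' : Fin n → ℤˣ) :
    signedPerm u ε * signedPerm u' ε' = signedPerm (u * u') (fun k => ε (u' k) * ε' k) := by
  ext a k
  rw [mul_signedPerm_apply]
  simp [signedPerm_apply, ite_mul]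

lemma signedPerm_one {n : ℕ} : signedPerm (1 : Equiv.Perm (Fin n)) (fun _ => 1) = 1 := by
  ext a k
  simp [signedPerm_apply, Matrix.one_apply]

lemma signedPerm_inj {n : ℕ} {u u' : Equiv.Perm (Fin n)} {ε ε' : Fin n → ℤˣ} :
    signedPerm u ε = signedPerm u' ε' ↔ u = u' ∧ ε = ε' := by
  constructor
  · intro h
    have key : ∀ k, u k = u' k ∧ ε k = ε' k := by
      intro k
      have h1 := congrFun (congrFun h (u k)) k
      simp only [signedPerm_apply, if_true] at h1
      split_ifs at h1 with h2
      · exact ⟨h2, unit_cast_inj.1 h1⟩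
      · exact absurd h1 (unit_cast_ne_zero _)
    exact ⟨Equiv.ext fun k => (key k).1, funext fun k => (key k).2⟩
  · rintro ⟨rfl, rfl⟩
    rfl

lemma isUnit_of_mul_eq_one {n : ℕ} {A B : Matrix (Fin n) (Fin n) ℝ} (h : A * B = 1) :
    IsUnit A := IsUnit.of_mul_eq_one _ h

lemma signedPerm_mul_self_eq_one {n : ℕ} {v : Equiv.Perm (Fin n)} {a : Fin n → ℤˣ} :
    signedPerm v a * signedPerm v a = 1 ↔ v * v = 1 ∧ ∀ k, a (v k) = a k := by
  rw [signedPerm_mul, ← signedPerm_one, signedPerm_inj, funext_iff]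
  refine and_congr_right fun _ => forall_congr' fun k => ?_
  rw [mul_eq_one_iff_eq_inv, Int.units_inv_eq_self]

lemma signedPerm_transpose {n : ℕ} {v : Equiv.Perm (Fin n)} (hv : v * v = 1) {η : Fin n → ℤˣ}
    (hη : ∀ k, η (v k) = η k) : (signedPerm v η)ᵀ = signedPerm v η := by
  have hvv : ∀ k, v (v k) = k := fun k => by simpa using Equiv.congr_fun hv k
  ext a k
  simp only [Matrix.transpose_apply, signedPerm_apply]
  by_cases h : k = v a
  · subst h; simp [hvv, hη]
  · have : a ≠ v k := by rintro rfl; simp [hvv] at h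
    simp [h, this]

/-! ### Triangular matrices -/

lemma diag_ne_zero_of_borel {n : ℕ} {b : Matrix (Fin n) (Fin n) ℝ} (hb : b ∈ borel n)
    (k : Fin n) : b k k ≠ 0 := by
  have h1 := (Matrix.isUnit_iff_isUnit_det b).1 hb.1
  rw [Matrix.det_of_isUpperTriangular hb.2, isUnit_iff_ne_zero, Finset.prod_ne_zero_iff] at h1
  exact h1 k (Finset.mem_univ _)

lemma borel_of_diag_ne_zero {n : ℕ} {b : Matrix (Fin n) (Fin n) ℝ} (hb : b.BlockTriangular id)
    (h : ∀ k, b k k ≠ 0) : b ∈ borel n := by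
  refine ⟨(Matrix.isUnit_iff_isUnit_det b).2 ?_, hb⟩
  rw [Matrix.det_of_isUpperTriangular hb, isUnit_iff_ne_zero, Finset.prod_ne_zero_iff]
  exact fun k _ => h k

lemma borelPos_subset_borel {n : ℕ} : borelPos n ⊆ borel n :=
  fun _ hb => borel_of_diag_ne_zero hb.1 fun k => (hb.2 k).ne'

lemma borel_mul {n : ℕ} {b c : Matrix (Fin n) (Fin n) ℝ} (hb : b ∈ borel n) (hc : c ∈ borel n) :
    b * c ∈ borel n := ⟨hb.1.mul hc.1, hb.2.mul hc.2⟩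

lemma upper_mul_apply_diag {n : ℕ} {b c : Matrix (Fin n) (Fin n) ℝ} (hb : b.BlockTriangular id)
    (hc : c.BlockTriangular id) (k : Fin n) : (b * c) k k = b k k * c k k := by
  rw [Matrix.mul_apply, Finset.sum_eq_single k]
  · intro j _ hj
    rcases lt_or_gt_of_ne hj with h | h
    · rw [hb (show id j < id k from h), zero_mul]
    · rw [hc (show id k < id j from h), mul_zero]
  · simp

lemma borelPos_mul {n : ℕ} {b c : Matrix (Fin n) (Fin n) ℝ} (hb : b ∈ borelPos n)
    (hc : c ∈ borelPos n) : b * c ∈ borelPos n :=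
  ⟨hb.1.mul hc.1, fun k => by
    rw [upper_mul_apply_diag hb.1 hc.1]; exact mul_pos (hb.2 k) (hc.2 k)⟩

lemma borel_exists_inv {n : ℕ} {b : Matrix (Fin n) (Fin n) ℝ} (hb : b ∈ borel n) :
    ∃ c ∈ borel n, b * c = 1 ∧ c * b = 1 := by
  obtain ⟨inst⟩ := hb.1.nonempty_invertible
  have hu : IsUnit b.det := (Matrix.isUnit_iff_isUnit_det b).1 hb.1
  refine ⟨b⁻¹, ⟨?_, Matrix.blockTriangular_inv_of_blockTriangular hb.2⟩,
    Matrix.mul_nonsing_inv _ hu, Matrix.nonsing_inv_mul _ hu⟩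
  exact isUnit_of_mul_eq_one (Matrix.nonsing_inv_mul _ hu)

lemma borelPos_exists_inv {n : ℕ} {b : Matrix (Fin n) (Fin n) ℝ} (hb : b ∈ borelPos n) :
    ∃ c ∈ borelPos n, b * c = 1 ∧ c * b = 1 := by
  obtain ⟨c, hc, h1, h2⟩ := borel_exists_inv (borelPos_subset_borel hb)
  refine ⟨c, ⟨hc.2, fun k => ?_⟩, h1, h2⟩
  have h3 := upper_mul_apply_diag hb.1 hc.2 k
  rw [h1, Matrix.one_apply_eq] at h3
  exact pos_of_mul_pos_right (by rw [← h3]; exact one_pos) (hb.2 k).le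

lemma diag_ne_zero_of_borelStar {n : ℕ} {b : Matrix (Fin n) (Fin n) ℝ} (hb : b ∈ borelStar n)
    (k : Fin n) : b k k ≠ 0 := diag_ne_zero_of_borel (b := bᵀ) hb k

/-! ### Double cosets -/

lemma mem_doubleCoset_borelPos_of_mul_eq {n : ℕ} {g X U W : Matrix (Fin n) (Fin n) ℝ}
    (hX : X ∈ borelPos n) (hU : U ∈ borelPos n) (h : g * X = U * W) :
    g ∈ doubleCoset W (borelPos n) (borelPos n) := by
  obtain ⟨Y, hY, h1, -⟩ := borelPos_exists_inv hX
  exact mem_doubleCoset.2 ⟨U, hU, Y, hY, by rw [← h, mul_assoc, h1, mul_one]⟩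

lemma mem_doubleCoset_borelStar_of_mul_eq {n : ℕ} {g X L V : Matrix (Fin n) (Fin n) ℝ}
    (hX : X ∈ borel n) (hL : L ∈ borelStar n) (h : g * X = L * V) :
    g ∈ doubleCoset V (borelStar n) (borel n) := by
  obtain ⟨Y, hY, h1, -⟩ := borel_exists_inv hX
  exact mem_doubleCoset.2 ⟨L, hL, Y, hY, by rw [← h, mul_assoc, h1, mul_one]⟩

lemma diagonal_sign_mem_borel {n : ℕ} (ε : Fin n → ℤˣ) : signedPerm 1 ε ∈ borel n := by
  refine borel_of_diag_ne_zero (fun i j hij => ?_) fun k => ?_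
  · simp [signedPerm_apply, (show j < i from hij).ne']
  · simp [signedPerm_apply]

lemma signedPerm_mul_diagonal_sign {n : ℕ} (u : Equiv.Perm (Fin n)) (ε ε' : Fin n → ℤˣ) :
    signedPerm u ε * signedPerm 1 (fun k => ε k * ε' k) = signedPerm u ε' := by
  rw [signedPerm_mul, mul_one]
  congr 1
  funext k
  rw [Equiv.Perm.one_apply, ← mul_assoc, Int.units_mul_self, one_mul]

/-- `B` contains the diagonal sign matrices, which absorb any change of column signs. Hence the
Richardson variety does not depend on the signs of `v` and `w`. -/
lemma doubleCoset_signedPerm_congr {n : ℕ} {S : Set (Matrix (Fin n) (Fin n) ℝ)}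
    {u : Equiv.Perm (Fin n)} {ε : Fin n → ℤˣ} {g : Matrix (Fin n) (Fin n) ℝ}
    (h : g ∈ doubleCoset (signedPerm u ε) S (borel n)) (ε' : Fin n → ℤˣ) :
    g ∈ doubleCoset (signedPerm u ε') S (borel n) := by
  obtain ⟨x, hx, y, hy, rfl⟩ := mem_doubleCoset.1 h
  refine mem_doubleCoset.2 ⟨x, hx, signedPerm 1 (fun k => ε' k * ε k) * y,
    borel_mul (diagonal_sign_mem_borel _) hy, ?_⟩
  rw [← mul_assoc, mul_assoc x (signedPerm u ε'), signedPerm_mul_diagonal_sign]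

lemma borelPos_doubleCoset_subset {n : ℕ} {W : Matrix (Fin n) (Fin n) ℝ} :
    doubleCoset W (borelPos n) (borelPos n) ⊆ doubleCoset W (borel n) (borel n) := by
  intro g hg
  obtain ⟨x, hx, y, hy, rfl⟩ := mem_doubleCoset.1 hg
  exact mem_doubleCoset.2 ⟨x, borelPos_subset_borel hx, y, borelPos_subset_borel hy, rfl⟩

/-! ### Leading coordinates, and the permutation and signs determined by a double coset -/

lemma upper_mulVec_eq_zero {n : ℕ} {b : Matrix (Fin n) (Fin n) ℝ} (hb : b.BlockTriangular id)
    {y : Fin n → ℝ} {m : Fin n} (hy : ∀ r, m < r → y r = 0) {r : Fin n} (hr : m < r) :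
    (b *ᵥ y) r = 0 := by
  rw [Matrix.mulVec, dotProduct]
  refine Finset.sum_eq_zero fun j _ => ?_
  by_cases h : j < r
  · simp [hb (show id j < id r from h)]
  · simp [hy j (lt_of_lt_of_le hr (not_lt.1 h))]

lemma upper_mulVec_top {n : ℕ} {b : Matrix (Fin n) (Fin n) ℝ} (hb : b.BlockTriangular id)
    {y : Fin n → ℝ} {m : Fin n} (hy : ∀ r, m < r → y r = 0) :
    (b *ᵥ y) m = b m m * y m := by
  rw [Matrix.mulVec, dotProduct]
  refine Finset.sum_eq_single m (fun j _ hj => ?_) (by simp)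
  rcases lt_or_gt_of_ne hj with h | h
  · simp [hb (show id j < id m from h)]
  · simp [hy j h]

lemma lower_mulVec_eq_zero {n : ℕ} {b : Matrix (Fin n) (Fin n) ℝ} (hb : bᵀ.BlockTriangular id)
    {y : Fin n → ℝ} {m : Fin n} (hy : ∀ r, r < m → y r = 0) {r : Fin n} (hr : r < m) :
    (b *ᵥ y) r = 0 := by
  rw [Matrix.mulVec, dotProduct]
  refine Finset.sum_eq_zero fun j _ => ?_
  by_cases h : r < j
  · simp [show b r j = 0 from hb (show id r < id j from h)]
  · simp [hy j (lt_of_le_of_lt (not_lt.1 h) hr)]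

lemma lower_mulVec_bot {n : ℕ} {b : Matrix (Fin n) (Fin n) ℝ} (hb : bᵀ.BlockTriangular id)
    {y : Fin n → ℝ} {m : Fin n} (hy : ∀ r, r < m → y r = 0) :
    (b *ᵥ y) m = b m m * y m := by
  rw [Matrix.mulVec, dotProduct]
  refine Finset.sum_eq_single m (fun j _ hj => ?_) (by simp)
  rcases lt_or_gt_of_ne hj with h | h
  · simp [hy j h]
  · simp [show b m j = 0 from hb (show id m < id j from h)]

lemma signedPerm_mulVec_single {n : ℕ} (u : Equiv.Perm (Fin n)) (ε : Fin n → ℤˣ) (k : Fin n) :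
    signedPerm u ε *ᵥ Pi.single k 1 = Pi.single (u k) ((ε k : ℤ) : ℝ) := by
  ext r
  simp [signedPerm_apply, Pi.single_apply]

/-- Columns of an element of `B W B`, after a change of basis by `B`. -/
lemma exists_vec_of_mem_borel {n : ℕ} {g : Matrix (Fin n) (Fin n) ℝ} {w : Equiv.Perm (Fin n)}
    {ε : Fin n → ℤˣ} (hg : g ∈ doubleCoset (signedPerm w ε) (borel n) (borel n)) (k : Fin n) :
    ∃ x : Fin n → ℝ, (∀ j, k < j → x j = 0) ∧ x k ≠ 0 ∧
      (∀ r, w k < r → (g *ᵥ x) r = 0) ∧ (g *ᵥ x) (w k) ≠ 0 := by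
  obtain ⟨b, hb, c, hc, rfl⟩ := mem_doubleCoset.1 hg
  obtain ⟨d, hd, h1, -⟩ := borel_exists_inv hc
  have hk : ∀ j, k < j → (Pi.single k 1 : Fin n → ℝ) j = 0 := fun j hj => by simp [hj.ne']
  -- The vector is `c⁻¹ e_k`. The right triangular factor cancels, and the image is `±b e_{w k}`,
  -- whose last nonzero coordinate is at `w k`.
  have hx : (b * signedPerm w ε * c) *ᵥ (d *ᵥ Pi.single k 1)
      = b *ᵥ Pi.single (w k) ((ε k : ℤ) : ℝ) := by
    rw [Matrix.mulVec_mulVec, mul_assoc, h1, mul_one, ← Matrix.mulVec_mulVec,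
      signedPerm_mulVec_single]
  have hw : ∀ j, w k < j → (Pi.single (w k) ((ε k : ℤ) : ℝ) : Fin n → ℝ) j = 0 :=
    fun j hj => by simp [hj.ne']
  refine ⟨d *ᵥ Pi.single k 1, fun j hj => upper_mulVec_eq_zero hd.2 hk hj, ?_, ?_, ?_⟩
  · rw [upper_mulVec_top hd.2 hk]
    simpa using diag_ne_zero_of_borel hd k
  · intro r hr
    rw [hx, upper_mulVec_eq_zero hb.2 hw hr]
  · rw [hx, upper_mulVec_top hb.2 hw]
    simpa using diag_ne_zero_of_borel hb (w k)

/-- With positive diagonals the sign of the leading coordinate survives the change of basis, so the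
double coset remembers `ε`. -/
lemma exists_vec_of_mem_borelPos {n : ℕ} {g : Matrix (Fin n) (Fin n) ℝ} {w : Equiv.Perm (Fin n)}
    {ε : Fin n → ℤˣ} (hg : g ∈ doubleCoset (signedPerm w ε) (borelPos n) (borelPos n))
    (k : Fin n) :
    ∃ x : Fin n → ℝ, 0 < x k ∧ 0 < ((ε k : ℤ) : ℝ) * (g *ᵥ x) (w k) ∧
      (∀ j, k < j → x j = 0) := by
  obtain ⟨b, hb, c, hc, rfl⟩ := mem_doubleCoset.1 hg
  obtain ⟨d, hd, h1, -⟩ := borelPos_exists_inv hc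
  have hk : ∀ j, k < j → (Pi.single k 1 : Fin n → ℝ) j = 0 := fun j hj => by simp [hj.ne']
  have hx : (b * signedPerm w ε * c) *ᵥ (d *ᵥ Pi.single k 1)
      = b *ᵥ Pi.single (w k) ((ε k : ℤ) : ℝ) := by
    rw [Matrix.mulVec_mulVec, mul_assoc, h1, mul_one, ← Matrix.mulVec_mulVec,
      signedPerm_mulVec_single]
  have hw : ∀ j, w k < j → (Pi.single (w k) ((ε k : ℤ) : ℝ) : Fin n → ℝ) j = 0 :=
    fun j hj => by simp [hj.ne']
  refine ⟨d *ᵥ Pi.single k 1, ?_, ?_, fun j hj => upper_mulVec_eq_zero hd.1 hk hj⟩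
  · rw [upper_mulVec_top hd.1 hk]
    simpa using hd.2 k
  · rw [hx, upper_mulVec_top hb.1 hw, Pi.single_eq_same, mul_left_comm, unit_cast_mul_self,
      mul_one]
    exact hb.2 _

/-- Columns of an element of `B* V B`, after a change of basis by `B`. -/
lemma exists_vec_of_mem_borelStar {n : ℕ} {g : Matrix (Fin n) (Fin n) ℝ} {v : Equiv.Perm (Fin n)}
    {ε : Fin n → ℤˣ} (hg : g ∈ doubleCoset (signedPerm v ε) (borelStar n) (borel n))
    (k : Fin n) :
    ∃ x : Fin n → ℝ, (∀ j, k < j → x j = 0) ∧ x k ≠ 0 ∧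
      (∀ r, r < v k → (g *ᵥ x) r = 0) ∧ (g *ᵥ x) (v k) ≠ 0 := by
  obtain ⟨b, hb, c, hc, rfl⟩ := mem_doubleCoset.1 hg
  obtain ⟨d, hd, h1, -⟩ := borel_exists_inv hc
  have hk : ∀ j, k < j → (Pi.single k 1 : Fin n → ℝ) j = 0 := fun j hj => by simp [hj.ne']
  have hx : (b * signedPerm v ε * c) *ᵥ (d *ᵥ Pi.single k 1)
      = b *ᵥ Pi.single (v k) ((ε k : ℤ) : ℝ) := by
    rw [Matrix.mulVec_mulVec, mul_assoc, h1, mul_one, ← Matrix.mulVec_mulVec,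
      signedPerm_mulVec_single]
  have hw : ∀ j, j < v k → (Pi.single (v k) ((ε k : ℤ) : ℝ) : Fin n → ℝ) j = 0 :=
    fun j hj => by simp [hj.ne]
  refine ⟨d *ᵥ Pi.single k 1, fun j hj => upper_mulVec_eq_zero hd.2 hk hj, ?_, ?_, ?_⟩
  · rw [upper_mulVec_top hd.2 hk]
    simpa using diag_ne_zero_of_borel hd k
  · intro r hr
    rw [hx, lower_mulVec_eq_zero hb.2 hw hr]
  · rw [hx, lower_mulVec_bot hb.2 hw]
    simpa using diag_ne_zero_of_borelStar hb (v k)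

/-- Both permutations have the same sum of values, so no inequality can be strict. -/
lemma perm_eq_of_forall_le {n : ℕ} {u w : Equiv.Perm (Fin n)} (h : ∀ k, u k ≤ w k) : u = w := by
  have hs : ∑ k, ((u k : Fin n) : ℕ) = ∑ k, ((w k : Fin n) : ℕ) := by
    rw [Equiv.sum_comp u (fun k : Fin n => (k : ℕ)), Equiv.sum_comp w (fun k : Fin n => (k : ℕ))]
  have h2 := (Finset.sum_eq_sum_iff_of_le fun k _ => Fin.le_def.1 (h k)).1 hs
  exact Equiv.ext fun k => Fin.ext (h2 k (Finset.mem_univ _))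

/-- A vector ending at coordinate `k` is sent by the signed permutation to one with nonzero
coordinate at `u k`, whereas the double coset supplies such a vector whose image vanishes beyond `w
k`. So `u ≤ w` pointwise. -/
lemma perm_eq_of_mem_borel {n : ℕ} {u w : Equiv.Perm (Fin n)} {ε ε' : Fin n → ℤˣ}
    (h : signedPerm u ε ∈ doubleCoset (signedPerm w ε') (borel n) (borel n)) : u = w := by
  refine perm_eq_of_forall_le fun k => not_lt.1 fun hk => ?_
  obtain ⟨x, -, hx, h1, -⟩ := exists_vec_of_mem_borel h k
  have h2 := h1 _ hk
  rw [signedPerm_mulVec] at h2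
  exact mul_ne_zero (unit_cast_ne_zero _) hx h2

lemma perm_eq_of_mem_borelStar {n : ℕ} {u v : Equiv.Perm (Fin n)} {ε ε' : Fin n → ℤˣ}
    (h : signedPerm u ε ∈ doubleCoset (signedPerm v ε') (borelStar n) (borel n)) : u = v := by
  refine (perm_eq_of_forall_le fun k => not_lt.1 fun hk => ?_).symm
  obtain ⟨x, -, hx, h1, -⟩ := exists_vec_of_mem_borelStar h k
  have h2 := h1 _ hk
  rw [signedPerm_mulVec] at h2
  exact mul_ne_zero (unit_cast_ne_zero _) hx h2

lemma signs_eq_of_mem_borelPos {n : ℕ} {w : Equiv.Perm (Fin n)} {ε ε' : Fin n → ℤˣ}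
    (h : signedPerm w ε ∈ doubleCoset (signedPerm w ε') (borelPos n) (borelPos n)) : ε = ε' := by
  funext k
  obtain ⟨x, hx, h1, -⟩ := exists_vec_of_mem_borelPos h k
  rw [signedPerm_mulVec, ← mul_assoc] at h1
  have h2 := pos_of_mul_pos_left h1 hx.le
  rcases Int.units_eq_one_or (ε k) with e1 | e1 <;> rcases Int.units_eq_one_or (ε' k) with e2 | e2
    <;> rw [e1, e2] at h2 ⊢ <;> norm_num at h2

/-- `B⁺` is a group, so two of its double cosets with a common element coincide. -/
lemma doubleCoset_borelPos_symm_trans {n : ℕ} {g W W' : Matrix (Fin n) (Fin n) ℝ}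
    (h : g ∈ doubleCoset W (borelPos n) (borelPos n))
    (h' : g ∈ doubleCoset W' (borelPos n) (borelPos n)) :
    W ∈ doubleCoset W' (borelPos n) (borelPos n) := by
  obtain ⟨x, hx, y, hy, rfl⟩ := mem_doubleCoset.1 h
  obtain ⟨x', hx', y', hy', h2⟩ := mem_doubleCoset.1 h'
  obtain ⟨z, hz, -, hz2⟩ := borelPos_exists_inv hx
  obtain ⟨t, ht, ht1, -⟩ := borelPos_exists_inv hy
  refine mem_doubleCoset.2 ⟨z * x', borelPos_mul hz hx', y' * t, borelPos_mul hy' ht, ?_⟩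
  calc W = (z * x) * W * (y * t) := by rw [hz2, ht1, one_mul, mul_one]
    _ = z * (x * W * y) * t := by simp only [mul_assoc]
    _ = _ := by rw [h2]; simp only [mul_assoc]

/-! ### Ranks of corner submatrices -/

/-- The number of nonzero entries of the permutation matrix of `u` in the first `a` rows and the
first `b` columns. -/
def count {n : ℕ} (u : Equiv.Perm (Fin n)) (a b : ℕ) : ℕ :=
  (Finset.univ.filter fun k : Fin n => (k : ℕ) < b ∧ (u k : ℕ) < a).card

/-- The sum of the entries in the first `a` rows and the first `b` columns. -/
def cornerSum {n : ℕ} (f : Fin n → Fin n → ℝ) (a b : ℕ) : ℝ :=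
  ∑ r : Fin n, ∑ k : Fin n, if (r : ℕ) < a ∧ (k : ℕ) < b then f r k else 0

/-- The coordinate projection onto the first `m` coordinates. -/
def coordProj (n m : ℕ) : Matrix (Fin n) (Fin n) ℝ :=
  Matrix.diagonal fun r => if (r : ℕ) < m then 1 else 0

/-- The coordinate projection onto all but the first `m` coordinates. -/
def coordCoproj (n m : ℕ) : Matrix (Fin n) (Fin n) ℝ :=
  Matrix.diagonal fun r => if (r : ℕ) < m then 0 else 1

/-- The trace is the sum of the eigenvalues, the rank is the number of nonzero ones, and none of
them exceeds 1. -/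
lemma trace_le_rank {n : ℕ} {S : Matrix (Fin n) (Fin n) ℝ} (h0 : S.PosSemidef)
    (h1 : (1 - S).PosSemidef) : S.trace ≤ S.rank := by
  have hS := h0.isHermitian
  have hle : ∀ i, hS.eigenvalues i ≤ 1 := by
    intro i
    -- The form of `1 - S` at a unit eigenvector is one minus the eigenvalue.
    have h2 := h1.re_dotProduct_nonneg (hS.eigenvectorBasis i).ofLp
    have h3 := hS.mulVec_eigenvectorBasis i
    have h4 : (hS.eigenvectorBasis i).ofLp ⬝ᵥ (hS.eigenvectorBasis i).ofLp = 1 := by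
      have h5 := hS.eigenvectorBasis.orthonormal.1 i
      have h6 := EuclideanSpace.real_norm_sq_eq (hS.eigenvectorBasis i)
      rw [h5] at h6
      simp only [dotProduct, ← sq]
      rw [← h6]; norm_num
    rw [Matrix.sub_mulVec, Matrix.one_mulVec, h3, dotProduct_sub] at h2
    simp only [star_trivial, dotProduct_smul, h4] at h2
    simpa using h2
  rw [hS.trace_eq_sum_eigenvalues, hS.rank_eq_card_non_zero_eigs, Fintype.card_subtype,
    Finset.card_filter, Nat.cast_sum]
  refine Finset.sum_le_sum fun i _ => ?_
  by_cases hi : hS.eigenvalues i = 0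
  · simp [hi]
  · simpa [hi] using hle i

lemma coordProj_add_coordCoproj (n m : ℕ) : coordProj n m + coordCoproj n m = 1 := by
  rw [coordProj, coordCoproj, Matrix.diagonal_add, ← Matrix.diagonal_one]
  congr 1
  funext r
  split_ifs <;> simp

/-- The first rows of a lower triangular matrix are supported in the first columns. This and the
next two lemmas move truncations past triangular factors, which reduces the rank of a corner of `g`
to that of the same corner of the permutation matrix. -/
lemma coordProj_mul_lower {n : ℕ} {L : Matrix (Fin n) (Fin n) ℝ} (hL : Lᵀ.BlockTriangular id)
    (a : ℕ) : coordProj n a * L = coordProj n a * L * coordProj n a := by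
  ext r k
  simp only [coordProj, Matrix.mul_diagonal, Matrix.diagonal_mul]
  by_cases hr : (r : ℕ) < a <;> by_cases hk : (k : ℕ) < a <;> simp [hr, hk]
  exact hL (show r < k from Fin.lt_def.2 (by omega))

lemma coordCoproj_mul_upper {n : ℕ} {b : Matrix (Fin n) (Fin n) ℝ} (hb : b.BlockTriangular id)
    (a : ℕ) : coordCoproj n a * b = coordCoproj n a * b * coordCoproj n a := by
  ext r k
  simp only [coordCoproj, Matrix.mul_diagonal, Matrix.diagonal_mul]
  by_cases hr : (r : ℕ) < a <;> by_cases hk : (k : ℕ) < a <;> simp [hr, hk]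
  exact hb (show k < r from Fin.lt_def.2 (by omega))

lemma upper_mul_coordProj {n : ℕ} {c : Matrix (Fin n) (Fin n) ℝ} (hc : c.BlockTriangular id)
    (b : ℕ) : c * coordProj n b = coordProj n b * c * coordProj n b := by
  ext r k
  simp only [coordProj, Matrix.mul_diagonal, Matrix.diagonal_mul]
  by_cases hr : (r : ℕ) < b <;> by_cases hk : (k : ℕ) < b <;> simp [hr, hk]
  exact hc (show k < r from Fin.lt_def.2 (by omega))

lemma rank_diagonal_indicator {n : ℕ} (p : Fin n → Prop) [DecidablePred p] :
    (Matrix.diagonal fun k => if p k then (1 : ℝ) else 0).rank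
      = (Finset.univ.filter p).card := by
  rw [Matrix.rank_diagonal, Fintype.card_subtype]
  congr 1
  ext k
  simp

lemma rank_upperLeft_le {n : ℕ} {g : Matrix (Fin n) (Fin n) ℝ} {v : Equiv.Perm (Fin n)}
    {ε : Fin n → ℤˣ} (hg : g ∈ doubleCoset (signedPerm v ε) (borelStar n) (borel n)) (a b : ℕ) :
    (coordProj n a * g * coordProj n b).rank ≤ count v a b := by
  obtain ⟨L, hL, c, hc, rfl⟩ := mem_doubleCoset.1 hg
  -- The truncated permutation matrix keeps exactly the columns of the points inside the corner.
  have h1 : coordProj n a * signedPerm v ε * coordProj n b = signedPerm v ε *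
      Matrix.diagonal fun k : Fin n => if (k : ℕ) < b ∧ (v k : ℕ) < a then (1 : ℝ) else 0 := by
    ext r k
    simp only [coordProj, Matrix.mul_diagonal, Matrix.diagonal_mul, signedPerm_apply]
    by_cases h : r = v k
    · subst h
      by_cases hr : (v k : ℕ) < a <;> by_cases hk : (k : ℕ) < b <;> simp [hr, hk]
    · simp [h]
  have h2 : coordProj n a * (L * signedPerm v ε * c) * coordProj n b
      = coordProj n a * L * (coordProj n a * signedPerm v ε * coordProj n b) *
        (c * coordProj n b) := by
    calc _ = (coordProj n a * L) * signedPerm v ε * (c * coordProj n b) := by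
            simp only [mul_assoc]
      _ = (coordProj n a * L * coordProj n a) * signedPerm v ε *
            (coordProj n b * c * coordProj n b) := by
            rw [← coordProj_mul_lower hL.2, ← upper_mul_coordProj hc.2]
      _ = _ := by simp only [mul_assoc]
  rw [h2, h1, count, ← rank_diagonal_indicator]
  exact (Matrix.rank_mul_le_left _ _).trans
    ((Matrix.rank_mul_le_right _ _).trans (Matrix.rank_mul_le_right _ _))

/-- With an upper triangular factor on the left, it is the bottom rows that are supported on bottom
columns, so the lower left corners are the ones controlled by `w`. -/
lemma rank_lowerLeft_le {n : ℕ} {g : Matrix (Fin n) (Fin n) ℝ} {w : Equiv.Perm (Fin n)}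
    {ε : Fin n → ℤˣ} (hg : g ∈ doubleCoset (signedPerm w ε) (borel n) (borel n)) (a b : ℕ) :
    (coordCoproj n a * g * coordProj n b).rank ≤
      (Finset.univ.filter fun k : Fin n => (k : ℕ) < b ∧ ¬ (w k : ℕ) < a).card := by
  obtain ⟨L, hL, c, hc, rfl⟩ := mem_doubleCoset.1 hg
  have h1 : coordCoproj n a * signedPerm w ε * coordProj n b = signedPerm w ε *
      Matrix.diagonal fun k : Fin n => if (k : ℕ) < b ∧ ¬ (w k : ℕ) < a then (1 : ℝ) else 0 := by
    ext r k
    simp only [coordProj, coordCoproj, Matrix.mul_diagonal, Matrix.diagonal_mul, signedPerm_apply]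
    by_cases h : r = w k
    · subst h
      by_cases hr : (w k : ℕ) < a <;> by_cases hk : (k : ℕ) < b <;> simp [hr, hk]
    · simp [h]
  have h2 : coordCoproj n a * (L * signedPerm w ε * c) * coordProj n b
      = coordCoproj n a * L * (coordCoproj n a * signedPerm w ε * coordProj n b) *
        (c * coordProj n b) := by
    calc _ = (coordCoproj n a * L) * signedPerm w ε * (c * coordProj n b) := by
            simp only [mul_assoc]
      _ = (coordCoproj n a * L * coordCoproj n a) * signedPerm w ε *
            (coordProj n b * c * coordProj n b) := by
            rw [← coordCoproj_mul_upper hL.2, ← upper_mul_coordProj hc.2]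
      _ = _ := by simp only [mul_assoc]
  rw [h2, h1, ← rank_diagonal_indicator]
  exact (Matrix.rank_mul_le_left _ _).trans
    ((Matrix.rank_mul_le_right _ _).trans (Matrix.rank_mul_le_right _ _))

lemma trace_upperLeft {n : ℕ} (g : Matrix (Fin n) (Fin n) ℝ) (a b : ℕ) :
    ((coordProj n a * g * coordProj n b)ᵀ * (coordProj n a * g * coordProj n b)).trace
      = cornerSum (fun r k => g r k ^ 2) a b := by
  rw [Matrix.trace, cornerSum, Finset.sum_comm]
  refine Finset.sum_congr rfl fun k _ => ?_
  rw [Matrix.diag_apply, Matrix.mul_apply]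
  refine Finset.sum_congr rfl fun r _ => ?_
  simp only [coordProj, Matrix.transpose_apply, Matrix.mul_diagonal, Matrix.diagonal_mul]
  by_cases hr : (r : ℕ) < a <;> by_cases hk : (k : ℕ) < b <;> simp [hr, hk, sq]

/-- Where `v` and `w` have the same number of points in an upper left corner, so that the columns
split orthogonally, the squares of the entries of the corner sum up to this number. -/
lemma cornerSum_sq_eq_count {n : ℕ} {g : Matrix (Fin n) (Fin n) ℝ} {v w : Equiv.Perm (Fin n)}
    {α β : Fin n → ℤˣ} (hgo : gᵀ * g = 1)
    (hv : g ∈ doubleCoset (signedPerm v α) (borelStar n) (borel n))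
    (hw : g ∈ doubleCoset (signedPerm w β) (borel n) (borel n)) {a b : ℕ}
    (hab : count v a b = count w a b) :
    cornerSum (fun r k => g r k ^ 2) a b = count v a b := by
  set X := coordProj n a * g * coordProj n b with hX
  set Y := coordCoproj n a * g * coordProj n b with hY
  have hidem : ∀ m, (coordProj n m)ᵀ * coordProj n m = coordProj n m := by
    intro m
    rw [coordProj, Matrix.diagonal_transpose, Matrix.diagonal_mul_diagonal]
    congr 1; funext r; split_ifs <;> simp
  have hidem' : ∀ m, (coordCoproj n m)ᵀ * coordCoproj n m = coordCoproj n m := by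
    intro m
    rw [coordCoproj, Matrix.diagonal_transpose, Matrix.diagonal_mul_diagonal]
    congr 1; funext r; split_ifs <;> simp
  -- `X` and `Y` are the upper and lower parts of the first `b` columns, which are orthonormal.
  have hsum : Xᵀ * X + Yᵀ * Y = coordProj n b := by
    calc Xᵀ * X + Yᵀ * Y
        = (coordProj n b)ᵀ * gᵀ * ((coordProj n a)ᵀ * coordProj n a
            + (coordCoproj n a)ᵀ * coordCoproj n a) * g * coordProj n b := by
          simp only [hX, hY, Matrix.transpose_mul, mul_add, add_mul, mul_assoc]
      _ = (coordProj n b)ᵀ * (gᵀ * g) * coordProj n b := by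
          rw [hidem, hidem', coordProj_add_coordCoproj, mul_one]; simp only [mul_assoc]
      _ = coordProj n b := by rw [hgo, mul_one, hidem]
  have hps : ∀ Z : Matrix (Fin n) (Fin n) ℝ, (Zᵀ * Z).PosSemidef := fun Z => by
    simpa using Matrix.posSemidef_conjTranspose_mul_self Z
  have hco : (coordCoproj n b).PosSemidef := by rw [← hidem']; exact hps _
  -- Each Gram matrix is bounded by the identity, because its complement is a sum of the other one
  -- and a projection.
  have h1 : (1 - Xᵀ * X) = Yᵀ * Y + coordCoproj n b := by
    rw [← coordProj_add_coordCoproj n b, ← hsum]; abel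
  have h2 : (1 - Yᵀ * Y) = Xᵀ * X + coordCoproj n b := by
    rw [← coordProj_add_coordCoproj n b, ← hsum]; abel
  have hXt := trace_le_rank (hps X) (by rw [h1]; exact (hps Y).add hco)
  have hYt := trace_le_rank (hps Y) (by rw [h2]; exact (hps X).add hco)
  rw [Matrix.rank_transpose_mul_self] at hXt hYt
  have hXr : (X.rank : ℝ) ≤ count v a b := by exact_mod_cast rank_upperLeft_le hv a b
  have hYr : (Y.rank : ℝ) ≤ _ := Nat.cast_le.2 (rank_lowerLeft_le hw a b)
  have htr := congrArg Matrix.trace hsum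
  have hb : (coordProj n b).trace
      = ((Finset.univ.filter fun k : Fin n => (k : ℕ) < b).card : ℝ) := by
    simp [coordProj, Matrix.trace_diagonal]
  have hcard : (Finset.univ.filter fun k : Fin n => (k : ℕ) < b).card
      = count w a b + (Finset.univ.filter fun k : Fin n => (k : ℕ) < b ∧ ¬ (w k : ℕ) < a).card := by
    rw [count, ← Finset.filter_filter, ← Finset.filter_filter]
    exact (Finset.card_filter_add_card_filter_not _).symm
  rw [Matrix.trace_add, hb, hcard, ← hab, Nat.cast_add] at htr
  rw [← trace_upperLeft]
  -- The two traces add up to the sum of their upper bounds, so each one attains its bound.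
  linarith

lemma cornerSum_second_difference {n : ℕ} (f : Fin n → Fin n → ℝ) (a b : Fin n) :
    cornerSum f (a + 1) (b + 1) - cornerSum f a (b + 1) - cornerSum f (a + 1) b
      + cornerSum f a b = f a b := by
  simp only [cornerSum, ← Finset.sum_sub_distrib, ← Finset.sum_add_distrib]
  rw [Finset.sum_eq_single a, Finset.sum_eq_single b]
  · simp
  · intro k _ hk
    have : (k : ℕ) ≠ b := fun h => hk (Fin.ext h)
    by_cases h1 : (k : ℕ) < b
    · simp [h1, Nat.lt_succ_of_lt h1]
    · simp [h1, show ¬ (k : ℕ) < b + 1 by omega]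
  · simp
  · intro r _ hr
    have : (r : ℕ) ≠ a := fun h => hr (Fin.ext h)
    refine Finset.sum_eq_zero fun k _ => ?_
    by_cases h1 : (r : ℕ) < a
    · simp [h1, Nat.lt_succ_of_lt h1]
    · simp [h1, show ¬ (r : ℕ) < a + 1 by omega]
  · simp

lemma cornerSum_indicator {n : ℕ} (v : Equiv.Perm (Fin n)) (a b : ℕ) :
    cornerSum (fun r k => if r = v k then 1 else 0) a b = count v a b := by
  rw [cornerSum, Finset.sum_comm, count, Finset.card_filter, Nat.cast_sum]
  refine Finset.sum_congr rfl fun k _ => ?_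
  rw [Finset.sum_eq_single (v k)]
  · by_cases hr : (v k : ℕ) < a <;> by_cases hk : (k : ℕ) < b <;> simp [hr, hk]
  · intro r _ hr
    simp [hr]
  · simp

/-- `v` and `w` have the same number of points in the four upper left corners at the entry
`(a, b)`. -/
def CornersAgree {n : ℕ} (v w : Equiv.Perm (Fin n)) (a b : Fin n) : Prop :=
  ∀ s < 2, ∀ t < 2, count v (a + s) (b + t) = count w (a + s) (b + t)

/-- The squares of the entries of `g` and the permutation matrix of `v` have the same four corner
sums around `(a, b)`; inclusion-exclusion recovers the entry. -/
lemma entry_sq_eq {n : ℕ} {g : Matrix (Fin n) (Fin n) ℝ} {v w : Equiv.Perm (Fin n)}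
    {α β : Fin n → ℤˣ} (hgo : gᵀ * g = 1)
    (hv : g ∈ doubleCoset (signedPerm v α) (borelStar n) (borel n))
    (hw : g ∈ doubleCoset (signedPerm w β) (borel n) (borel n)) {a b : Fin n}
    (hab : CornersAgree v w a b) : g a b ^ 2 = if a = v b then 1 else 0 := by
  have h00 := cornerSum_sq_eq_count hgo hv hw (hab 0 (by norm_num) 0 (by norm_num))
  have h01 := cornerSum_sq_eq_count hgo hv hw (hab 0 (by norm_num) 1 (by norm_num))
  have h10 := cornerSum_sq_eq_count hgo hv hw (hab 1 (by norm_num) 0 (by norm_num))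
  have h11 := cornerSum_sq_eq_count hgo hv hw (hab 1 (by norm_num) 1 (by norm_num))
  rw [← cornerSum_indicator] at h00 h01 h10 h11
  simp only [add_zero] at h00 h01 h10 h11
  have h1 := cornerSum_second_difference (fun r k => g r k ^ 2) a b
  rw [h00, h01, h10, h11, cornerSum_second_difference (fun r k => if r = v k then 1 else 0)] at h1
  exact h1.symm

/-! ### Matrices with a distinguished block -/

section BlockEmbed

variable {d n : ℕ} {p : Fin d → Fin n}

lemma blockEmbed_apply_block (hp : Function.Injective p) (M : Matrix (Fin d) (Fin d) ℝ)
    (R : Matrix (Fin n) (Fin n) ℝ) (x y : Fin d) : blockEmbed p M R (p x) (p y) = M x y := by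
  simp only [blockEmbed, Matrix.of_apply, hp.eq_iff]
  rw [if_pos (Or.inl ⟨x, rfl⟩), Finset.sum_eq_single x, Finset.sum_eq_single y] <;>
    simp +contextual

lemma blockEmbed_apply_left (M : Matrix (Fin d) (Fin d) ℝ)
    (R : Matrix (Fin n) (Fin n) ℝ) (x : Fin d) {b : Fin n} (hb : ∀ y, p y ≠ b) :
    blockEmbed p M R (p x) b = 0 := by
  simp only [blockEmbed, Matrix.of_apply]
  rw [if_pos (Or.inl ⟨x, rfl⟩)]
  simp [hb]

lemma blockEmbed_apply_right (M : Matrix (Fin d) (Fin d) ℝ)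
    (R : Matrix (Fin n) (Fin n) ℝ) {a : Fin n} (ha : ∀ y, p y ≠ a) (x : Fin d) :
    blockEmbed p M R a (p x) = 0 := by
  simp only [blockEmbed, Matrix.of_apply]
  rw [if_pos (Or.inr ⟨x, rfl⟩)]
  simp [ha]

lemma blockEmbed_apply_off (M : Matrix (Fin d) (Fin d) ℝ)
    (R : Matrix (Fin n) (Fin n) ℝ) {a b : Fin n} (ha : ∀ y, p y ≠ a) (hb : ∀ y, p y ≠ b) :
    blockEmbed p M R a b = R a b := by
  simp only [blockEmbed, Matrix.of_apply]
  rw [if_neg]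
  simp [ha, hb]

lemma exists_or_forall_ne (p : Fin d → Fin n) (a : Fin n) : (∃ x, p x = a) ∨ ∀ x, p x ≠ a := by
  by_cases h : ∃ x, p x = a
  · exact Or.inl h
  · exact Or.inr fun x hx => h ⟨x, hx⟩

lemma eq_blockEmbed (hp : Function.Injective p) {g R : Matrix (Fin n) (Fin n) ℝ}
    {M : Matrix (Fin d) (Fin d) ℝ}
    (hM : ∀ x y, g (p x) (p y) = M x y)
    (hl : ∀ x b, (∀ y, p y ≠ b) → g (p x) b = 0)
    (hr : ∀ a x, (∀ y, p y ≠ a) → g a (p x) = 0)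
    (ho : ∀ a b, (∀ y, p y ≠ a) → (∀ y, p y ≠ b) → g a b = R a b) : g = blockEmbed p M R := by
  ext a b
  rcases exists_or_forall_ne p a with ⟨x, rfl⟩ | ha <;>
    rcases exists_or_forall_ne p b with ⟨y, rfl⟩ | hb
  · rw [blockEmbed_apply_block hp, hM]
  · rw [blockEmbed_apply_left _ _ _ hb, hl _ _ hb]
  · rw [blockEmbed_apply_right _ _ ha, hr _ _ ha]
  · rw [blockEmbed_apply_off _ _ ha hb, ho _ _ ha hb]

lemma blockEmbed_inj (hp : Function.Injective p) {M M' : Matrix (Fin d) (Fin d) ℝ}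
    {R R' : Matrix (Fin n) (Fin n) ℝ} : blockEmbed p M R = blockEmbed p M' R' ↔
      M = M' ∧ ∀ a b, (∀ y, p y ≠ a) → (∀ y, p y ≠ b) → R a b = R' a b := by
  constructor
  · intro h
    refine ⟨?_, fun a b ha hb => ?_⟩
    · ext x y
      rw [← blockEmbed_apply_block hp M R, h, blockEmbed_apply_block hp]
    · rw [← blockEmbed_apply_off M R ha hb, h, blockEmbed_apply_off _ _ ha hb]
  · rintro ⟨rfl, h⟩
    exact eq_blockEmbed hp (blockEmbed_apply_block hp _ _)
      (fun x b hb => blockEmbed_apply_left _ _ _ hb) (fun a x ha => blockEmbed_apply_right _ _ ha _)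
      fun a b ha hb => by rw [blockEmbed_apply_off _ _ ha hb, h a b ha hb]

lemma sum_eq_sum_block_add (hp : Function.Injective p) {A : Type*} [AddCommMonoid A]
    (f : Fin n → A) :
    ∑ c, f c = ∑ x, f (p x) + ∑ c ∈ Finset.univ.filter (fun c => ∀ x, p x ≠ c), f c := by
  rw [← Finset.sum_filter_add_sum_filter_not Finset.univ (fun c => ∃ x, p x = c) f]
  congr 1
  · rw [← Finset.sum_image (f := f) (s := Finset.univ) (g := p) fun x _ y _ h => hp h]
    refine Finset.sum_congr ?_ fun _ _ => rfl
    ext c; simp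
  · refine Finset.sum_congr ?_ fun _ _ => rfl
    ext c; simp

/-- The hypothesis `h` says that no path between two indices off the block passes through the block.
Without it `R * R'` would contain terms absent from the product on the left. -/
lemma blockEmbed_mul (hp : Function.Injective p) (M M' : Matrix (Fin d) (Fin d) ℝ)
    {R R' : Matrix (Fin n) (Fin n) ℝ}
    (h : ∀ a b, (∀ y, p y ≠ a) → (∀ y, p y ≠ b) → ∀ x, R a (p x) * R' (p x) b = 0) :
    blockEmbed p M R * blockEmbed p M' R' = blockEmbed p (M * M') (R * R') := by
  refine eq_blockEmbed hp (fun x y => ?_) (fun x b hb => ?_) (fun a x ha => ?_)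
    (fun a b ha hb => ?_)
  · rw [Matrix.mul_apply, sum_eq_sum_block_add hp, Finset.sum_eq_zero (s := Finset.filter _ _),
      add_zero, Matrix.mul_apply]
    · simp only [blockEmbed_apply_block hp]
    · intro c hc
      rw [blockEmbed_apply_left _ _ _ (Finset.mem_filter.1 hc).2, zero_mul]
  · rw [Matrix.mul_apply, sum_eq_sum_block_add hp, Finset.sum_eq_zero (s := Finset.filter _ _),
      add_zero]
    · exact Finset.sum_eq_zero fun z _ => by rw [blockEmbed_apply_left _ _ _ hb, mul_zero]
    · intro c hc
      rw [blockEmbed_apply_left _ _ _ (Finset.mem_filter.1 hc).2, zero_mul]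
  · rw [Matrix.mul_apply, sum_eq_sum_block_add hp, Finset.sum_eq_zero (s := Finset.filter _ _),
      add_zero]
    · exact Finset.sum_eq_zero fun z _ => by rw [blockEmbed_apply_right _ _ ha, zero_mul]
    · intro c hc
      rw [blockEmbed_apply_right _ _ (Finset.mem_filter.1 hc).2, mul_zero]
  · rw [Matrix.mul_apply, Matrix.mul_apply, sum_eq_sum_block_add hp,
      sum_eq_sum_block_add hp (fun c => R a c * R' c b)]
    congr 1
    · refine Finset.sum_congr rfl fun z _ => ?_
      rw [h a b ha hb, blockEmbed_apply_right _ _ ha, zero_mul]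
    · refine Finset.sum_congr rfl fun c hc => ?_
      have hc' := (Finset.mem_filter.1 hc).2
      rw [blockEmbed_apply_off _ _ ha hc', blockEmbed_apply_off _ _ hc' hb]

lemma blockEmbed_one_mul (hp : Function.Injective p) (M M' : Matrix (Fin d) (Fin d) ℝ)
    (R : Matrix (Fin n) (Fin n) ℝ) :
    blockEmbed p M 1 * blockEmbed p M' R = blockEmbed p (M * M') R := by
  rw [blockEmbed_mul hp, one_mul]
  intro a b ha _ x
  rw [Matrix.one_apply_ne (ha x).symm, zero_mul]

lemma blockEmbed_mul_one (hp : Function.Injective p) (M M' : Matrix (Fin d) (Fin d) ℝ)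
    (R : Matrix (Fin n) (Fin n) ℝ) :
    blockEmbed p M R * blockEmbed p M' 1 = blockEmbed p (M * M') R := by
  rw [blockEmbed_mul hp, mul_one]
  intro a b _ hb x
  rw [Matrix.one_apply_ne (hb x), mul_zero]

lemma blockEmbed_one_one (hp : Function.Injective p) :
    blockEmbed p (1 : Matrix (Fin d) (Fin d) ℝ) 1 = 1 := by
  refine (eq_blockEmbed hp (fun x y => ?_) (fun x b hb => ?_) (fun a x ha => ?_)
    (fun a b _ _ => rfl)).symm
  · simp [Matrix.one_apply, hp.eq_iff]
  · exact Matrix.one_apply_ne (hb x)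
  · exact Matrix.one_apply_ne (ha x).symm

lemma blockEmbed_transpose (hp : Function.Injective p) (M : Matrix (Fin d) (Fin d) ℝ)
    (R : Matrix (Fin n) (Fin n) ℝ) : (blockEmbed p M R)ᵀ = blockEmbed p Mᵀ Rᵀ :=
  eq_blockEmbed hp (fun x y => by simp [blockEmbed_apply_block hp])
    (fun x b hb => blockEmbed_apply_right _ _ hb _) (fun a x ha => blockEmbed_apply_left _ _ _ ha)
    fun a b ha hb => blockEmbed_apply_off _ _ hb ha

lemma blockEmbed_blockTriangular (hp : StrictMono p) {M : Matrix (Fin d) (Fin d) ℝ}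
    (hM : M.BlockTriangular id) : (blockEmbed p M 1).BlockTriangular id := by
  intro a b hab
  replace hab : b < a := hab
  rcases exists_or_forall_ne p a with ⟨x, rfl⟩ | ha <;>
    rcases exists_or_forall_ne p b with ⟨y, rfl⟩ | hb
  · rw [blockEmbed_apply_block hp.injective]
    exact hM (show y < x from hp.lt_iff_lt.1 hab)
  · exact blockEmbed_apply_left _ _ _ hb
  · exact blockEmbed_apply_right _ _ ha _
  · rw [blockEmbed_apply_off _ _ ha hb, Matrix.one_apply_ne hab.ne']

lemma blockEmbed_mem_borel (hp : StrictMono p) {M : Matrix (Fin d) (Fin d) ℝ}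
    (hM : M ∈ borel d) : blockEmbed p M 1 ∈ borel n := by
  refine borel_of_diag_ne_zero (blockEmbed_blockTriangular hp hM.2) fun a => ?_
  rcases exists_or_forall_ne p a with ⟨x, rfl⟩ | ha
  · rw [blockEmbed_apply_block hp.injective]
    exact diag_ne_zero_of_borel hM x
  · rw [blockEmbed_apply_off _ _ ha ha]
    simp

lemma blockEmbed_mem_borelPos (hp : StrictMono p) {M : Matrix (Fin d) (Fin d) ℝ}
    (hM : M ∈ borelPos d) : blockEmbed p M 1 ∈ borelPos n := by
  refine ⟨blockEmbed_blockTriangular hp hM.1, fun a => ?_⟩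
  rcases exists_or_forall_ne p a with ⟨x, rfl⟩ | ha
  · rw [blockEmbed_apply_block hp.injective]
    exact hM.2 x
  · rw [blockEmbed_apply_off _ _ ha ha]
    simp

lemma blockEmbed_mem_borelStar (hp : StrictMono p) {M : Matrix (Fin d) (Fin d) ℝ}
    (hM : M ∈ borelStar d) : blockEmbed p M 1 ∈ borelStar n := by
  show _ᵀ ∈ borel n
  rw [blockEmbed_transpose hp.injective, Matrix.transpose_one]
  exact blockEmbed_mem_borel hp hM

lemma blockEmbed_mulVec (hp : Function.Injective p) (M : Matrix (Fin d) (Fin d) ℝ)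
    (R : Matrix (Fin n) (Fin n) ℝ) (x : Fin n → ℝ) (r : Fin d) :
    (blockEmbed p M R *ᵥ x) (p r) = (M *ᵥ (x ∘ p)) r := by
  rw [Matrix.mulVec, dotProduct, sum_eq_sum_block_add hp,
    Finset.sum_eq_zero (s := Finset.filter _ _), add_zero, Matrix.mulVec, dotProduct]
  · simp only [blockEmbed_apply_block hp, Function.comp]
  · intro c hc
    rw [blockEmbed_apply_left _ _ _ (Finset.mem_filter.1 hc).2, zero_mul]

lemma perm_apply_off {u : Equiv.Perm (Fin n)} {us : Equiv.Perm (Fin d)}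
    (hu : ∀ x, u (p x) = p (us x)) {k : Fin n} (hk : ∀ x, p x ≠ k) (x : Fin d) : p x ≠ u k := by
  intro h
  apply hk (us⁻¹ x)
  apply u.injective
  rw [hu, ← h]
  simp

lemma signedPerm_eq_blockEmbed (hp : Function.Injective p) {u v : Equiv.Perm (Fin n)}
    {us : Equiv.Perm (Fin d)} (hu : ∀ x, u (p x) = p (us x)) {ε η : Fin n → ℤˣ}
    (hoff : ∀ k, (∀ x, p x ≠ k) → u k = v k ∧ ε k = η k) :
    signedPerm u ε = blockEmbed p (signedPerm us (ε ∘ p)) (signedPerm v η) := by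
  refine eq_blockEmbed hp (fun x y => ?_) (fun x b hb => ?_) (fun a x ha => ?_)
    (fun a b _ hb => ?_)
  · simp [signedPerm_apply, hu, hp.eq_iff]
  · rw [signedPerm_apply, if_neg (perm_apply_off hu hb x)]
  · rw [signedPerm_apply, hu, if_neg (ha _).symm]
  · rw [signedPerm_apply, signedPerm_apply, (hoff b hb).1, (hoff b hb).2]

lemma blockEmbed_signedPerm (hp : Function.Injective p) {u v : Equiv.Perm (Fin n)}
    {us : Equiv.Perm (Fin d)} (hu : ∀ x, u (p x) = p (us x))
    (hoff : ∀ k, (∀ x, p x ≠ k) → u k = v k) (εs : Fin d → ℤˣ) (η : Fin n → ℤˣ) :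
    blockEmbed p (signedPerm us εs) (signedPerm v η) = signedPerm u (Function.extend p εs η) := by
  rw [signedPerm_eq_blockEmbed (v := v) (η := η) hp hu]
  · congr 2
    funext x
    simp [hp.extend_apply]
  · intro k hk
    exact ⟨hoff k hk, Function.extend_apply' _ _ _ fun ⟨x, hx⟩ => hk x hx⟩

/-- The block is stable under `v`, so the signed permutation never leads from the block to its
complement, as `blockEmbed_mul` requires. -/
lemma blockEmbed_signedPerm_sq (hp : Function.Injective p) {v : Equiv.Perm (Fin n)}
    {vs : Equiv.Perm (Fin d)} (hv : v * v = 1) (hvs : ∀ x, v (p x) = p (vs x)) {η : Fin n → ℤˣ}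
    (hη : ∀ k, η (v k) = η k) {M : Matrix (Fin d) (Fin d) ℝ} (hM : M * M = 1) :
    blockEmbed p M (signedPerm v η) * blockEmbed p M (signedPerm v η) = 1 := by
  rw [blockEmbed_mul hp, hM, signedPerm_mul_self_eq_one.2 ⟨hv, hη⟩, blockEmbed_one_one hp]
  intro a b ha _ x
  rw [signedPerm_apply, hvs, if_neg (ha _).symm, zero_mul]

lemma blockEmbed_signedPerm_mem_grassm (hp : Function.Injective p) {v : Equiv.Perm (Fin n)}
    {vs : Equiv.Perm (Fin d)} (hv : v * v = 1) (hvs : ∀ x, v (p x) = p (vs x)) {η : Fin n → ℤˣ}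
    (hη : ∀ k, η (v k) = η k) {M : Matrix (Fin d) (Fin d) ℝ} (hM : M * M = 1) (hMt : Mᵀ = M) :
    blockEmbed p M (signedPerm v η) ∈ grassm n := by
  have h := blockEmbed_signedPerm_sq hp hv hvs hη hM
  refine ⟨(Matrix.mem_orthogonalGroup_iff' _ _).2 ?_, h⟩
  rw [blockEmbed_transpose hp, hMt, signedPerm_transpose hv hη, h]

end BlockEmbed

/-! ### Comparing a permutation with its block -/

section Cuts

variable {d n : ℕ} {p : Fin d → Fin n}

/-- By monotonicity the positions with value below `m` form an initial segment, so each corner of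
the large matrix cuts out a corner of the block. -/
lemma exists_cut (hp : StrictMono p) (m : ℕ) : ∃ t : ℕ, t ≤ d ∧ ∀ z, (p z : ℕ) < m ↔ (z : ℕ) < t := by
  classical
  have hex : ∃ t, ∀ z : Fin d, t ≤ (z : ℕ) → m ≤ p z := ⟨d, fun z hz => absurd z.2 (by omega)⟩
  refine ⟨Nat.find hex, Nat.find_min' hex fun z hz => absurd z.2 (by omega), fun z => ?_⟩
  constructor
  · intro h
    by_contra hz
    have := Nat.find_spec hex z (not_lt.1 hz)
    omega
  · intro h
    have h1 := Nat.find_min hex h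
    push Not at h1
    obtain ⟨z', hz', h2⟩ := h1
    have : p z ≤ p z' := hp.monotone (Fin.le_def.2 hz')
    exact lt_of_le_of_lt (Fin.le_def.1 this) h2

/-- The difference between the counts for `v` and `w` comes from the block alone. The additive form
avoids subtraction of natural numbers. -/
lemma count_add_count (hp : Function.Injective p) {v w : Equiv.Perm (Fin n)}
    {vs ws : Equiv.Perm (Fin d)} (hv : ∀ x, v (p x) = p (vs x)) (hw : ∀ x, w (p x) = p (ws x))
    (hoff : ∀ k, (∀ x, p x ≠ k) → w k = v k) {a b a' b' : ℕ}
    (ha : ∀ z, (p z : ℕ) < a ↔ (z : ℕ) < a') (hb : ∀ z, (p z : ℕ) < b ↔ (z : ℕ) < b') :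
    count v a b + count ws a' b' = count w a b + count vs a' b' := by
  simp only [count, Finset.card_filter]
  rw [sum_eq_sum_block_add hp, sum_eq_sum_block_add hp (fun k => if (k : ℕ) < b ∧ (w k : ℕ) < a
    then 1 else 0)]
  simp only [hv, hw, ha, hb]
  have h : ∑ c ∈ Finset.univ.filter (fun c => ∀ x, p x ≠ c),
        (if (c : ℕ) < b ∧ (w c : ℕ) < a then 1 else 0)
      = ∑ c ∈ Finset.univ.filter (fun c => ∀ x, p x ≠ c),
        (if (c : ℕ) < b ∧ (v c : ℕ) < a then 1 else 0) :=
    Finset.sum_congr rfl fun c hc => by rw [hoff c (Finset.mem_filter.1 hc).2]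
  rw [h]
  ring

lemma cornersAgree_of_block (hp : StrictMono p) {v w : Equiv.Perm (Fin n)}
    {vs ws : Equiv.Perm (Fin d)} (hv : ∀ x, v (p x) = p (vs x)) (hw : ∀ x, w (p x) = p (ws x))
    (hoff : ∀ k, (∀ x, p x ≠ k) → w k = v k) {x y : Fin d} (h : CornersAgree vs ws x y) :
    CornersAgree v w (p x) (p y) := by
  have hcut : ∀ (x : Fin d) (s : ℕ), s < 2 → ∀ z, (p z : ℕ) < p x + s ↔ (z : ℕ) < x + s := by
    intro x s hs z
    obtain rfl | rfl : s = 0 ∨ s = 1 := by omega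
    -- For `s = 0` and `s = 1` these are the strict and the weak inequality, both preserved by an
    -- increasing map.
    · simpa using hp.lt_iff_lt
    · simpa [Nat.lt_succ_iff] using hp.le_iff_le
  intro s hs t ht
  have h1 := count_add_count hp.injective hv hw hoff (hcut x s hs) (hcut y t ht)
  have h2 := h s hs t ht
  omega

/-- Away from the block, the entries of `v` do not lie in the two rectangles in which `v` and `w`
have different numbers of points in the upper left corner. -/
lemma cornersAgree_off (hp : StrictMono p) {v w : Equiv.Perm (Fin n)}
    {vs ws : Equiv.Perm (Fin d)} (hvv : v * v = 1)
    (hv : ∀ x, v (p x) = p (vs x)) (hw : ∀ x, w (p x) = p (ws x))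
    (hoff : ∀ k, (∀ x, p x ≠ k) → w k = v k) {I J : Fin d}
    (hrise : ¬ ∃ k, p I < k ∧ k < p J ∧ v (p I) < v k ∧ v k < v (p J))
    (hloc : ∀ a ≤ d, ∀ b ≤ d, count vs a b = count ws a b ∨
      ((I : ℕ) < b ∧ b ≤ J ∧ (vs I : ℕ) < a ∧ a ≤ vs J) ∨
      ((I : ℕ) < a ∧ a ≤ J ∧ (vs I : ℕ) < b ∧ b ≤ vs J))
    {k : Fin n} (hk : ∀ x, p x ≠ k) : CornersAgree v w (v k) k := by
  have hvk : ∀ x, p x ≠ v k := perm_apply_off hv hk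
  have hvvk : v (v k) = k := by simpa using Equiv.congr_fun hvv k
  obtain ⟨a', ha', ha⟩ := exists_cut hp (v k)
  obtain ⟨b', hb', hb⟩ := exists_cut hp k
  have hlt : ∀ {m : Fin n}, (∀ x, p x ≠ m) → ∀ z, ¬ (p z : ℕ) < m ↔ m < p z := by
    intro m hm z
    rw [← Fin.lt_def, not_lt]
    exact ⟨fun h => lt_of_le_of_ne h (hm z).symm, le_of_lt⟩
  -- An index off the block and its successor cut the block at the same place, so one comparison of
  -- counts serves all four corners.
  have hcut : ∀ {m : Fin n} {t : ℕ}, (∀ x, p x ≠ m) → (∀ z, (p z : ℕ) < m ↔ (z : ℕ) < t) →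
      ∀ s < 2, ∀ z, (p z : ℕ) < m + s ↔ (z : ℕ) < t := by
    intro m t hm ht s hs z
    rw [← ht]
    have : (p z : ℕ) ≠ m := fun h => hm z (Fin.ext h)
    omega
  have hcount : count vs a' b' = count ws a' b' := by
    rcases hloc a' ha' b' hb' with h | ⟨h1, h2, h3, h4⟩ | ⟨h1, h2, h3, h4⟩
    · exact h
    · refine absurd ⟨k, ?_, ?_, ?_, ?_⟩ hrise
      · exact Fin.lt_def.2 ((hb _).2 h1)
      · rw [← hlt hk, hb]; omega
      · rw [hv]; exact Fin.lt_def.2 ((ha _).2 h3)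
      · rw [hv, ← hlt hvk, ha]; omega
    -- The second rectangle is the transpose of the first; as `v` is an involution, the forbidden
    -- point is now `v k`.
    · refine absurd ⟨v k, ?_, ?_, ?_, ?_⟩ hrise
      · exact Fin.lt_def.2 ((ha _).2 h1)
      · rw [← hlt hvk, ha]; omega
      · rw [hv, hvvk]; exact Fin.lt_def.2 ((hb _).2 h3)
      · rw [hv, hvvk, ← hlt hk, hb]; omega
  intro s hs t ht
  have h1 := count_add_count hp.injective hv hw hoff (hcut hvk ha s hs) (hcut hk hb t ht)
  omega

/-! ### The block of an element of the generalized Richardson variety -/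

lemma transpose_eq_of_mem_grassm {g : Matrix (Fin n) (Fin n) ℝ} (hg : g ∈ grassm n) :
    gᵀ = g ∧ gᵀ * g = 1 := by
  have h1 : gᵀ * g = 1 := (Matrix.mem_orthogonalGroup_iff' _ _).1 hg.1
  refine ⟨?_, h1⟩
  calc gᵀ = gᵀ * (g * g) := by rw [hg.2, mul_one]
    _ = g := by rw [← mul_assoc, h1, one_mul]

/-- The column has norm 1, so an entry `±1` leaves no room for others. -/
lemma column_eq_zero {g : Matrix (Fin n) (Fin n) ℝ} (hg : gᵀ * g = 1) {a k : Fin n}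
    (h : g a k ^ 2 = 1) {r : Fin n} (hr : r ≠ a) : g r k = 0 := by
  have h1 : ∑ r, g r k ^ 2 = 1 := by
    have := congrFun (congrFun hg k) k
    simpa [Matrix.mul_apply, sq] using this
  rw [← Finset.add_sum_erase _ _ (Finset.mem_univ a), h, add_eq_left,
    Finset.sum_eq_zero_iff_of_nonneg fun _ _ => sq_nonneg _] at h1
  exact pow_eq_zero_iff (two_ne_zero) |>.1 (h1 r (by simp [hr]))

/-- The conditions which the block of an element of the generalized Richardson variety satisfies. -/
structure IsRichardsonBlock (vs ws : Equiv.Perm (Fin d)) (M : Matrix (Fin d) (Fin d) ℝ) : Prop where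
  transpose_eq : Mᵀ = M
  sq_eq : M * M = 1
  entry_eq_zero : ∀ x y, CornersAgree vs ws x y → x ≠ vs y → M x y = 0
  exists_lower : ∀ k, ∃ x : Fin d → ℝ, (∀ j, k < j → x j = 0) ∧ x k ≠ 0 ∧
    (∀ r, r < vs k → (M *ᵥ x) r = 0) ∧ (M *ᵥ x) (vs k) ≠ 0
  exists_upper : ∀ k, ∃ x : Fin d → ℝ, (∀ j, k < j → x j = 0) ∧ x k ≠ 0 ∧
    (∀ r, ws k < r → (M *ᵥ x) r = 0) ∧ (M *ᵥ x) (ws k) ≠ 0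

/-- Reduction to size `d`: off the block each column of `g` has an entry `±1` at the place given by
`v`, hence nothing else, and by symmetry the rows as well. The incidence conditions restrict to the
block because `p` is increasing. -/
lemma exists_block_of_mem_richardson (hp : StrictMono p) {v w : Equiv.Perm (Fin n)}
    {vs ws : Equiv.Perm (Fin d)} (hvv : v * v = 1)
    (hv : ∀ x, v (p x) = p (vs x)) (hw : ∀ x, w (p x) = p (ws x))
    (hoff : ∀ k, (∀ x, p x ≠ k) → w k = v k) {I J : Fin d}
    (hrise : ¬ ∃ k, p I < k ∧ k < p J ∧ v (p I) < v k ∧ v k < v (p J))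
    (hloc : ∀ a ≤ d, ∀ b ≤ d, count vs a b = count ws a b ∨
      ((I : ℕ) < b ∧ b ≤ J ∧ (vs I : ℕ) < a ∧ a ≤ vs J) ∨
      ((I : ℕ) < a ∧ a ≤ J ∧ (vs I : ℕ) < b ∧ b ≤ vs J))
    {α β : Fin n → ℤˣ} {g : Matrix (Fin n) (Fin n) ℝ}
    (hg : g ∈ richardson (signedPerm v α) (signedPerm w β)) :
    ∃ (M : Matrix (Fin d) (Fin d) ℝ) (η : Fin n → ℤˣ), (∀ k, η (v k) = η k) ∧
      g = blockEmbed p M (signedPerm v η) ∧ IsRichardsonBlock vs ws M := by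
  obtain ⟨⟨hgr, hgv⟩, hgw⟩ := hg
  obtain ⟨hgt, hgo⟩ := transpose_eq_of_mem_grassm hgr
  have hsymm : ∀ a b, g a b = g b a := fun a b => congrFun (congrFun hgt b) a
  have hvvk : ∀ k, v (v k) = k := fun k => by simpa using Equiv.congr_fun hvv k
  have hsq : ∀ k, (∀ x, p x ≠ k) → g (v k) k ^ 2 = 1 := fun k hk => by
    rw [entry_sq_eq hgo hgv hgw (cornersAgree_off hp hvv hv hw hoff hrise hloc hk), if_pos rfl]
  have hcol : ∀ k, (∀ x, p x ≠ k) → ∀ r, r ≠ v k → g r k = 0 := fun k hk r hr =>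
    column_eq_zero hgo (hsq k hk) hr
  -- The signs on the block do not affect the matrix; the value 1 there keeps `η` invariant under
  -- `v`.
  have hex : ∀ k, ∃ σ : ℤˣ, ((∀ x, p x ≠ k) → ((σ : ℤ) : ℝ) = g (v k) k) ∧
      ((∃ x, p x = k) → σ = 1) := by
    intro k
    rcases exists_or_forall_ne p k with ⟨x, hx⟩ | hk
    · exact ⟨1, fun h => absurd hx (h x), fun _ => rfl⟩
    · obtain ⟨σ, hσ⟩ := exists_unit_cast (hsq k hk)
      exact ⟨σ, fun _ => hσ, fun ⟨x, hx⟩ => absurd hx (hk x)⟩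
  choose η hη1 hη2 using hex
  have hgeq : g = blockEmbed p (g.submatrix p p) (signedPerm v η) := by
    refine eq_blockEmbed hp.injective (fun x y => rfl) (fun x b hb => ?_) (fun a x ha => ?_)
      (fun a b _ hb => ?_)
    · exact hcol b hb _ (perm_apply_off hv hb x)
    · rw [hsymm]; exact hcol a ha _ (perm_apply_off hv ha x)
    · rw [signedPerm_apply]
      split_ifs with h
      · rw [h, hη1 b hb]
      · exact hcol b hb a h
  have hM : ∀ x : Fin n → ℝ, ∀ r, (g *ᵥ x) (p r) = ((g.submatrix p p) *ᵥ (x ∘ p)) r := by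
    intro x r
    conv_lhs => rw [hgeq]
    rw [blockEmbed_mulVec hp.injective]
  refine ⟨g.submatrix p p, η, fun k => ?_, hgeq, ?_, ?_, ?_, ?_, ?_⟩
  · rcases exists_or_forall_ne p k with ⟨x, hx⟩ | hk
    · rw [hη2 k ⟨x, hx⟩, hη2 (v k) ⟨vs x, by rw [← hv, hx]⟩]
    · rw [← unit_cast_inj, hη1 k hk, hη1 (v k) (perm_apply_off hv hk), hvvk, hsymm]
  · ext x y
    exact hsymm _ _
  · have h := hgr.2
    rw [hgeq, blockEmbed_mul hp.injective, ← blockEmbed_one_one hp.injective,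
      blockEmbed_inj hp.injective] at h
    · exact h.1
    · intro a b ha _ x
      rw [signedPerm_apply, hv, if_neg (ha _).symm, zero_mul]
  · intro x y hxy hne
    have h := entry_sq_eq hgo hgv hgw (cornersAgree_of_block hp hv hw hoff hxy)
    rw [hv, if_neg fun h => hne (hp.injective h)] at h
    exact pow_eq_zero_iff (two_ne_zero) |>.1 h
  · intro k
    obtain ⟨x, h1, h2, h3, h4⟩ := exists_vec_of_mem_borelStar hgv (p k)
    refine ⟨x ∘ p, fun j hj => h1 _ (hp hj), h2, fun r hr => ?_, ?_⟩
    · rw [← hM]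
      exact h3 _ (by rw [hv]; exact hp hr)
    · rw [← hM, ← hv]
      exact h4
  · intro k
    obtain ⟨x, h1, h2, h3, h4⟩ := exists_vec_of_mem_borel hgw (p k)
    refine ⟨x ∘ p, fun j hj => h1 _ (hp hj), h2, fun r hr => ?_, ?_⟩
    · rw [← hM]
      exact h3 _ (by rw [hw]; exact hp hr)
    · rw [← hM, ← hw]
      exact h4

end Cuts

/-! ### The circle and its half circles -/

lemma circle_re_sq_add_im_sq (z : Circle) : (z : ℂ).re ^ 2 + (z : ℂ).im ^ 2 = 1 := by
  have h := Circle.normSq_coe z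
  rw [Complex.normSq_apply] at h
  rw [← h]; ring

lemma exists_circle {c s : ℝ} (h : c ^ 2 + s ^ 2 = 1) :
    ∃ z : Circle, (z : ℂ).re = c ∧ (z : ℂ).im = s := by
  refine ⟨⟨⟨c, s⟩, ?_⟩, rfl, rfl⟩
  refine mem_sphere_zero_iff_norm.2 ?_
  rw [← sq_eq_sq₀ (norm_nonneg _) zero_le_one, ← Complex.normSq_eq_norm_sq,
    Complex.normSq_mk, one_pow, ← h]
  ring

/-- The open upper (`σ = 1`) or lower (`σ = -1`) half circle. -/
def halfCircle (σ : ℤˣ) : Set Circle := {z | 0 < ((σ : ℤ) : ℝ) * (z : ℂ).im}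

lemma im_exp_unit_mul (σ : ℤˣ) (t : ℝ) :
    (Circle.exp (((σ : ℤ) : ℝ) * t) : ℂ).im = ((σ : ℤ) : ℝ) * Real.sin t := by
  rw [Circle.coe_exp, Complex.exp_ofReal_mul_I_im]
  rcases Int.units_eq_one_or σ with rfl | rfl <;> simp

lemma halfCircle_eq_image (σ : ℤˣ) :
    halfCircle σ = (fun t : ℝ => Circle.exp (((σ : ℤ) : ℝ) * t)) '' Set.Ioo 0 Real.pi := by
  ext z
  simp only [halfCircle, Set.mem_ofPred_eq, Set.mem_image, Set.mem_Ioo]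
  constructor
  · intro hz
    -- Multiplication by `σ` turns the argument of a point of the half circle into a positive angle.
    set t := ((σ : ℤ) : ℝ) * Complex.arg z with ht
    have hexp : Circle.exp (((σ : ℤ) : ℝ) * t) = z := by
      rw [ht, ← mul_assoc, unit_cast_mul_self, one_mul, Circle.exp_arg]
    have him := im_exp_unit_mul σ t
    rw [hexp] at him
    rw [him, ← mul_assoc, unit_cast_mul_self, one_mul] at hz
    have h1 := Complex.neg_pi_lt_arg z
    have h2 := Complex.arg_le_pi z
    have h3 : -Real.pi ≤ t ∧ t ≤ Real.pi := by
      rcases Int.units_eq_one_or σ with rfl | rfl <;> simp only [ht] <;> norm_num <;>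
        constructor <;> linarith
    refine ⟨t, ⟨not_le.1 fun h => ?_, lt_of_le_of_ne h3.2 fun h => ?_⟩, hexp⟩
    · exact absurd hz (not_lt.2 (Real.sin_nonpos_of_nonpos_of_neg_pi_le h h3.1))
    · rw [h, Real.sin_pi] at hz
      exact lt_irrefl _ hz
  · rintro ⟨t, ⟨h0, h1⟩, rfl⟩
    rw [im_exp_unit_mul, ← mul_assoc, unit_cast_mul_self, one_mul]
    exact Real.sin_pos_of_pos_of_lt_pi h0 h1

lemma continuous_exp_unit_mul (σ : ℤˣ) :
    Continuous fun t : ℝ => Circle.exp (((σ : ℤ) : ℝ) * t) :=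
  Circle.exp.continuous.comp (continuous_const.mul continuous_id)

lemma isConnected_halfCircle (σ : ℤˣ) : IsConnected (halfCircle σ) := by
  rw [halfCircle_eq_image]
  exact (isConnected_Ioo Real.pi_pos).image _ (continuous_exp_unit_mul σ).continuousOn

/-- The weak inequality defines a closed set, which gives one inclusion. For the other, the two end
points are the values at `0` and `π` of the parametrization of the open half circle. -/
lemma closure_halfCircle (σ : ℤˣ) :
    closure (halfCircle σ) = halfCircle σ ∪ {z : Circle | (z : ℂ).im = 0} := by
  apply Set.Subset.antisymm
  · have hc : IsClosed {z : Circle | 0 ≤ ((σ : ℤ) : ℝ) * (z : ℂ).im} :=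
      isClosed_le continuous_const
        (continuous_const.mul (Complex.continuous_im.comp continuous_subtype_val))
    have hsub : halfCircle σ ⊆ {z : Circle | 0 ≤ ((σ : ℤ) : ℝ) * (z : ℂ).im} :=
      fun z (hz : 0 < ((σ : ℤ) : ℝ) * (z : ℂ).im) => hz.le
    refine (closure_minimal hsub hc).trans fun z hz => ?_
    rcases eq_or_lt_of_le (show 0 ≤ ((σ : ℤ) : ℝ) * (z : ℂ).im from hz) with h | h
    · exact Or.inr ((mul_eq_zero.1 h.symm).resolve_left (unit_cast_ne_zero σ))
    · exact Or.inl h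
  · refine Set.union_subset subset_closure fun z hz => ?_
    have hcl : (fun t : ℝ => Circle.exp (((σ : ℤ) : ℝ) * t)) '' Set.Icc 0 Real.pi
        ⊆ closure (halfCircle σ) := by
      rw [halfCircle_eq_image, ← closure_Ioo Real.pi_pos.ne]
      exact image_closure_subset_closure_image (continuous_exp_unit_mul σ)
    apply hcl
    have h1 := circle_re_sq_add_im_sq z
    rw [show (z : ℂ).im = 0 from hz] at h1
    have h2 : ((z : ℂ).re - 1) * ((z : ℂ).re + 1) = 0 := by linarith
    rcases mul_eq_zero.1 h2 with h | h
    · refine ⟨0, ⟨le_rfl, Real.pi_pos.le⟩, ?_⟩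
      apply Circle.ext
      apply Complex.ext
      · simp; linarith
      · simpa using hz.symm
    · refine ⟨Real.pi, ⟨Real.pi_pos.le, le_rfl⟩, ?_⟩
      apply Circle.ext
      apply Complex.ext
      · rw [Circle.coe_exp, Complex.exp_ofReal_mul_I_re]
        rcases Int.units_eq_one_or σ with rfl | rfl <;> simp <;> linarith
      · rw [im_exp_unit_mul]; simpa using hz.symm

lemma finite_circle_axes : {z : Circle | (z : ℂ).re = 0 ∨ (z : ℂ).im = 0}.Finite := by
  have hinj : Function.Injective fun z : Circle => ((z : ℂ).re, (z : ℂ).im) := by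
    intro z z' h
    exact Circle.ext (Complex.ext (congrArg Prod.fst h) (congrArg Prod.snd h))
  refine Set.Finite.subset (Set.Finite.preimage hinj.injOn
    (s := ({0, 1, -1} : Set ℝ) ×ˢ ({0, 1, -1} : Set ℝ))
    (((Set.finite_singleton _).insert _).insert _ |>.prod
      (((Set.finite_singleton _).insert _).insert _))) fun z hz => ?_
  have h1 := circle_re_sq_add_im_sq z
  simp only [Set.mem_preimage, Set.mem_prod, Set.mem_insert_iff, Set.mem_singleton_iff]
  rcases hz with h | h
  · rw [h] at h1
    exact ⟨Or.inl h, Or.inr (mul_self_eq_one_iff.1 (by nlinarith))⟩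
  · rw [h] at h1
    exact ⟨Or.inr (mul_self_eq_one_iff.1 (by nlinarith)), Or.inl h⟩

instance nontrivial_circle : Nontrivial Circle := ⟨1, -1, (Circle.neg_ne_self 1).symm⟩

/-- The circle has no isolated points, so removing finitely many points leaves a dense set. -/
lemma dense_compl_circle_axes :
    Dense {z : Circle | ¬ ((z : ℂ).re = 0 ∨ (z : ℂ).im = 0)} := by
  have h := (dense_univ (X := Circle)).sdiff_finite finite_circle_axes
  rwa [← Set.compl_eq_univ_sdiff] at h

/-! ### Families of circles of orthogonal involutions -/

/-- The curve of matrices with block `Φ c s`, where `(c, s)` runs through the unit circle. -/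
def blockCurve {d n : ℕ} (p : Fin d → Fin n) (v : Equiv.Perm (Fin n)) (η : Fin n → ℤˣ)
    (Φ : ℝ → ℝ → Matrix (Fin d) (Fin d) ℝ) : Set (Matrix (Fin n) (Fin n) ℝ) :=
  {x | ∃ c s : ℝ, c ^ 2 + s ^ 2 = 1 ∧ x = blockEmbed p (Φ c s) (signedPerm v η)}

/-- A parametrized circle of symmetric orthogonal matrices, which meets the signed permutation
matrices over `vs` on the horizontal and those over `ws` on the vertical axis and is otherwise
contained in the big cells. -/
structure IsCellCircle {d : ℕ} (vs ws : Equiv.Perm (Fin d))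
    (Φ : ℝ → ℝ → Matrix (Fin d) (Fin d) ℝ) (av aw : ℤˣ → Fin d → ℤˣ) : Prop where
  continuous : Continuous fun q : ℝ × ℝ => Φ q.1 q.2
  injective : ∀ c s c' s', c ^ 2 + s ^ 2 = 1 → c' ^ 2 + s' ^ 2 = 1 → Φ c s = Φ c' s' →
    c = c' ∧ s = s'
  transpose_eq : ∀ c s, (Φ c s)ᵀ = Φ c s
  sq_eq : ∀ c s, c ^ 2 + s ^ 2 = 1 → Φ c s * Φ c s = 1
  at_horizontal : ∀ σ : ℤˣ, Φ ((σ : ℤ) : ℝ) 0 = signedPerm vs (av σ)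
  at_vertical : ∀ σ : ℤˣ, Φ 0 ((σ : ℤ) : ℝ) = signedPerm ws (aw σ)
  lower : ∀ c s, c ^ 2 + s ^ 2 = 1 → c ≠ 0 → ∃ X ∈ borel d, ∃ L ∈ borelStar d,
    Φ c s * X = L * signedPerm vs 1
  upper : ∀ c s, c ^ 2 + s ^ 2 = 1 → ∀ σ : ℤˣ, 0 < ((σ : ℤ) : ℝ) * s →
    ∃ X ∈ borelPos d, ∃ U ∈ borelPos d, Φ c s * X = U * Φ 0 ((σ : ℤ) : ℝ)

/-- The block `p` of the permutations `v` and `w`, which coincide elsewhere. -/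
structure IsBlockPair {d n : ℕ} (p : Fin d → Fin n) (v w : Equiv.Perm (Fin n))
    (vs ws : Equiv.Perm (Fin d)) : Prop where
  strictMono : StrictMono p
  involutive : v * v = 1
  left : ∀ x, v (p x) = p (vs x)
  right : ∀ x, w (p x) = p (ws x)
  off : ∀ k, (∀ x, p x ≠ k) → w k = v k
  ne : v ≠ w

section SingleCurve

variable {d n : ℕ} {p : Fin d → Fin n} {v w : Equiv.Perm (Fin n)} {vs ws : Equiv.Perm (Fin d)}
  {Φ : ℝ → ℝ → Matrix (Fin d) (Fin d) ℝ} {av aw : ℤˣ → Fin d → ℤˣ} {η : Fin n → ℤˣ}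

/-- The parametrization of `blockCurve` by the circle. -/
def curveMap (p : Fin d → Fin n) (v : Equiv.Perm (Fin n)) (η : Fin n → ℤˣ)
    (Φ : ℝ → ℝ → Matrix (Fin d) (Fin d) ℝ) (z : Circle) : Matrix (Fin n) (Fin n) ℝ :=
  blockEmbed p (Φ (z : ℂ).re (z : ℂ).im) (signedPerm v η)

lemma range_curveMap : Set.range (curveMap p v η Φ) = blockCurve p v η Φ := by
  ext x
  constructor
  · rintro ⟨z, rfl⟩
    exact ⟨_, _, circle_re_sq_add_im_sq z, rfl⟩
  · rintro ⟨c, s, h, rfl⟩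
    obtain ⟨z, rfl, rfl⟩ := exists_circle h
    exact ⟨z, rfl⟩

lemma continuous_blockEmbed (p : Fin d → Fin n) (R : Matrix (Fin n) (Fin n) ℝ) :
    Continuous fun M => blockEmbed p M R := by
  refine continuous_matrix fun a b => ?_
  simp only [blockEmbed, Matrix.of_apply]
  split_ifs
  · refine continuous_finsetSum _ fun x _ => continuous_finsetSum _ fun y _ => ?_
    split_ifs
    · exact continuous_id.matrix_elem x y
    · exact continuous_const
  · exact continuous_const

lemma continuous_curveMap (h : IsCellCircle vs ws Φ av aw) : Continuous (curveMap p v η Φ) :=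
  (continuous_blockEmbed p _).comp (h.continuous.comp
    ((Complex.continuous_re.comp continuous_subtype_val).prodMk
      (Complex.continuous_im.comp continuous_subtype_val)))

lemma injective_curveMap (h : IsCellCircle vs ws Φ av aw) (hp : Function.Injective p) :
    Function.Injective (curveMap p v η Φ) := by
  intro z z' hz
  obtain ⟨h1, h2⟩ := h.injective _ _ _ _ (circle_re_sq_add_im_sq z) (circle_re_sq_add_im_sq z')
    ((blockEmbed_inj hp).1 hz).1
  exact Circle.ext (Complex.ext h1 h2)

/-- A continuous injection of a compact space into a Hausdorff space. -/
lemma isClosedEmbedding_curveMap (h : IsCellCircle vs ws Φ av aw) (hp : Function.Injective p) :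
    Topology.IsClosedEmbedding (curveMap p v η Φ) :=
  (continuous_curveMap h).isClosedEmbedding (injective_curveMap h hp)

lemma blockEmbed_horizontal (h : IsCellCircle vs ws Φ av aw) (hb : IsBlockPair p v w vs ws)
    (σ : ℤˣ) : blockEmbed p (Φ ((σ : ℤ) : ℝ) 0) (signedPerm v η)
      = signedPerm v (Function.extend p (av σ) η) := by
  rw [h.at_horizontal, blockEmbed_signedPerm hb.strictMono.injective hb.left fun _ _ => rfl]

lemma blockEmbed_vertical (h : IsCellCircle vs ws Φ av aw) (hb : IsBlockPair p v w vs ws)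
    (σ : ℤˣ) : blockEmbed p (Φ 0 ((σ : ℤ) : ℝ)) (signedPerm v η)
      = signedPerm w (Function.extend p (aw σ) η) := by
  rw [h.at_vertical, blockEmbed_signedPerm hb.strictMono.injective hb.right hb.off]

lemma exists_unit_of_im_eq_zero {z : Circle} (hz : (z : ℂ).im = 0) :
    ∃ σ : ℤˣ, ((σ : ℤ) : ℝ) = (z : ℂ).re := by
  have h := circle_re_sq_add_im_sq z
  rw [hz] at h
  exact exists_unit_cast (by linarith)

lemma exists_unit_of_re_eq_zero {z : Circle} (hz : (z : ℂ).re = 0) :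
    ∃ σ : ℤˣ, ((σ : ℤ) : ℝ) = (z : ℂ).im := by
  have h := circle_re_sq_add_im_sq z
  rw [hz] at h
  exact exists_unit_cast (by linarith)

lemma curveMap_of_im_eq_zero (h : IsCellCircle vs ws Φ av aw) (hb : IsBlockPair p v w vs ws)
    {z : Circle} {σ : ℤˣ} (hz : (z : ℂ).im = 0) (hσ : ((σ : ℤ) : ℝ) = (z : ℂ).re) :
    curveMap p v η Φ z = signedPerm v (Function.extend p (av σ) η) := by
  rw [← blockEmbed_horizontal h hb, curveMap, hz, hσ]

lemma curveMap_of_re_eq_zero (h : IsCellCircle vs ws Φ av aw) (hb : IsBlockPair p v w vs ws)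
    {z : Circle} {σ : ℤˣ} (hz : (z : ℂ).re = 0) (hσ : ((σ : ℤ) : ℝ) = (z : ℂ).im) :
    curveMap p v η Φ z = signedPerm w (Function.extend p (aw σ) η) := by
  rw [← blockEmbed_vertical h hb, curveMap, hz, hσ]

lemma curveMap_mem_grassm (h : IsCellCircle vs ws Φ av aw) (hb : IsBlockPair p v w vs ws)
    (hη : ∀ k, η (v k) = η k) (z : Circle) : curveMap p v η Φ z ∈ grassm n :=
  blockEmbed_signedPerm_mem_grassm hb.strictMono.injective hb.involutive hb.left hη
    (h.sq_eq _ _ (circle_re_sq_add_im_sq z)) (h.transpose_eq _ _)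

lemma curveMap_mem_lower (h : IsCellCircle vs ws Φ av aw) (hb : IsBlockPair p v w vs ws)
    {z : Circle} (hz : (z : ℂ).re ≠ 0) (a : Fin n → ℤˣ) :
    curveMap p v η Φ z ∈ doubleCoset (signedPerm v a) (borelStar n) (borel n) := by
  obtain ⟨X, hX, L, hL, hXL⟩ := h.lower _ _ (circle_re_sq_add_im_sq z) hz
  have hp := hb.strictMono.injective
  -- The model factorization has all signs 1 in the block; the signs required are installed by `B`.
  refine doubleCoset_signedPerm_congr (ε := Function.extend p 1 η) ?_ a
  rw [← blockEmbed_signedPerm hp hb.left fun _ _ => rfl]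
  refine mem_doubleCoset_borelStar_of_mul_eq (blockEmbed_mem_borel hb.strictMono hX)
    (blockEmbed_mem_borelStar hb.strictMono hL) ?_
  rw [curveMap, blockEmbed_mul_one hp, blockEmbed_one_mul hp, hXL]

/-- Each half circle lies in a single positive cell, whose signs are those at its midpoint `(0, σ)`.
-/
lemma curveMap_mem_upper (h : IsCellCircle vs ws Φ av aw) (hb : IsBlockPair p v w vs ws)
    {z : Circle} {σ : ℤˣ} (hz : z ∈ halfCircle σ) :
    curveMap p v η Φ z ∈ doubleCoset (signedPerm w (Function.extend p (aw σ) η))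
      (borelPos n) (borelPos n) := by
  obtain ⟨X, hX, U, hU, hXU⟩ := h.upper _ _ (circle_re_sq_add_im_sq z) σ hz
  have hp := hb.strictMono.injective
  rw [← blockEmbed_vertical h hb]
  refine mem_doubleCoset_borelPos_of_mul_eq (blockEmbed_mem_borelPos hb.strictMono hX)
    (blockEmbed_mem_borelPos hb.strictMono hU) ?_
  rw [curveMap, blockEmbed_mul_one hp, blockEmbed_one_mul hp, hXU]

lemma exists_mem_halfCircle {z : Circle} (hz : (z : ℂ).im ≠ 0) : ∃ σ : ℤˣ, z ∈ halfCircle σ := by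
  rcases lt_or_gt_of_ne hz with h | h
  · exact ⟨-1, by simpa [halfCircle] using h⟩
  · exact ⟨1, by simpa [halfCircle] using h⟩

/-- A point on the vertical axis is a signed permutation over `w`, which is not in the coset of `v`;
on the horizontal axis the roles are exchanged. Elsewhere both factorizations are available. -/
lemma curveMap_mem_richardson_iff (h : IsCellCircle vs ws Φ av aw) (hb : IsBlockPair p v w vs ws)
    (hη : ∀ k, η (v k) = η k) (a b : Fin n → ℤˣ) (z : Circle) :
    curveMap p v η Φ z ∈ richardson (signedPerm v a) (signedPerm w b) ↔
      ¬ ((z : ℂ).re = 0 ∨ (z : ℂ).im = 0) := by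
  constructor
  · rintro ⟨⟨-, hv⟩, hw⟩ (hz | hz)
    · obtain ⟨σ, hσ⟩ := exists_unit_of_re_eq_zero hz
      rw [curveMap_of_re_eq_zero h hb hz hσ] at hv
      exact hb.ne (perm_eq_of_mem_borelStar hv).symm
    · obtain ⟨σ, hσ⟩ := exists_unit_of_im_eq_zero hz
      rw [curveMap_of_im_eq_zero h hb hz hσ] at hw
      exact hb.ne (perm_eq_of_mem_borel hw)
  · intro hz
    rw [not_or] at hz
    obtain ⟨σ, hσ⟩ := exists_mem_halfCircle hz.2
    exact ⟨⟨curveMap_mem_grassm h hb hη z, curveMap_mem_lower h hb hz.1 a⟩,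
      doubleCoset_signedPerm_congr (borelPos_doubleCoset_subset (curveMap_mem_upper h hb hσ)) b⟩

lemma richardson_disjoint_signedPerms (hne : v ≠ w) {a b : Fin n → ℤˣ}
    {g : Matrix (Fin n) (Fin n) ℝ} (hg : g ∈ richardson (signedPerm v a) (signedPerm w b)) :
    g ∉ signedPerms n := by
  rintro ⟨u, ε, rfl⟩
  exact hne ((perm_eq_of_mem_borelStar hg.1.2).symm.trans (perm_eq_of_mem_borel hg.2))

lemma curveMap_mem_signedPerms_iff (h : IsCellCircle vs ws Φ av aw)
    (hb : IsBlockPair p v w vs ws) (hη : ∀ k, η (v k) = η k) (z : Circle) :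
    curveMap p v η Φ z ∈ signedPerms n ↔ (z : ℂ).re = 0 ∨ (z : ℂ).im = 0 := by
  constructor
  · intro hz
    by_contra hz'
    exact richardson_disjoint_signedPerms hb.ne
      ((curveMap_mem_richardson_iff h hb hη 1 1 z).2 hz') hz
  · rintro (hz | hz)
    · obtain ⟨σ, hσ⟩ := exists_unit_of_re_eq_zero hz
      exact ⟨_, _, curveMap_of_re_eq_zero h hb hz hσ⟩
    · obtain ⟨σ, hσ⟩ := exists_unit_of_im_eq_zero hz
      exact ⟨_, _, curveMap_of_im_eq_zero h hb hz hσ⟩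

lemma neg_mem_halfCircle {z : Circle} {σ : ℤˣ} (hz : (z : ℂ).im ≠ 0) (hσ : z ∉ halfCircle σ) :
    z ∈ halfCircle (-σ) := by
  have h1 : ((σ : ℤ) : ℝ) * (z : ℂ).im ≠ 0 := mul_ne_zero (unit_cast_ne_zero σ) hz
  have h2 : ¬ 0 < ((σ : ℤ) : ℝ) * (z : ℂ).im := hσ
  show 0 < (((-σ : ℤˣ) : ℤ) : ℝ) * (z : ℂ).im
  rcases lt_or_gt_of_ne h1 with h | h
  · push_cast [Units.val_neg]; linarith
  · exact absurd h h2

/-- Equal signs would identify two distinct points of the circle. The two half circles therefore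
belong to different cells. -/
lemma vertical_ne_neg (h : IsCellCircle vs ws Φ av aw) (σ : ℤˣ) : aw σ ≠ aw (-σ) := by
  intro h1
  have h2 : Φ 0 ((σ : ℤ) : ℝ) = Φ 0 (((-σ : ℤˣ) : ℤ) : ℝ) := by
    rw [h.at_vertical, h.at_vertical, h1]
  have hsq : ∀ σ : ℤˣ, (0 : ℝ) ^ 2 + ((σ : ℤ) : ℝ) ^ 2 = 1 := fun σ => by
    rw [sq ((σ : ℤ) : ℝ), unit_cast_mul_self]; norm_num
  have h3 := (h.injective _ _ _ _ (hsq σ) (hsq (-σ)) h2).2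
  rw [unit_cast_inj] at h3
  revert h3
  rcases Int.units_eq_one_or σ with rfl | rfl <;> decide

lemma horizontal_ne_neg (h : IsCellCircle vs ws Φ av aw) (σ : ℤˣ) : av σ ≠ av (-σ) := by
  intro h1
  have h2 : Φ ((σ : ℤ) : ℝ) 0 = Φ (((-σ : ℤˣ) : ℤ) : ℝ) 0 := by
    rw [h.at_horizontal, h.at_horizontal, h1]
  have hsq : ∀ σ : ℤˣ, ((σ : ℤ) : ℝ) ^ 2 + (0 : ℝ) ^ 2 = 1 := fun σ => by
    rw [sq ((σ : ℤ) : ℝ), unit_cast_mul_self]; norm_num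
  have h3 := (h.injective _ _ _ _ (hsq σ) (hsq (-σ)) h2).1
  rw [unit_cast_inj] at h3
  revert h3
  rcases Int.units_eq_one_or σ with rfl | rfl <;> decide

lemma extend_inj (hp : Function.Injective p) {x y : Fin d → ℤˣ}
    (h : Function.extend p x η = Function.extend p y η) : x = y := by
  funext k
  have := congrFun h (p k)
  rwa [hp.extend_apply, hp.extend_apply] at this

lemma curveMap_mem_bruhatCell_iff (h : IsCellCircle vs ws Φ av aw)
    (hb : IsBlockPair p v w vs ws) (hη : ∀ k, η (v k) = η k) (σ : ℤˣ) (z : Circle) :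
    curveMap p v η Φ z ∈ bruhatCell (signedPerm w (Function.extend p (aw σ) η)) ↔
      z ∈ halfCircle σ := by
  constructor
  · rintro ⟨-, hz⟩
    by_contra hσ
    have him : (z : ℂ).im ≠ 0 := by
      intro h0
      obtain ⟨τ, hτ⟩ := exists_unit_of_im_eq_zero h0
      rw [curveMap_of_im_eq_zero h hb h0 hτ] at hz
      exact hb.ne (perm_eq_of_mem_borel (borelPos_doubleCoset_subset hz))
    -- Off the horizontal axis the point would lie in the opposite half circle, and the two cells,
    -- sharing it, would have the same signs.
    have h1 := curveMap_mem_upper (η := η) h hb (neg_mem_halfCircle him hσ)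
    have h2 := signs_eq_of_mem_borelPos (doubleCoset_borelPos_symm_trans hz h1)
    exact vertical_ne_neg h σ (extend_inj hb.strictMono.injective h2)
  · intro hz
    exact ⟨curveMap_mem_grassm h hb hη z, curveMap_mem_upper h hb hz⟩

lemma blockCurve_inter_bruhatCell (h : IsCellCircle vs ws Φ av aw)
    (hb : IsBlockPair p v w vs ws) (hη : ∀ k, η (v k) = η k) (σ : ℤˣ) :
    blockCurve p v η Φ ∩ bruhatCell (signedPerm w (Function.extend p (aw σ) η))
      = curveMap p v η Φ '' halfCircle σ := by
  ext g
  rw [← range_curveMap]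
  constructor
  · rintro ⟨⟨z, rfl⟩, hz⟩
    exact ⟨z, (curveMap_mem_bruhatCell_iff h hb hη σ z).1 hz, rfl⟩
  · rintro ⟨z, hz, rfl⟩
    exact ⟨⟨z, rfl⟩, (curveMap_mem_bruhatCell_iff h hb hη σ z).2 hz⟩

lemma exists_circle_horizontal (σ : ℤˣ) :
    ∃ z : Circle, (z : ℂ).re = ((σ : ℤ) : ℝ) ∧ (z : ℂ).im = 0 :=
  exists_circle (by rw [sq ((σ : ℤ) : ℝ), unit_cast_mul_self]; norm_num)

lemma exists_circle_vertical (σ : ℤˣ) :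
    ∃ z : Circle, (z : ℂ).re = 0 ∧ (z : ℂ).im = ((σ : ℤ) : ℝ) :=
  exists_circle (by rw [sq ((σ : ℤ) : ℝ), unit_cast_mul_self]; norm_num)

lemma image_horizontal (h : IsCellCircle vs ws Φ av aw) (hb : IsBlockPair p v w vs ws) :
    curveMap p v η Φ '' {z | (z : ℂ).im = 0} = {signedPerm v (Function.extend p (av 1) η),
      signedPerm v (Function.extend p (av (-1)) η)} := by
  ext g
  constructor
  · rintro ⟨z, hz, rfl⟩
    obtain ⟨σ, hσ⟩ := exists_unit_of_im_eq_zero hz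
    rw [curveMap_of_im_eq_zero h hb hz hσ]
    rcases Int.units_eq_one_or σ with rfl | rfl
    · exact Or.inl rfl
    · exact Or.inr rfl
  · have key : ∀ σ : ℤˣ, signedPerm v (Function.extend p (av σ) η) ∈
        curveMap p v η Φ '' {z | (z : ℂ).im = 0} := by
      intro σ
      obtain ⟨z, h1, h2⟩ := exists_circle_horizontal σ
      exact ⟨z, h2, curveMap_of_im_eq_zero h hb h2 h1.symm⟩
    rintro (rfl | rfl)
    · exact key 1
    · exact key (-1)

lemma image_vertical (h : IsCellCircle vs ws Φ av aw) (hb : IsBlockPair p v w vs ws) :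
    curveMap p v η Φ '' {z | (z : ℂ).re = 0} = {signedPerm w (Function.extend p (aw 1) η),
      signedPerm w (Function.extend p (aw (-1)) η)} := by
  ext g
  constructor
  · rintro ⟨z, hz, rfl⟩
    obtain ⟨σ, hσ⟩ := exists_unit_of_re_eq_zero hz
    rw [curveMap_of_re_eq_zero h hb hz hσ]
    rcases Int.units_eq_one_or σ with rfl | rfl
    · exact Or.inl rfl
    · exact Or.inr rfl
  · have key : ∀ σ : ℤˣ, signedPerm w (Function.extend p (aw σ) η) ∈
        curveMap p v η Φ '' {z | (z : ℂ).re = 0} := by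
      intro σ
      obtain ⟨z, h1, h2⟩ := exists_circle_vertical σ
      exact ⟨z, h1, curveMap_of_re_eq_zero h hb h1 h2.symm⟩
    rintro (rfl | rfl)
    · exact key 1
    · exact key (-1)

lemma blockCurve_structure (h : IsCellCircle vs ws Φ av aw) (hb : IsBlockPair p v w vs ws)
    (hη : ∀ k, η (v k) = η k) :
    Nonempty (blockCurve p v η Φ ≃ₜ Circle) ∧
      ∃ V V' W W' : Matrix (Fin n) (Fin n) ℝ,
        (∃ a, V = signedPerm v a) ∧ (∃ a, V' = signedPerm v a) ∧
        (∃ b, W = signedPerm w b) ∧ (∃ b, W' = signedPerm w b) ∧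
        V ≠ V' ∧ W ≠ W' ∧
        blockCurve p v η Φ ∩ signedPerms n = {V, V', W, W'} ∧
        blockCurve p v η Φ = {V, V'} ∪ (blockCurve p v η Φ ∩ bruhatCell W) ∪
          (blockCurve p v η Φ ∩ bruhatCell W') ∧
        IsConnected (blockCurve p v η Φ ∩ bruhatCell W) ∧
        IsConnected (blockCurve p v η Φ ∩ bruhatCell W') ∧
        closure (blockCurve p v η Φ ∩ bruhatCell W)
          = (blockCurve p v η Φ ∩ bruhatCell W) ∪ {V, V'} ∧
        closure (blockCurve p v η Φ ∩ bruhatCell W')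
          = (blockCurve p v η Φ ∩ bruhatCell W') ∪ {V, V'} := by
  have hp := hb.strictMono.injective
  have hemb := isClosedEmbedding_curveMap (v := v) (η := η) h hp
  refine ⟨⟨(Homeomorph.setCongr range_curveMap.symm).trans
    hemb.isEmbedding.toHomeomorph.symm⟩, signedPerm v (Function.extend p (av 1) η),
    signedPerm v (Function.extend p (av (-1)) η), signedPerm w (Function.extend p (aw 1) η),
    signedPerm w (Function.extend p (aw (-1)) η), ⟨_, rfl⟩, ⟨_, rfl⟩, ⟨_, rfl⟩, ⟨_, rfl⟩,
    ?_, ?_, ?_, ?_, ?_⟩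
  · intro h1
    exact horizontal_ne_neg h 1 (extend_inj hp (signedPerm_inj.1 h1).2)
  · intro h1
    exact vertical_ne_neg h 1 (extend_inj hp (signedPerm_inj.1 h1).2)
  · have h1 : blockCurve p v η Φ ∩ signedPerms n
        = curveMap p v η Φ '' {z | (z : ℂ).im = 0} ∪ curveMap p v η Φ '' {z | (z : ℂ).re = 0} := by
      rw [← Set.image_union, ← range_curveMap]
      ext g
      constructor
      · rintro ⟨⟨z, rfl⟩, hz⟩
        exact ⟨z, ((curveMap_mem_signedPerms_iff h hb hη z).1 hz).symm, rfl⟩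
      · rintro ⟨z, hz, rfl⟩
        exact ⟨⟨z, rfl⟩, (curveMap_mem_signedPerms_iff h hb hη z).2 (Or.symm hz)⟩
    rw [h1, image_horizontal h hb, image_vertical h hb, Set.insert_union, Set.singleton_union]
  · rw [blockCurve_inter_bruhatCell h hb hη, blockCurve_inter_bruhatCell h hb hη,
      ← image_horizontal h hb, ← Set.image_union, ← Set.image_union, ← range_curveMap,
      ← Set.image_univ]
    congr 1
    refine (Set.eq_univ_of_forall fun z => ?_).symm
    by_cases h0 : (z : ℂ).im = 0
    · exact Or.inl (Or.inl h0)
    · by_cases h1 : z ∈ halfCircle 1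
      · exact Or.inl (Or.inr h1)
      · exact Or.inr (neg_mem_halfCircle h0 h1)
  · have hconn : ∀ σ : ℤˣ, IsConnected (blockCurve p v η Φ ∩
        bruhatCell (signedPerm w (Function.extend p (aw σ) η))) := fun σ => by
      rw [blockCurve_inter_bruhatCell h hb hη]
      exact (isConnected_halfCircle σ).image _ hemb.continuous.continuousOn
    have hclos : ∀ σ : ℤˣ, closure (blockCurve p v η Φ ∩
        bruhatCell (signedPerm w (Function.extend p (aw σ) η)))
          = (blockCurve p v η Φ ∩ bruhatCell (signedPerm w (Function.extend p (aw σ) η))) ∪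
            {signedPerm v (Function.extend p (av 1) η),
              signedPerm v (Function.extend p (av (-1)) η)} := fun σ => by
      -- A closed embedding commutes with closure, so the two points added are the images of the end
      -- points of the half circle.
      rw [blockCurve_inter_bruhatCell h hb hη, hemb.closure_image_eq, closure_halfCircle,
        Set.image_union, image_horizontal h hb]
    exact ⟨hconn 1, hconn (-1), hclos 1, hclos (-1)⟩

/-- Only the axes carry signed permutations, and the vertical one lies over `w ≠ v`. So the signs
must be those of an end point on the block and `η` off it. -/
lemma signedPerm_left_mem_blockCurve_iff (h : IsCellCircle vs ws Φ av aw)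
    (hb : IsBlockPair p v w vs ws) (hη : ∀ k, η (v k) = η k) {a : Fin n → ℤˣ} :
    signedPerm v a ∈ blockCurve p v η Φ ↔
      (∃ σ, a ∘ p = av σ) ∧ ∀ k, (∀ x, p x ≠ k) → a k = η k := by
  have hp := hb.strictMono.injective
  constructor
  · rw [← range_curveMap]
    rintro ⟨z, hz⟩
    have h1 := (curveMap_mem_signedPerms_iff h hb hη z).1 ⟨_, _, hz⟩
    rcases h1 with h1 | h1
    · obtain ⟨σ, hσ⟩ := exists_unit_of_re_eq_zero h1
      rw [curveMap_of_re_eq_zero h hb h1 hσ, signedPerm_inj] at hz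
      exact absurd hz.1.symm hb.ne
    · obtain ⟨σ, hσ⟩ := exists_unit_of_im_eq_zero h1
      rw [curveMap_of_im_eq_zero h hb h1 hσ, signedPerm_inj] at hz
      rw [← hz.2]
      refine ⟨⟨σ, ?_⟩, fun k hk => Function.extend_apply' _ _ _ fun ⟨x, hx⟩ => hk x hx⟩
      funext x
      simp [hp.extend_apply]
  · rintro ⟨⟨σ, hσ⟩, hoff⟩
    refine ⟨((σ : ℤ) : ℝ), 0, by rw [sq ((σ : ℤ) : ℝ), unit_cast_mul_self]; norm_num, ?_⟩
    rw [h.at_horizontal, ← hσ]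
    exact signedPerm_eq_blockEmbed hp hb.left fun k hk => ⟨rfl, hoff k hk⟩

lemma signedPerm_right_mem_blockCurve_iff (h : IsCellCircle vs ws Φ av aw)
    (hb : IsBlockPair p v w vs ws) (hη : ∀ k, η (v k) = η k) {a : Fin n → ℤˣ} :
    signedPerm w a ∈ blockCurve p v η Φ ↔
      (∃ σ, a ∘ p = aw σ) ∧ ∀ k, (∀ x, p x ≠ k) → a k = η k := by
  have hp := hb.strictMono.injective
  constructor
  · rw [← range_curveMap]
    rintro ⟨z, hz⟩
    have h1 := (curveMap_mem_signedPerms_iff h hb hη z).1 ⟨_, _, hz⟩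
    rcases h1 with h1 | h1
    · obtain ⟨σ, hσ⟩ := exists_unit_of_re_eq_zero h1
      rw [curveMap_of_re_eq_zero h hb h1 hσ, signedPerm_inj] at hz
      rw [← hz.2]
      refine ⟨⟨σ, ?_⟩, fun k hk => Function.extend_apply' _ _ _ fun ⟨x, hx⟩ => hk x hx⟩
      funext x
      simp [hp.extend_apply]
    · obtain ⟨σ, hσ⟩ := exists_unit_of_im_eq_zero h1
      rw [curveMap_of_im_eq_zero h hb h1 hσ, signedPerm_inj] at hz
      exact absurd hz.1 hb.ne
  · rintro ⟨⟨σ, hσ⟩, hoff⟩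
    refine ⟨0, ((σ : ℤ) : ℝ), by rw [sq ((σ : ℤ) : ℝ), unit_cast_mul_self]; norm_num, ?_⟩
    rw [h.at_vertical, ← hσ]
    exact signedPerm_eq_blockEmbed hp hb.right fun k hk => ⟨hb.off k hk, hoff k hk⟩

end SingleCurve

/-! ### The generalized Richardson variety as a union of circles -/

/-- A family of circles of `d × d` matrices, indexed by two signs, which parametrizes the blocks of
the elements of a generalized Richardson variety; `I`, `J` are the positions of the rise and `Q`
describes the signed covering operations. -/
structure IsRiseModel {d : ℕ} (vs ws : Equiv.Perm (Fin d)) (I J : Fin d)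
    (Φ : ℤˣ → ℤˣ → ℝ → ℝ → Matrix (Fin d) (Fin d) ℝ) (av aw : ℤˣ → ℤˣ → ℤˣ → Fin d → ℤˣ)
    (Q : Matrix (Fin d) (Fin d) ℝ → Prop) : Prop where
  isCellCircle : ∀ ε δ, IsCellCircle vs ws (Φ ε δ) (av ε δ) (aw ε δ)
  count_eq_or : ∀ a ≤ d, ∀ b ≤ d, count vs a b = count ws a b ∨
      ((I : ℕ) < b ∧ b ≤ J ∧ (vs I : ℕ) < a ∧ a ≤ vs J) ∨
      ((I : ℕ) < a ∧ a ≤ J ∧ (vs I : ℕ) < b ∧ b ≤ vs J)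
  exists_of_block : ∀ M, IsRichardsonBlock vs ws M →
    ∃ ε δ c s, c ^ 2 + s ^ 2 = 1 ∧ M = Φ ε δ c s
  eq_of_signs : ∀ ε δ ε' δ' σ σ' τ τ', av ε δ σ = av ε' δ' σ' → aw ε δ τ = aw ε' δ' τ' →
    Φ ε δ = Φ ε' δ'
  covering_iff : ∀ α β : Fin d → ℤˣ, (∀ x, α (vs x) = α x) → (∀ x, β (ws x) = β x) →
    (Q (signedPerm vs α * signedPerm ws β) ↔ ∃ ε δ σ τ, α = av ε δ σ ∧ β = aw ε δ τ)

section Family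

variable {d n : ℕ} {p : Fin d → Fin n} {v w : Equiv.Perm (Fin n)} {vs ws : Equiv.Perm (Fin d)}
  {I J : Fin d} {Φ : ℤˣ → ℤˣ → ℝ → ℝ → Matrix (Fin d) (Fin d) ℝ}
  {av aw : ℤˣ → ℤˣ → ℤˣ → Fin d → ℤˣ} {Q : Matrix (Fin d) (Fin d) ℝ → Prop}

/-- The curves obtained from all sign choices. -/
def blockCurves (p : Fin d → Fin n) (v : Equiv.Perm (Fin n))
    (Φ : ℤˣ → ℤˣ → ℝ → ℝ → Matrix (Fin d) (Fin d) ℝ) : Set (Set (Matrix (Fin n) (Fin n) ℝ)) :=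
  {C | ∃ (ε δ : ℤˣ) (η : Fin n → ℤˣ), (∀ k, η (v k) = η k) ∧ C = blockCurve p v η (Φ ε δ)}

lemma richardson_eq (hm : IsRiseModel vs ws I J Φ av aw Q) (hb : IsBlockPair p v w vs ws)
    (hrise : ¬ ∃ k, p I < k ∧ k < p J ∧ v (p I) < v k ∧ v k < v (p J)) (a b : Fin n → ℤˣ) :
    richardson (signedPerm v a) (signedPerm w b) = ⋃₀ blockCurves p v Φ \ signedPerms n := by
  ext g
  constructor
  · intro hg
    refine ⟨?_, richardson_disjoint_signedPerms hb.ne hg⟩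
    obtain ⟨M, η, hη, rfl, hM⟩ := exists_block_of_mem_richardson hb.strictMono hb.involutive hb.left
      hb.right hb.off hrise hm.count_eq_or hg
    obtain ⟨ε, δ, c, s, hcs, rfl⟩ := hm.exists_of_block M hM
    exact ⟨_, ⟨ε, δ, η, hη, rfl⟩, c, s, hcs, rfl⟩
  · rintro ⟨⟨C, ⟨ε, δ, η, hη, rfl⟩, hg⟩, hs⟩
    rw [← range_curveMap] at hg
    obtain ⟨z, rfl⟩ := hg
    rw [curveMap_mem_signedPerms_iff (hm.isCellCircle ε δ) hb hη] at hs
    exact (curveMap_mem_richardson_iff (hm.isCellCircle ε δ) hb hη a b z).2 hs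

/-- There are finitely many sign choices and each curve is compact, so the union is closed; on each
curve the points off the axes are dense. -/
lemma closure_richardson (hm : IsRiseModel vs ws I J Φ av aw Q) (hb : IsBlockPair p v w vs ws)
    (hrise : ¬ ∃ k, p I < k ∧ k < p J ∧ v (p I) < v k ∧ v k < v (p J)) (a b : Fin n → ℤˣ) :
    closure (richardson (signedPerm v a) (signedPerm w b)) = ⋃₀ blockCurves p v Φ := by
  have hemb := fun ε δ η => isClosedEmbedding_curveMap (v := v) (η := η) (hm.isCellCircle ε δ)
    hb.strictMono.injective
  apply Set.Subset.antisymm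
  · refine closure_minimal (by rw [richardson_eq hm hb hrise]; exact Set.sdiff_subset) ?_
    have hfin : (blockCurves p v Φ).Finite := by
      refine (Set.finite_range fun q : ℤˣ × ℤˣ × (Fin n → ℤˣ) =>
        blockCurve p v q.2.2 (Φ q.1 q.2.1)).subset ?_
      rintro C ⟨ε, δ, η, -, rfl⟩
      exact ⟨(ε, δ, η), rfl⟩
    rw [Set.sUnion_eq_biUnion]
    refine hfin.isClosed_biUnion ?_
    rintro C ⟨ε, δ, η, -, rfl⟩
    rw [← range_curveMap]
    exact (hemb ε δ η).isClosed_range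
  · rintro g ⟨C, ⟨ε, δ, η, hη, rfl⟩, hg⟩
    rw [← range_curveMap, ← Set.image_univ, ← dense_compl_circle_axes.closure_eq,
      ← (hemb ε δ η).closure_image_eq] at hg
    refine closure_mono ?_ hg
    rintro _ ⟨z, hz, rfl⟩
    exact (curveMap_mem_richardson_iff (hm.isCellCircle ε δ) hb hη a b z).2 hz

lemma covering_iff_existsUnique (hm : IsRiseModel vs ws I J Φ av aw Q)
    (hb : IsBlockPair p v w vs ws) {a b : Fin n → ℤˣ}
    (ha : signedPerm v a * signedPerm v a = 1) (hbb : signedPerm w b * signedPerm w b = 1) :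
    (∃ M, Q M ∧ signedPerm v a * signedPerm w b = blockEmbed p M 1) ↔
      ∃! C : Set (Matrix (Fin n) (Fin n) ℝ), C ∈ blockCurves p v Φ ∧
        signedPerm v a ∈ C ∧ signedPerm w b ∈ C := by
  have hp := hb.strictMono.injective
  have hav := (signedPerm_mul_self_eq_one.1 ha).2
  have hbw := (signedPerm_mul_self_eq_one.1 hbb).2
  have hvv : ∀ k, v (v k) = k := fun k => by simpa using Equiv.congr_fun hb.involutive k
  have hα : ∀ x, (a ∘ p) (vs x) = (a ∘ p) x := fun x => by
    simp only [Function.comp, ← hb.left, hav]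
  have hβ : ∀ x, (b ∘ p) (ws x) = (b ∘ p) x := fun x => by
    simp only [Function.comp, ← hb.right, hbw]
  have hprod : signedPerm v a * signedPerm w b
      = blockEmbed p (signedPerm vs (a ∘ p) * signedPerm ws (b ∘ p))
        (signedPerm v a * signedPerm v b) := by
    conv_lhs =>
      rw [signedPerm_eq_blockEmbed (v := v) (η := a) hp hb.left fun k hk => ⟨rfl, rfl⟩,
        signedPerm_eq_blockEmbed (v := v) (η := b) hp hb.right fun k hk => ⟨hb.off k hk, rfl⟩]
    rw [blockEmbed_mul hp]
    intro r k hr _ x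
    rw [signedPerm_apply, hb.left, if_neg (hr _).symm, zero_mul]
  -- Off the block the product has diagonal entries `a k * b k`, so it is the identity there exactly
  -- when the signs agree.
  have hoff : (∀ r k, (∀ y, p y ≠ r) → (∀ y, p y ≠ k) →
      (signedPerm v a * signedPerm v b) r k = (1 : Matrix (Fin n) (Fin n) ℝ) r k) ↔
      ∀ k, (∀ x, p x ≠ k) → b k = a k := by
    rw [signedPerm_mul, hb.involutive]
    constructor
    · intro h k hk
      have h1 := h k k hk hk
      rw [signedPerm_apply, Equiv.Perm.one_apply, if_pos rfl, Matrix.one_apply_eq, hav] at h1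
      have h2 : a k * b k = 1 := by
        rw [← unit_cast_inj, h1]; simp
      rw [mul_eq_one_iff_eq_inv, Int.units_inv_eq_self] at h2
      exact h2.symm
    · intro h r k _ hk
      rw [signedPerm_apply, Equiv.Perm.one_apply, h k hk, hav, Int.units_mul_self,
        Matrix.one_apply]
      simp
  have hcov : (∃ M, Q M ∧ signedPerm v a * signedPerm w b = blockEmbed p M 1) ↔
      (∃ ε δ σ τ, a ∘ p = av ε δ σ ∧ b ∘ p = aw ε δ τ) ∧ ∀ k, (∀ x, p x ≠ k) → b k = a k := by
    rw [← hm.covering_iff _ _ hα hβ, ← hoff]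
    constructor
    · rintro ⟨M, hQ, hM⟩
      rw [hprod, blockEmbed_inj hp] at hM
      exact ⟨hM.1 ▸ hQ, hM.2⟩
    · rintro ⟨hQ, h⟩
      exact ⟨_, hQ, by rw [hprod]; exact (blockEmbed_inj hp).2 ⟨rfl, h⟩⟩
  rw [hcov]
  constructor
  · rintro ⟨⟨ε, δ, σ, τ, h1, h2⟩, h3⟩
    refine ⟨blockCurve p v a (Φ ε δ), ⟨⟨ε, δ, a, hav, rfl⟩, ?_, ?_⟩, ?_⟩
    · exact (signedPerm_left_mem_blockCurve_iff (hm.isCellCircle ε δ) hb hav).2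
        ⟨⟨σ, h1⟩, fun _ _ => rfl⟩
    · exact (signedPerm_right_mem_blockCurve_iff (hm.isCellCircle ε δ) hb hav).2 ⟨⟨τ, h2⟩, h3⟩
    · rintro C ⟨⟨ε', δ', η, hη, rfl⟩, h4, h5⟩
      obtain ⟨⟨σ', h6⟩, h7⟩ :=
        (signedPerm_left_mem_blockCurve_iff (hm.isCellCircle ε' δ') hb hη).1 h4
      obtain ⟨⟨τ', h8⟩, -⟩ :=
        (signedPerm_right_mem_blockCurve_iff (hm.isCellCircle ε' δ') hb hη).1 h5
      rw [hm.eq_of_signs ε' δ' ε δ σ' σ τ' τ (h6.symm.trans h1) (h8.symm.trans h2)]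
      -- The sign functions `η` and `a` may differ on the block, but there they do not influence the
      -- curve.
      have hR : ∀ M : Matrix (Fin d) (Fin d) ℝ,
          blockEmbed p M (signedPerm v η) = blockEmbed p M (signedPerm v a) := fun M =>
        (blockEmbed_inj hp).2 ⟨rfl, fun r k _ hk => by
          rw [signedPerm_apply, signedPerm_apply, h7 k hk]⟩
      simp only [blockCurve, hR]
  -- Existence alone suffices here: any curve through both points forces a signed covering
  -- operation, so otherwise there is none.
  · rintro ⟨C, ⟨⟨ε, δ, η, hη, rfl⟩, h4, h5⟩, -⟩
    obtain ⟨⟨σ, h6⟩, h7⟩ := (signedPerm_left_mem_blockCurve_iff (hm.isCellCircle ε δ) hb hη).1 h4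
    obtain ⟨⟨τ, h8⟩, h9⟩ := (signedPerm_right_mem_blockCurve_iff (hm.isCellCircle ε δ) hb hη).1 h5
    exact ⟨⟨ε, δ, σ, τ, h6, h8⟩, fun k hk => (h9 k hk).trans (h7 k hk).symm⟩

end Family

/-! ### Small triangular matrices -/

lemma mem_borel_two {a b c : ℝ} (ha : a ≠ 0) (hc : c ≠ 0) : !![a, b; 0, c] ∈ borel 2 := by
  refine borel_of_diag_ne_zero (fun i j hij => ?_) fun k => ?_
  · fin_cases i <;> fin_cases j <;> first | rfl | simp at hij
  · fin_cases k <;> assumption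

lemma mem_borelPos_two {a b c : ℝ} (ha : 0 < a) (hc : 0 < c) : !![a, b; 0, c] ∈ borelPos 2 := by
  refine ⟨fun i j hij => ?_, fun k => ?_⟩
  · fin_cases i <;> fin_cases j <;> first | rfl | simp at hij
  · fin_cases k <;> assumption

lemma mem_borelStar_two {a b c : ℝ} (ha : a ≠ 0) (hc : c ≠ 0) :
    !![a, 0; b, c] ∈ borelStar 2 := by
  refine borel_of_diag_ne_zero (fun i j hij => ?_) fun k => ?_
  · fin_cases i <;> fin_cases j <;> first | rfl | simp at hij
  · fin_cases k <;> assumption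

lemma mem_borel_three {a b c d e f : ℝ} (ha : a ≠ 0) (hd : d ≠ 0) (hf : f ≠ 0) :
    !![a, b, c; 0, d, e; 0, 0, f] ∈ borel 3 := by
  refine borel_of_diag_ne_zero (fun i j hij => ?_) fun k => ?_
  · fin_cases i <;> fin_cases j <;> first | rfl | simp at hij
  · fin_cases k <;> assumption

lemma mem_borelPos_three {a b c d e f : ℝ} (ha : 0 < a) (hd : 0 < d) (hf : 0 < f) :
    !![a, b, c; 0, d, e; 0, 0, f] ∈ borelPos 3 := by
  refine ⟨fun i j hij => ?_, fun k => ?_⟩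
  · fin_cases i <;> fin_cases j <;> first | rfl | simp at hij
  · fin_cases k <;> assumption

lemma mem_borelStar_three {a b c d e f : ℝ} (ha : a ≠ 0) (hd : d ≠ 0) (hf : f ≠ 0) :
    !![a, 0, 0; b, d, 0; c, e, f] ∈ borelStar 3 := by
  refine borel_of_diag_ne_zero (fun i j hij => ?_) fun k => ?_
  · fin_cases i <;> fin_cases j <;> first | rfl | simp at hij
  · fin_cases k <;> assumption

lemma mem_borel_four {a b c d e f g h k l : ℝ} (ha : a ≠ 0) (he : e ≠ 0) (hh : h ≠ 0)
    (hl : l ≠ 0) : !![a, b, c, d; 0, e, f, g; 0, 0, h, k; 0, 0, 0, l] ∈ borel 4 := by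
  refine borel_of_diag_ne_zero (fun i j hij => ?_) fun k => ?_
  · fin_cases i <;> fin_cases j <;> first | rfl | simp at hij
  · fin_cases k <;> assumption

lemma mem_borelPos_four {a b c d e f g h k l : ℝ} (ha : 0 < a) (he : 0 < e) (hh : 0 < h)
    (hl : 0 < l) : !![a, b, c, d; 0, e, f, g; 0, 0, h, k; 0, 0, 0, l] ∈ borelPos 4 := by
  refine ⟨fun i j hij => ?_, fun k => ?_⟩
  · fin_cases i <;> fin_cases j <;> first | rfl | simp at hij
  · fin_cases k <;> assumption

lemma mem_borelStar_four {a b c d e f g h k l : ℝ} (ha : a ≠ 0) (he : e ≠ 0) (hh : h ≠ 0)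
    (hl : l ≠ 0) : !![a, 0, 0, 0; b, e, 0, 0; c, f, h, 0; d, g, k, l] ∈ borelStar 4 := by
  refine borel_of_diag_ne_zero (fun i j hij => ?_) fun k => ?_
  · fin_cases i <;> fin_cases j <;> first | rfl | simp at hij
  · fin_cases k <;> assumption

/-! ### Two fixed points -/

/-- The curve for two fixed points. -/
def ffBlock (c s : ℝ) : Matrix (Fin 2) (Fin 2) ℝ := !![c, s; s, -c]

/-- The signed covering operations for two fixed points. -/
def ffCovering (α : ℤˣ) : Matrix (Fin 2) (Fin 2) ℝ := !![0, (α : ℤ); -(α : ℤ), 0]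

lemma isCellCircle_ff : IsCellCircle 1 (Equiv.swap 0 1) ffBlock (fun σ => ![σ, -σ])
    fun σ => ![σ, σ] where
  continuous := continuous_matrix fun a b => by
    fin_cases a <;> fin_cases b <;> simp [ffBlock] <;> fun_prop
  injective c s c' s' _ _ h :=
    ⟨congrFun (congrFun h 0) 0, congrFun (congrFun h 0) 1⟩
  transpose_eq c s := by
    ext a b
    fin_cases a <;> fin_cases b <;> rfl
  sq_eq c s h := by
    ext a b
    fin_cases a <;> fin_cases b <;> simp [ffBlock, Matrix.mul_apply, Fin.sum_univ_two] <;> grind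
  at_horizontal σ := by
    ext a b
    fin_cases a <;> fin_cases b <;> simp [ffBlock, signedPerm_apply]
  at_vertical σ := by
    ext a b
    fin_cases a <;> fin_cases b <;> simp [ffBlock, signedPerm_apply]
  lower c s h hc := by
    -- Column elimination: `X` clears the part of the product above the pivots. The `lower`
    -- witnesses of the other models arise in the same way.
    refine ⟨!![1, -s; 0, c], mem_borel_two one_ne_zero hc, !![c, 0; s, -1],
      mem_borelStar_two hc (by norm_num), ?_⟩
    ext a b
    rw [mul_signedPerm_apply]
    fin_cases a <;> fin_cases b <;> simp [ffBlock, Matrix.mul_apply, Fin.sum_univ_two] <;> grind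
  upper c s h σ hσ := by
    have hs := unit_cast_mul_self σ
    set t := ((σ : ℤ) : ℝ)
    -- The same matrix is used on both sides, so the point `Φ c s` is conjugate to `Φ 0 σ` under
    -- `B⁺`. This is possible for all types except crossing excedances.
    refine ⟨!![1, t * c; 0, t * s], mem_borelPos_two one_pos hσ, !![1, t * c; 0, t * s],
      mem_borelPos_two one_pos hσ, ?_⟩
    ext a b
    fin_cases a <;> fin_cases b <;> simp [ffBlock, Matrix.mul_apply, Fin.sum_univ_two] <;> grind

lemma isRiseModel_ff : IsRiseModel 1 (Equiv.swap 0 1) 0 1 (fun _ _ => ffBlock)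
    (fun _ _ σ => ![σ, -σ]) (fun _ _ σ => ![σ, σ]) (fun M => ∃ α : ℤˣ, M = ffCovering α) where
  isCellCircle _ _ := isCellCircle_ff
  count_eq_or := by decide
  exists_of_block M hM := by
    have hsym : M 1 0 = M 0 1 := congrFun (congrFun hM.transpose_eq 0) 1
    have hsq := fun a b => congrFun (congrFun hM.sq_eq a) b
    simp only [Matrix.mul_apply, Fin.sum_univ_two] at hsq
    have h00 := hsq 0 0
    have h01 := hsq 0 1
    -- The vector is a multiple of `e_0`, so the incidence condition says that `M 0 1 ≠ 0`; this
    -- excludes the diagonal matrices `±1`.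
    obtain ⟨x, hx, -, -, h1⟩ := hM.exists_upper 0
    have hx1 := hx 1 (by decide)
    simp [Matrix.mulVec, dotProduct, Fin.sum_univ_two, hx1, hsym] at h1 h00 h01
    -- The signs `ε`, `δ` do not enter this family and are set to 1.
    refine ⟨1, 1, M 0 0, M 0 1, by linarith, ?_⟩
    ext a b
    fin_cases a <;> fin_cases b <;> simp [ffBlock, hsym]
    have : M 0 1 * (M 0 0 + M 1 1) = 0 := by linarith
    linarith [(mul_eq_zero.1 this).resolve_left h1.1]
  eq_of_signs := fun _ _ _ _ _ _ _ _ _ _ => rfl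
  covering_iff α β hα hβ := by
    have hQ : ∀ α' : ℤˣ, ffCovering α' = signedPerm (1 * Equiv.swap 0 1) ![-α', α'] := by
      intro α'
      ext a b
      fin_cases a <;> fin_cases b <;> simp [ffCovering, signedPerm_apply]
    have h1 := hβ 0
    simp only [signedPerm_mul, hQ, signedPerm_inj, true_and, funext_iff, Fin.forall_fin_two] at h1 ⊢
    simp at h1 ⊢
    rw [h1]
    generalize α 0 = a0
    generalize α 1 = a1
    generalize β 0 = b0
    revert a0 a1 b0
    decide

/-! ### A fixed point and an excedance -/

/-- The curve for a fixed point followed by an excedance. -/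
def feBlock (ε : ℤˣ) (c s : ℝ) : Matrix (Fin 3) (Fin 3) ℝ :=
  ((ε : ℤ) : ℝ) • !![c ^ 2, s * c, s; s * c, s ^ 2, -c; s, -c, 0]

/-- The signed covering operations for a fixed point followed by an excedance. -/
def feCovering (α β : ℤˣ) : Matrix (Fin 3) (Fin 3) ℝ :=
  !![0, 0, (α : ℤ); (β : ℤ), 0, 0; 0, (α : ℤ) * (β : ℤ), 0]

lemma isCellCircle_fe (ε : ℤˣ) : IsCellCircle (Equiv.swap 1 2) (Equiv.swap 0 2) (feBlock ε)
    (fun σ => ![ε, -(ε * σ), -(ε * σ)]) fun σ => ![ε * σ, ε, ε * σ] where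
  continuous := continuous_matrix fun a b => by
    fin_cases a <;> fin_cases b <;> simp [feBlock] <;> fun_prop
  injective c s c' s' _ _ h := by
    have h1 := congrFun (congrFun h 1) 2
    have h2 := congrFun (congrFun h 0) 2
    simpa [feBlock] using And.intro h1 h2
  transpose_eq c s := by
    ext a b
    fin_cases a <;> fin_cases b <;> rfl
  sq_eq c s h := by
    have he := unit_cast_mul_self ε
    ext a b
    fin_cases a <;> fin_cases b <;> simp [feBlock, Matrix.mul_apply, Fin.sum_univ_three] <;> grind
  at_horizontal σ := by
    have he := unit_cast_mul_self σ
    have e1 : (Equiv.swap 1 2 : Equiv.Perm (Fin 3)) 0 = 0 := by decide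
    ext a b
    fin_cases a <;> fin_cases b <;> simp [feBlock, signedPerm_apply, e1, sq, he]
  at_vertical σ := by
    have he := unit_cast_mul_self σ
    have e1 : (Equiv.swap 0 2 : Equiv.Perm (Fin 3)) 1 = 1 := by decide
    ext a b
    fin_cases a <;> fin_cases b <;> simp [feBlock, signedPerm_apply, e1, sq, he]
  lower c s h hc := by
    have he := unit_cast_mul_self ε
    have he0 := unit_cast_ne_zero ε
    have e1 : (Equiv.swap 1 2 : Equiv.Perm (Fin 3)) 0 = 0 := by decide
    refine ⟨!![1, -s, s * c; 0, c, s ^ 2; 0, 0, -c],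
      mem_borel_three one_ne_zero hc (neg_ne_zero.2 hc),
      !![(ε : ℤ) * c ^ 2, 0, 0; (ε : ℤ) * (s * c), (ε : ℤ), 0; (ε : ℤ) * s, 0, -(ε : ℤ)],
      mem_borelStar_three (mul_ne_zero he0 (pow_ne_zero 2 hc)) he0 (neg_ne_zero.2 he0), ?_⟩
    ext a b
    rw [mul_signedPerm_apply]
    fin_cases a <;> fin_cases b <;>
      simp [feBlock, Matrix.mul_apply, Fin.sum_univ_three, e1] <;> grind
  upper c s h σ hσ := by
    have he := unit_cast_mul_self ε
    have hs := unit_cast_mul_self σ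
    set t := ((σ : ℤ) : ℝ)
    refine ⟨!![1, t * c, t * c ^ 2; 0, t * s, t * (s * c); 0, 0, t * s],
      mem_borelPos_three one_pos hσ hσ,
      !![1, t * c, t * c ^ 2; 0, t * s, t * (s * c); 0, 0, t * s],
      mem_borelPos_three one_pos hσ hσ, ?_⟩
    ext a b
    fin_cases a <;> fin_cases b <;> simp [feBlock, Matrix.mul_apply, Fin.sum_univ_three] <;> grind

/-- A symmetric orthogonal `3 × 3` matrix with a zero on the diagonal, up to the order of the
coordinates. -/
lemma exists_sign_of_symmetric_orthogonal {a b d k s : ℝ} (h0 : a ^ 2 + b ^ 2 + s ^ 2 = 1)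
    (h1 : a * b + b * d + s * k = 0) (h2 : a * s + b * k = 0) (h3 : b ^ 2 + d ^ 2 + k ^ 2 = 1)
    (h4 : b * s + d * k = 0) (h5 : s ^ 2 + k ^ 2 = 1) :
    ∃ ε : ℤˣ, a = (ε : ℤ) * k ^ 2 ∧ b = -((ε : ℤ) * (s * k)) ∧ d = (ε : ℤ) * s ^ 2 := by
  -- The symmetric block with rows `(a, b)`, `(b, d)` kills the unit vector `(s, k)`. It is
  -- therefore a multiple of the projection onto the unit vector `(k, -s)`, the factor being its
  -- quadratic form there, and orthogonality makes this factor `±1`.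
  have ha : a = (a * k ^ 2 - 2 * b * s * k + d * s ^ 2) * k ^ 2 := by grind
  have hb : b = -((a * k ^ 2 - 2 * b * s * k + d * s ^ 2) * (s * k)) := by grind
  have hd : d = (a * k ^ 2 - 2 * b * s * k + d * s ^ 2) * s ^ 2 := by grind
  obtain ⟨ε, hε⟩ := exists_unit_cast
    (show (a * k ^ 2 - 2 * b * s * k + d * s ^ 2) ^ 2 = 1 by grind)
  exact ⟨ε, by rw [hε]; exact ha, by rw [hε]; exact hb, by rw [hε]; exact hd⟩

lemma isRiseModel_fe : IsRiseModel (Equiv.swap 1 2) (Equiv.swap 0 2) 0 1 (fun ε _ => feBlock ε)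
    (fun ε _ σ => ![ε, -(ε * σ), -(ε * σ)]) (fun ε _ σ => ![ε * σ, ε, ε * σ])
    (fun M => ∃ α β : ℤˣ, M = feCovering α β) where
  isCellCircle ε _ := isCellCircle_fe ε
  count_eq_or := by decide
  exists_of_block M hM := by
    have hsym := fun a b => congrFun (congrFun hM.transpose_eq a) b
    have s10 : M 1 0 = M 0 1 := hsym 0 1
    have s20 : M 2 0 = M 0 2 := hsym 0 2
    have s21 : M 2 1 = M 1 2 := hsym 1 2
    have z22 : M 2 2 = 0 := hM.entry_eq_zero 2 2 (by unfold CornersAgree; decide) (by decide)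
    have hsq := fun a b => congrFun (congrFun hM.sq_eq a) b
    simp only [Matrix.mul_apply, Fin.sum_univ_three] at hsq
    have h00 := hsq 0 0
    have h01 := hsq 0 1
    have h02 := hsq 0 2
    have h11 := hsq 1 1
    have h12 := hsq 1 2
    have h22 := hsq 2 2
    simp [s10, s20, s21, z22] at h00 h01 h02 h11 h12 h22
    obtain ⟨ε, ha, hb, hd⟩ := exists_sign_of_symmetric_orthogonal (a := M 0 0) (b := M 0 1)
      (d := M 1 1) (k := M 1 2) (s := M 0 2) (by linarith) (by linarith) (by linarith)
      (by linarith) (by linarith) (by linarith)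
    have he := unit_cast_mul_self ε
    -- `c` and `s` are read off from the last column of `feBlock`, with `ε` divided out.
    refine ⟨ε, 1, -((ε : ℤ) * M 1 2), (ε : ℤ) * M 0 2, by grind, ?_⟩
    ext a b
    fin_cases a <;> fin_cases b <;> simp [feBlock, s10, s20, s21, z22] <;> grind
  eq_of_signs ε δ ε' δ' σ σ' τ τ' h _ := by
    have h0 : ε = ε' := congrFun h 0
    rw [h0]
  covering_iff α β hα hβ := by
    have e0 : (Equiv.swap 1 2 : Equiv.Perm (Fin 3)) 0 = 0 := by decide
    have e1 : (Equiv.swap 0 2 : Equiv.Perm (Fin 3)) 1 = 1 := by decide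
    have hQ : ∀ α' β' : ℤˣ, feCovering α' β'
        = signedPerm (Equiv.swap 1 2 * Equiv.swap 0 2) ![β', α' * β', α'] := by
      intro α' β'
      ext a b
      fin_cases a <;> fin_cases b <;> simp [feCovering, signedPerm_apply, e0, e1]
    have h1 := hα 1
    have h2 := hβ 0
    simp only [signedPerm_mul, hQ, signedPerm_inj, true_and, funext_iff, Fin.forall_fin_succ]
      at h1 h2 ⊢
    simp [e1] at h1 h2 ⊢
    rw [h1, h2]
    generalize α 0 = a0
    generalize α 1 = a1
    generalize β 0 = b0
    generalize β 1 = b1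
    revert a0 a1 b0 b1
    decide

/-! ### An excedance and a fixed point -/

/-- The curve for an excedance followed by a fixed point. -/
def efBlock (ε : ℤˣ) (c s : ℝ) : Matrix (Fin 3) (Fin 3) ℝ :=
  ((ε : ℤ) : ℝ) • !![0, -c, s; -c, s ^ 2, s * c; s, s * c, c ^ 2]

/-- The signed covering operations for an excedance followed by a fixed point. -/
def efCovering (α β : ℤˣ) : Matrix (Fin 3) (Fin 3) ℝ :=
  !![0, (α : ℤ), 0; 0, 0, (α : ℤ) * (β : ℤ); (β : ℤ), 0, 0]

lemma isCellCircle_ef (ε : ℤˣ) : IsCellCircle (Equiv.swap 0 1) (Equiv.swap 0 2) (efBlock ε)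
    (fun σ => ![-(ε * σ), -(ε * σ), ε]) fun σ => ![ε * σ, ε, ε * σ] where
  continuous := continuous_matrix fun a b => by
    fin_cases a <;> fin_cases b <;> simp [efBlock] <;> fun_prop
  injective c s c' s' _ _ h := by
    have h1 := congrFun (congrFun h 0) 1
    have h2 := congrFun (congrFun h 0) 2
    simpa [efBlock] using And.intro h1 h2
  transpose_eq c s := by
    ext a b
    fin_cases a <;> fin_cases b <;> rfl
  sq_eq c s h := by
    have he := unit_cast_mul_self ε
    ext a b
    fin_cases a <;> fin_cases b <;> simp [efBlock, Matrix.mul_apply, Fin.sum_univ_three] <;> grind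
  at_horizontal σ := by
    have he := unit_cast_mul_self σ
    have e1 : (Equiv.swap 0 1 : Equiv.Perm (Fin 3)) 2 = 2 := by decide
    ext a b
    fin_cases a <;> fin_cases b <;> simp [efBlock, signedPerm_apply, e1, sq, he]
  at_vertical σ := by
    have he := unit_cast_mul_self σ
    have e1 : (Equiv.swap 0 2 : Equiv.Perm (Fin 3)) 1 = 1 := by decide
    ext a b
    fin_cases a <;> fin_cases b <;> simp [efBlock, signedPerm_apply, e1, sq, he]
  lower c s h hc := by
    have he := unit_cast_mul_self ε
    have he0 := unit_cast_ne_zero ε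
    have e1 : (Equiv.swap 0 1 : Equiv.Perm (Fin 3)) 2 = 2 := by decide
    refine ⟨!![1, 0, s; 0, 1, s * c; 0, 0, c ^ 2],
      mem_borel_three one_ne_zero one_ne_zero (pow_ne_zero 2 hc),
      !![-((ε : ℤ) * c), 0, 0; (ε : ℤ) * s ^ 2, -((ε : ℤ) * c), 0;
        (ε : ℤ) * (s * c), (ε : ℤ) * s, (ε : ℤ)],
      mem_borelStar_three (neg_ne_zero.2 (mul_ne_zero he0 hc))
        (neg_ne_zero.2 (mul_ne_zero he0 hc)) he0, ?_⟩
    ext a b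
    rw [mul_signedPerm_apply]
    fin_cases a <;> fin_cases b <;>
      simp [efBlock, Matrix.mul_apply, Fin.sum_univ_three, e1] <;> grind
  upper c s h σ hσ := by
    have he := unit_cast_mul_self ε
    have hs := unit_cast_mul_self σ
    set t := ((σ : ℤ) : ℝ)
    refine ⟨!![1, -c, 0; 0, 1, -(t * c); 0, 0, t * s], mem_borelPos_three one_pos one_pos hσ,
      !![1, -c, 0; 0, 1, -(t * c); 0, 0, t * s], mem_borelPos_three one_pos one_pos hσ, ?_⟩
    ext a b
    fin_cases a <;> fin_cases b <;> simp [efBlock, Matrix.mul_apply, Fin.sum_univ_three] <;> grind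

lemma isRiseModel_ef : IsRiseModel (Equiv.swap 0 1) (Equiv.swap 0 2) 0 2 (fun ε _ => efBlock ε)
    (fun ε _ σ => ![-(ε * σ), -(ε * σ), ε]) (fun ε _ σ => ![ε * σ, ε, ε * σ])
    (fun M => ∃ α β : ℤˣ, M = efCovering α β) where
  isCellCircle ε _ := isCellCircle_ef ε
  count_eq_or := by decide
  exists_of_block M hM := by
    have hsym := fun a b => congrFun (congrFun hM.transpose_eq a) b
    have s10 : M 1 0 = M 0 1 := hsym 0 1
    have s20 : M 2 0 = M 0 2 := hsym 0 2
    have s21 : M 2 1 = M 1 2 := hsym 1 2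
    have z00 : M 0 0 = 0 := hM.entry_eq_zero 0 0 (by unfold CornersAgree; decide) (by decide)
    have hsq := fun a b => congrFun (congrFun hM.sq_eq a) b
    simp only [Matrix.mul_apply, Fin.sum_univ_three] at hsq
    have h00 := hsq 0 0
    have h01 := hsq 0 1
    have h02 := hsq 0 2
    have h11 := hsq 1 1
    have h12 := hsq 1 2
    have h22 := hsq 2 2
    simp [s10, s20, s21, z00] at h00 h01 h02 h11 h12 h22
    -- The zero now sits at the first diagonal place, so the coordinates are taken in the order 1,
    -- 2, 0.
    obtain ⟨ε, ha, hb, hd⟩ := exists_sign_of_symmetric_orthogonal (a := M 1 1) (b := M 1 2)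
      (d := M 2 2) (k := M 0 2) (s := M 0 1) (by linarith) (by linarith) (by linarith)
      (by linarith) (by linarith) (by linarith)
    have he := unit_cast_mul_self ε
    refine ⟨ε, 1, -((ε : ℤ) * M 0 1), (ε : ℤ) * M 0 2, by grind, ?_⟩
    ext a b
    fin_cases a <;> fin_cases b <;> simp [efBlock, s10, s20, s21, z00] <;> grind
  eq_of_signs ε δ ε' δ' σ σ' τ τ' h _ := by
    have h0 : ε = ε' := congrFun h 2
    rw [h0]
  covering_iff α β hα hβ := by
    have e0 : (Equiv.swap 0 1 : Equiv.Perm (Fin 3)) 2 = 2 := by decide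
    have e1 : (Equiv.swap 0 2 : Equiv.Perm (Fin 3)) 1 = 1 := by decide
    have hQ : ∀ α' β' : ℤˣ, efCovering α' β'
        = signedPerm (Equiv.swap 0 1 * Equiv.swap 0 2) ![β', α', α' * β'] := by
      intro α' β'
      ext a b
      fin_cases a <;> fin_cases b <;> simp [efCovering, signedPerm_apply, e0, e1]
    have h1 := hα 0
    have h2 := hβ 0
    simp only [signedPerm_mul, hQ, signedPerm_inj, true_and, funext_iff, Fin.forall_fin_succ]
      at h1 h2 ⊢
    simp [e1] at h1 h2 ⊢
    rw [h1, h2]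
    generalize α 0 = a0
    generalize α 2 = a1
    generalize β 0 = b0
    generalize β 1 = b1
    revert a0 a1 b0 b1
    decide

/-! ### Matchings of four points -/

/-- The permutation `(0 1)(2 3)`. -/
def adjacentPairs : Equiv.Perm (Fin 4) := Equiv.swap 0 1 * Equiv.swap 2 3

/-- The permutation `(0 2)(1 3)`. -/
def crossingPairs : Equiv.Perm (Fin 4) := Equiv.swap 0 2 * Equiv.swap 1 3

/-- The permutation `(0 3)(1 2)`. -/
def nestedPairs : Equiv.Perm (Fin 4) := Equiv.swap 0 3 * Equiv.swap 1 2

/-- The permutation `(0 3)`. -/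
def outerPair : Equiv.Perm (Fin 4) := Equiv.swap 0 3

@[simp] lemma adjacentPairs_zero : adjacentPairs 0 = 1 := by decide
@[simp] lemma adjacentPairs_one : adjacentPairs 1 = 0 := by decide
@[simp] lemma adjacentPairs_two : adjacentPairs 2 = 3 := by decide
@[simp] lemma adjacentPairs_three : adjacentPairs 3 = 2 := by decide
@[simp] lemma crossingPairs_zero : crossingPairs 0 = 2 := by decide
@[simp] lemma crossingPairs_one : crossingPairs 1 = 3 := by decide
@[simp] lemma crossingPairs_two : crossingPairs 2 = 0 := by decide
@[simp] lemma crossingPairs_three : crossingPairs 3 = 1 := by decide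
@[simp] lemma nestedPairs_zero : nestedPairs 0 = 3 := by decide
@[simp] lemma nestedPairs_one : nestedPairs 1 = 2 := by decide
@[simp] lemma nestedPairs_two : nestedPairs 2 = 1 := by decide
@[simp] lemma nestedPairs_three : nestedPairs 3 = 0 := by decide
@[simp] lemma outerPair_zero : outerPair 0 = 3 := by decide
@[simp] lemma outerPair_one : outerPair 1 = 1 := by decide
@[simp] lemma outerPair_two : outerPair 2 = 2 := by decide
@[simp] lemma outerPair_three : outerPair 3 = 0 := by decide

/-! ### Two non-crossing excedances -/

/-- The curve for two non-crossing excedances. -/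
def eeBlock (ε : ℤˣ) (c s : ℝ) : Matrix (Fin 4) (Fin 4) ℝ :=
  !![0, 0, c, s; 0, 0, (ε : ℤ) * s, -((ε : ℤ) * c); c, (ε : ℤ) * s, 0, 0; s, -((ε : ℤ) * c), 0, 0]

/-- The signed covering operations for two non-crossing excedances. -/
def eeCovering (α β : ℤˣ) : Matrix (Fin 4) (Fin 4) ℝ :=
  !![0, -(β : ℤ), 0, 0; (β : ℤ), 0, 0, 0; 0, 0, 0, (α : ℤ); 0, 0, -(α : ℤ), 0]

lemma isCellCircle_ee (ε : ℤˣ) : IsCellCircle crossingPairs nestedPairs (eeBlock ε)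
    (fun σ => ![σ, -(ε * σ), σ, -(ε * σ)]) fun σ => ![σ, ε * σ, ε * σ, σ] where
  continuous := continuous_matrix fun a b => by
    fin_cases a <;> fin_cases b <;> simp [eeBlock] <;> fun_prop
  injective c s c' s' _ _ h :=
    ⟨congrFun (congrFun h 0) 2, congrFun (congrFun h 0) 3⟩
  transpose_eq c s := by
    ext a b
    fin_cases a <;> fin_cases b <;> rfl
  sq_eq c s h := by
    have he := unit_cast_mul_self ε
    ext a b
    fin_cases a <;> fin_cases b <;> simp [eeBlock, Matrix.mul_apply, Fin.sum_univ_four] <;> grind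
  at_horizontal σ := by
    ext a b
    fin_cases a <;> fin_cases b <;> simp [eeBlock, signedPerm_apply]
  at_vertical σ := by
    ext a b
    fin_cases a <;> fin_cases b <;> simp [eeBlock, signedPerm_apply]
  lower c s h hc := by
    have he := unit_cast_mul_self ε
    have he0 := unit_cast_ne_zero ε
    refine ⟨!![1, -((ε : ℤ) * s), 0, 0; 0, c, 0, 0; 0, 0, 1, s; 0, 0, 0, -c],
      mem_borel_four one_ne_zero hc one_ne_zero (neg_ne_zero.2 hc),
      !![c, 0, 0, 0; (ε : ℤ) * s, (ε : ℤ), 0, 0; 0, 0, c, 0; 0, 0, s, -(ε : ℤ)],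
      mem_borelStar_four hc he0 hc (neg_ne_zero.2 he0), ?_⟩
    ext a b
    rw [mul_signedPerm_apply]
    fin_cases a <;> fin_cases b <;>
      simp [eeBlock, Matrix.mul_apply, Fin.sum_univ_four] <;> grind
  upper c s h σ hσ := by
    have he := unit_cast_mul_self ε
    have hs := unit_cast_mul_self σ
    set t := ((σ : ℤ) : ℝ)
    refine ⟨!![1, t * ((ε : ℤ) * c), 0, 0; 0, t * s, 0, 0; 0, 0, 1, t * c; 0, 0, 0, t * s],
      mem_borelPos_four one_pos hσ one_pos hσ,
      !![1, t * ((ε : ℤ) * c), 0, 0; 0, t * s, 0, 0; 0, 0, 1, t * c; 0, 0, 0, t * s],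
      mem_borelPos_four one_pos hσ one_pos hσ, ?_⟩
    ext a b
    fin_cases a <;> fin_cases b <;> simp [eeBlock, Matrix.mul_apply, Fin.sum_univ_four] <;> grind

/-- An orthogonal `2 × 2` matrix is determined by its first row and its determinant. -/
lemma exists_sign_of_orthogonal_two {x y z t : ℝ} (h0 : x ^ 2 + y ^ 2 = 1)
    (h1 : z ^ 2 + t ^ 2 = 1) (h2 : x * z + y * t = 0) :
    ∃ ε : ℤˣ, z = -((ε : ℤ) * y) ∧ t = (ε : ℤ) * x := by
  obtain ⟨ε, hε⟩ := exists_unit_cast (show (t * x - z * y) ^ 2 = 1 by grind)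
  exact ⟨ε, by rw [hε]; grind, by rw [hε]; grind⟩

/-- `(p, q)` is orthogonal to both rows of an orthogonal matrix. In the models with four points this
produces the zeros which do not follow from the corner counts. -/
lemma eq_zero_of_orthogonal_two {x y z t p q : ℝ} (h0 : x ^ 2 + y ^ 2 = 1)
    (h1 : z ^ 2 + t ^ 2 = 1) (h2 : x * z + y * t = 0) (h3 : x * p + y * q = 0)
    (h4 : z * p + t * q = 0) : p = 0 ∧ q = 0 := by
  obtain ⟨ε, rfl, rfl⟩ := exists_sign_of_orthogonal_two h0 h1 h2
  have he := unit_cast_mul_self ε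
  constructor <;> grind

lemma isRiseModel_ee : IsRiseModel crossingPairs nestedPairs 0 1 (fun ε _ => eeBlock ε)
    (fun ε _ σ => ![σ, -(ε * σ), σ, -(ε * σ)]) (fun ε _ σ => ![σ, ε * σ, ε * σ, σ])
    (fun M => ∃ α β : ℤˣ, M = eeCovering α β) where
  isCellCircle ε _ := isCellCircle_ee ε
  count_eq_or := by decide
  exists_of_block M hM := by
    have hsym := fun a b => congrFun (congrFun hM.transpose_eq a) b
    have s10 : M 1 0 = M 0 1 := hsym 0 1
    have s20 : M 2 0 = M 0 2 := hsym 0 2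
    have s21 : M 2 1 = M 1 2 := hsym 1 2
    have s30 : M 3 0 = M 0 3 := hsym 0 3
    have s31 : M 3 1 = M 1 3 := hsym 1 3
    have s32 : M 3 2 = M 2 3 := hsym 2 3
    have z00 : M 0 0 = 0 := hM.entry_eq_zero 0 0 (by unfold CornersAgree; decide) (by decide)
    have z01 : M 0 1 = 0 := hM.entry_eq_zero 0 1 (by unfold CornersAgree; decide) (by decide)
    have z11 : M 1 1 = 0 := hM.entry_eq_zero 1 1 (by unfold CornersAgree; decide) (by decide)
    have hsq := fun a b => congrFun (congrFun hM.sq_eq a) b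
    simp only [Matrix.mul_apply, Fin.sum_univ_four] at hsq
    have h00 := hsq 0 0
    have h01 := hsq 0 1
    have h02 := hsq 0 2
    have h03 := hsq 0 3
    have h11 := hsq 1 1
    have h12 := hsq 1 2
    have h13 := hsq 1 3
    simp [s10, s20, s21, s30, s31, s32, z00, z01, z11] at h00 h01 h02 h03 h11 h12 h13
    have g0 : M 0 2 ^ 2 + M 0 3 ^ 2 = 1 := by linarith
    have g1 : M 1 2 ^ 2 + M 1 3 ^ 2 = 1 := by linarith
    obtain ⟨z22, z23⟩ := eq_zero_of_orthogonal_two g0 g1 (by linarith) h02 h12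
    obtain ⟨-, z33⟩ := eq_zero_of_orthogonal_two g0 g1 (by linarith) h03 h13
    obtain ⟨ε, hz, ht⟩ := exists_sign_of_orthogonal_two g0 g1 (by linarith)
    -- `eeBlock` has the opposite sign convention in its second row, hence `-ε`.
    refine ⟨-ε, 1, M 0 2, M 0 3, g0, ?_⟩
    ext a b
    fin_cases a <;> fin_cases b <;>
      simp [eeBlock, s10, s20, s21, s30, s31, s32, z00, z01, z11, z22, z23, z33, hz, ht]
  eq_of_signs ε δ ε' δ' σ σ' τ τ' h _ := by
    have h0 : σ = σ' := congrFun h 0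
    have h1 : -(ε * σ) = -(ε' * σ') := congrFun h 1
    rw [h0, neg_inj, mul_left_inj] at h1
    rw [h1]
  covering_iff α β hα hβ := by
    have hQ : ∀ α' β' : ℤˣ, eeCovering α' β'
        = signedPerm (crossingPairs * nestedPairs) ![β', -β', -α', α'] := by
      intro α' β'
      ext a b
      fin_cases a <;> fin_cases b <;> simp [eeCovering, signedPerm_apply]
    have h1 := hα 0
    have h2 := hα 1
    have h3 := hβ 0
    have h4 := hβ 1
    simp only [signedPerm_mul, hQ, signedPerm_inj, true_and, funext_iff, Fin.forall_fin_succ]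
    simp at h1 h2 h3 h4 ⊢
    rw [h1, h2, h3, h4]
    generalize α 0 = a0
    generalize α 1 = a1
    generalize β 0 = b0
    generalize β 1 = b1
    revert a0 a1 b0 b1
    decide

/-! ### An excedance and a deficiency -/

/-- The curve for an excedance followed by a deficiency. -/
def edBlock (ε : ℤˣ) (c s : ℝ) : Matrix (Fin 4) (Fin 4) ℝ :=
  !![0, c, s, 0; c, 0, 0, -((ε : ℤ) * s); s, 0, 0, (ε : ℤ) * c; 0, -((ε : ℤ) * s), (ε : ℤ) * c, 0]

/-- The signed covering operations for an excedance followed by a deficiency. -/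
def edCovering (α β : ℤˣ) : Matrix (Fin 4) (Fin 4) ℝ :=
  !![0, 0, 0, (α : ℤ); 0, 0, (β : ℤ), 0; 0, -(β : ℤ), 0, 0; -(α : ℤ), 0, 0, 0]

lemma isCellCircle_ed (ε : ℤˣ) : IsCellCircle adjacentPairs crossingPairs (edBlock ε)
    (fun σ => ![σ, σ, ε * σ, ε * σ]) fun σ => ![σ, -(ε * σ), σ, -(ε * σ)] where
  continuous := continuous_matrix fun a b => by
    fin_cases a <;> fin_cases b <;> simp [edBlock] <;> fun_prop
  injective c s c' s' _ _ h :=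
    ⟨congrFun (congrFun h 0) 1, congrFun (congrFun h 0) 2⟩
  transpose_eq c s := by
    ext a b
    fin_cases a <;> fin_cases b <;> rfl
  sq_eq c s h := by
    have he := unit_cast_mul_self ε
    ext a b
    fin_cases a <;> fin_cases b <;> simp [edBlock, Matrix.mul_apply, Fin.sum_univ_four] <;> grind
  at_horizontal σ := by
    ext a b
    fin_cases a <;> fin_cases b <;> simp [edBlock, signedPerm_apply]
  at_vertical σ := by
    ext a b
    fin_cases a <;> fin_cases b <;> simp [edBlock, signedPerm_apply]
  lower c s h hc := by
    have he := unit_cast_mul_self ε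
    have he0 := unit_cast_ne_zero ε
    refine ⟨!![1, 0, 0, s; 0, 1, -s, 0; 0, 0, c, 0; 0, 0, 0, (ε : ℤ) * c],
      mem_borel_four one_ne_zero one_ne_zero hc (mul_ne_zero he0 hc),
      !![c, 0, 0, 0; 0, c, 0, 0; 0, s, 1, 0; -((ε : ℤ) * s), 0, 0, (ε : ℤ)],
      mem_borelStar_four hc hc one_ne_zero he0, ?_⟩
    ext a b
    rw [mul_signedPerm_apply]
    fin_cases a <;> fin_cases b <;>
      simp [edBlock, Matrix.mul_apply, Fin.sum_univ_four] <;> grind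
  upper c s h σ hσ := by
    have he := unit_cast_mul_self ε
    have hs := unit_cast_mul_self σ
    set t := ((σ : ℤ) : ℝ)
    refine ⟨!![1, 0, 0, -(t * ((ε : ℤ) * c)); 0, 1, t * c, 0; 0, 0, t * s, 0; 0, 0, 0, t * s],
      mem_borelPos_four one_pos one_pos hσ hσ,
      !![1, 0, 0, -(t * ((ε : ℤ) * c)); 0, 1, t * c, 0; 0, 0, t * s, 0; 0, 0, 0, t * s],
      mem_borelPos_four one_pos one_pos hσ hσ, ?_⟩
    ext a b
    fin_cases a <;> fin_cases b <;> simp [edBlock, Matrix.mul_apply, Fin.sum_univ_four] <;> grind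

lemma isRiseModel_ed : IsRiseModel adjacentPairs crossingPairs 0 3 (fun ε _ => edBlock ε)
    (fun ε _ σ => ![σ, σ, ε * σ, ε * σ]) (fun ε _ σ => ![σ, -(ε * σ), σ, -(ε * σ)])
    (fun M => ∃ α β : ℤˣ, M = edCovering α β) where
  isCellCircle ε _ := isCellCircle_ed ε
  count_eq_or := by decide
  exists_of_block M hM := by
    have hsym := fun a b => congrFun (congrFun hM.transpose_eq a) b
    have s10 : M 1 0 = M 0 1 := hsym 0 1
    have s20 : M 2 0 = M 0 2 := hsym 0 2
    have s21 : M 2 1 = M 1 2 := hsym 1 2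
    have s30 : M 3 0 = M 0 3 := hsym 0 3
    have s31 : M 3 1 = M 1 3 := hsym 1 3
    have s32 : M 3 2 = M 2 3 := hsym 2 3
    have z00 : M 0 0 = 0 := hM.entry_eq_zero 0 0 (by unfold CornersAgree; decide) (by decide)
    have z03 : M 0 3 = 0 := hM.entry_eq_zero 0 3 (by unfold CornersAgree; decide) (by decide)
    have z33 : M 3 3 = 0 := hM.entry_eq_zero 3 3 (by unfold CornersAgree; decide) (by decide)
    have hsq := fun a b => congrFun (congrFun hM.sq_eq a) b
    simp only [Matrix.mul_apply, Fin.sum_univ_four] at hsq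
    have h00 := hsq 0 0
    have h01 := hsq 0 1
    have h02 := hsq 0 2
    have h03 := hsq 0 3
    have h33 := hsq 3 3
    have h31 := hsq 3 1
    have h32 := hsq 3 2
    simp [s10, s20, s21, s30, s31, s32, z00, z03, z33] at h00 h01 h02 h03 h33 h31 h32
    have g0 : M 0 1 ^ 2 + M 0 2 ^ 2 = 1 := by linarith
    have g1 : M 1 3 ^ 2 + M 2 3 ^ 2 = 1 := by linarith
    obtain ⟨z11, z12⟩ := eq_zero_of_orthogonal_two g0 g1 (by linarith) h01 h31
    obtain ⟨-, z22⟩ := eq_zero_of_orthogonal_two g0 g1 (by linarith) h02 h32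
    obtain ⟨ε, hz, ht⟩ := exists_sign_of_orthogonal_two g0 g1 (by linarith)
    refine ⟨ε, 1, M 0 1, M 0 2, g0, ?_⟩
    ext a b
    fin_cases a <;> fin_cases b <;>
      simp [edBlock, s10, s20, s21, s30, s31, s32, z00, z03, z33, z11, z12, z22, hz, ht]
  eq_of_signs ε δ ε' δ' σ σ' τ τ' h _ := by
    have h0 : σ = σ' := congrFun h 0
    have h1 : ε * σ = ε' * σ' := congrFun h 2
    rw [h0, mul_left_inj] at h1
    rw [h1]
  covering_iff α β hα hβ := by
    have hQ : ∀ α' β' : ℤˣ, edCovering α' β'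
        = signedPerm (adjacentPairs * crossingPairs) ![-α', -β', β', α'] := by
      intro α' β'
      ext a b
      fin_cases a <;> fin_cases b <;> simp [edCovering, signedPerm_apply]
    have h1 := hα 0
    have h2 := hα 2
    have h3 := hβ 0
    have h4 := hβ 1
    simp only [signedPerm_mul, hQ, signedPerm_inj, true_and, funext_iff, Fin.forall_fin_succ]
    simp at h1 h2 h3 h4 ⊢
    rw [h1, h2, h3, h4]
    generalize α 0 = a0
    generalize α 2 = a1
    generalize β 0 = b0
    generalize β 1 = b1
    revert a0 a1 b0 b1
    decide

/-! ### Two crossing excedances -/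

/-- The shape of the blocks for two crossing excedances. -/
def crossingMatrix (ε δ : ℤˣ) (e f g : ℝ) : Matrix (Fin 4) (Fin 4) ℝ :=
  !![0, e, f, g;
     e, (δ : ℤ) * (1 - e ^ 2), -((δ : ℤ) * e * f), -((ε : ℤ) * f);
     f, -((δ : ℤ) * e * f), -((δ : ℤ) * (1 - e ^ 2)), (ε : ℤ) * e;
     g, -((ε : ℤ) * f), (ε : ℤ) * e, 0]

/-- The curve `(1 + e ^ 2) (1 + g ^ 2) = 2` in terms of the unit circle. -/
noncomputable def crossingCoord (c s : ℝ) : ℝ := c / √(1 + s ^ 2)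

/-- The curve for two crossing excedances. -/
noncomputable def crossingBlock (ε δ : ℤˣ) (c s : ℝ) : Matrix (Fin 4) (Fin 4) ℝ :=
  crossingMatrix ε δ (crossingCoord c s) ((ε : ℤ) * (δ : ℤ) * crossingCoord c s * s) s

/-- The signed covering operations for two crossing excedances. -/
def crossingCovering (α β γ : ℤˣ) : Matrix (Fin 4) (Fin 4) ℝ :=
  !![0, -((α : ℤ) * (β : ℤ) * (γ : ℤ)), 0, 0; 0, 0, 0, (γ : ℤ); (β : ℤ), 0, 0, 0; 0, 0, (α : ℤ), 0]

lemma sqrt_one_add_sq_pos (s : ℝ) : 0 < √(1 + s ^ 2) := Real.sqrt_pos.2 (by positivity)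

/-- With `f = ± e * g` the norm condition becomes `(1 + e ^ 2) * (1 + g ^ 2) = 2`; with `g = s` it
is solved by rescaling `c`, and `s` remains a coordinate. -/
lemma crossingCoord_eq {c s : ℝ} (h : c ^ 2 + s ^ 2 = 1) :
    crossingCoord c s ^ 2 * (1 + s ^ 2) = 1 - s ^ 2 := by
  have h1 := sqrt_one_add_sq_pos s
  have h2 : √(1 + s ^ 2) ^ 2 = 1 + s ^ 2 := Real.sq_sqrt (by positivity)
  rw [crossingCoord, div_pow, h2, div_mul_cancel₀ _ (by positivity)]
  linarith

lemma crossingCoord_ne_zero {c s : ℝ} (hc : c ≠ 0) : crossingCoord c s ≠ 0 :=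
  div_ne_zero hc (sqrt_one_add_sq_pos s).ne'

lemma exists_crossingCoord {e g : ℝ} (h : e ^ 2 * (1 + g ^ 2) = 1 - g ^ 2) :
    ∃ c, c ^ 2 + g ^ 2 = 1 ∧ crossingCoord c g = e := by
  refine ⟨e * √(1 + g ^ 2), ?_, mul_div_cancel_right₀ _ (sqrt_one_add_sq_pos g).ne'⟩
  rw [mul_pow, Real.sq_sqrt (by positivity), h]
  ring

lemma crossingCoord_unit_zero (σ : ℤˣ) : crossingCoord ((σ : ℤ) : ℝ) 0 = (σ : ℤ) := by
  simp [crossingCoord]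

lemma crossingCoord_zero (s : ℝ) : crossingCoord 0 s = 0 := by
  simp [crossingCoord]

lemma isCellCircle_crossing (ε δ : ℤˣ) : IsCellCircle adjacentPairs outerPair
    (crossingBlock ε δ) (fun σ => ![σ, σ, ε * σ, ε * σ]) fun σ => ![σ, δ, -δ, σ] where
  continuous := by
    have hc : Continuous fun q : ℝ × ℝ => crossingCoord q.1 q.2 :=
      continuous_fst.div (by fun_prop) fun q => (sqrt_one_add_sq_pos q.2).ne'
    refine continuous_matrix fun a b => ?_
    fin_cases a <;> fin_cases b <;> simp [crossingBlock, crossingMatrix] <;> fun_prop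
  injective c s c' s' _ _ h := by
    have h1 : crossingCoord c s = crossingCoord c' s' := congrFun (congrFun h 0) 1
    have h2 : s = s' := congrFun (congrFun h 0) 3
    subst h2
    exact ⟨(div_left_inj' (sqrt_one_add_sq_pos s).ne').1 h1, rfl⟩
  transpose_eq c s := by
    ext a b
    fin_cases a <;> fin_cases b <;> rfl
  sq_eq c s h := by
    have he := unit_cast_mul_self ε
    have hd := unit_cast_mul_self δ
    have h1 := crossingCoord_eq h
    rw [crossingBlock]
    generalize crossingCoord c s = e at h1 ⊢
    ext a b
    fin_cases a <;> fin_cases b <;>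
      simp [crossingMatrix, Matrix.mul_apply, Fin.sum_univ_four] <;> grind
  at_horizontal σ := by
    have hs := unit_cast_mul_self σ
    rw [crossingBlock, crossingCoord_unit_zero]
    ext a b
    fin_cases a <;> fin_cases b <;> simp [crossingMatrix, signedPerm_apply, sq, hs]
  at_vertical σ := by
    rw [crossingBlock, crossingCoord_zero]
    ext a b
    fin_cases a <;> fin_cases b <;> simp [crossingMatrix, signedPerm_apply]
  lower c s h hc := by
    have he := unit_cast_mul_self ε
    have hd := unit_cast_mul_self δ
    have he0 := unit_cast_ne_zero ε
    have h1 := crossingCoord_eq h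
    have h2 := crossingCoord_ne_zero (s := s) hc
    rw [crossingBlock]
    generalize crossingCoord c s = e at h1 h2 ⊢
    obtain ⟨f, hf⟩ : ∃ f : ℝ, f = (ε : ℤ) * (δ : ℤ) * e * s := ⟨_, rfl⟩
    rw [← hf]
    refine ⟨!![1, 0, s, f; 0, 1, -((ε : ℤ) * f), -((δ : ℤ) * e * f);
        0, 0, (ε : ℤ) * e, -((δ : ℤ) * (1 - e ^ 2)); 0, 0, 0, (ε : ℤ) * e],
      mem_borel_four one_ne_zero one_ne_zero (mul_ne_zero he0 h2) (mul_ne_zero he0 h2),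
      !![e, 0, 0, 0; (δ : ℤ) * (1 - e ^ 2), e, 0, 0; -((δ : ℤ) * e * f), f, 1, 0;
        -((ε : ℤ) * f), s, 0, 1],
      mem_borelStar_four h2 h2 one_ne_zero one_ne_zero, ?_⟩
    ext a b
    rw [mul_signedPerm_apply]
    fin_cases a <;> fin_cases b <;>
      simp [crossingMatrix, Matrix.mul_apply, Fin.sum_univ_four] <;> grind
  upper c s h σ hσ := by
    have he := unit_cast_mul_self ε
    have hd := unit_cast_mul_self δ
    have hs := unit_cast_mul_self σ
    have h1 := crossingCoord_eq h
    rw [crossingBlock, crossingBlock, crossingCoord_zero]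
    generalize crossingCoord c s = e at h1 ⊢
    obtain ⟨f, hf⟩ : ∃ f : ℝ, f = (ε : ℤ) * (δ : ℤ) * e * s := ⟨_, rfl⟩
    rw [← hf]
    set t := ((σ : ℤ) : ℝ)
    -- Here the left and right factors differ, in contrast to the other types; both have diagonal
    -- `1, 1, t * s, t * s`.
    refine ⟨!![1, (δ : ℤ) * e, -(t * (ε : ℤ) * e), 0; 0, 1, 0, t * e; 0, 0, t * s, t * f;
        0, 0, 0, t * s], mem_borelPos_four one_pos one_pos hσ hσ,
      !![1, (δ : ℤ) * e, -(t * (δ : ℤ) * f * s), 0;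
        0, 1, t * (δ : ℤ) * (ε : ℤ) * e ^ 2 + t * e * f * s, t * e; 0, 0, t * s, t * f;
        0, 0, 0, t * s], mem_borelPos_four one_pos one_pos hσ hσ, ?_⟩
    ext a b
    fin_cases a <;> fin_cases b <;>
      simp [crossingMatrix, Matrix.mul_apply, Fin.sum_univ_four] <;> grind

/-- The vector `(h, k)` is orthogonal to `(e, f)` and of the same length, so it is `x * (-f, e)`
with `x = ±1`. Orthogonality then gives `r = -p`, and together with the vanishing minor `hdet` it
forces `f ^ 2 = (e * g) ^ 2`. The signs are `ε = x` and `δ = x * f / (e * g)`. -/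
lemma exists_signs_of_crossing {e f g h k p q r : ℝ} (h00 : e ^ 2 + f ^ 2 + g ^ 2 = 1)
    (h01 : e * p + f * q + g * h = 0) (h02 : e * q + f * r + g * k = 0)
    (h03 : e * h + f * k = 0) (h32 : g * f + h * q + k * r = 0) (h33 : g ^ 2 + h ^ 2 + k ^ 2 = 1)
    (hdet : f * h = q * g) (he : e ≠ 0) (hg : g ≠ 0) :
    ∃ ε δ : ℤˣ, h = -((ε : ℤ) * f) ∧ k = (ε : ℤ) * e ∧ f = (ε : ℤ) * (δ : ℤ) * e * g ∧
      p = (δ : ℤ) * (1 - e ^ 2) ∧ q = -((δ : ℤ) * e * f) ∧ r = -((δ : ℤ) * (1 - e ^ 2)) := by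
  have hD : e ^ 2 + f ^ 2 ≠ 0 := by positivity
  obtain ⟨x, hx⟩ : ∃ x, x * (e ^ 2 + f ^ 2) = e * k - f * h :=
    ⟨(e * k - f * h) / (e ^ 2 + f ^ 2), div_mul_cancel₀ _ hD⟩
  have hh : h = -(x * f) := mul_right_cancel₀ hD (by linear_combination f * hx + e * h03)
  have hk : k = x * e := mul_right_cancel₀ hD (by linear_combination -e * hx + f * h03)
  have hx2 : x ^ 2 = 1 := by
    refine mul_right_cancel₀ hD ?_
    subst hh hk
    linear_combination h33 - h00
  obtain ⟨ε, hε⟩ := exists_unit_cast hx2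
  subst hh hk
  have hr : r = -p := by
    have : e * (p + r) = 0 := by linear_combination h01 + x * h32 - (- f * q + e * r) * hx2
    linarith [(mul_eq_zero.1 this).resolve_left he]
  subst hr
  have hp : e * p * g = x * f * (1 - e ^ 2) := by
    linear_combination g * h01 + f * hdet + x * f * h00
  have hf : f ^ 2 = (e * g) ^ 2 := by
    have : x * (f ^ 2 - (e * g) ^ 2) = 0 := by
      linear_combination (-(e * g)) * h02 - f * hp - e ^ 2 * hdet
    have h2 := (mul_eq_zero.1 this).resolve_left (by rintro rfl; norm_num at hx2)
    linarith
  have heg : e * g ≠ 0 := mul_ne_zero he hg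
  obtain ⟨y, hy⟩ : ∃ y, y * (e * g) = x * f := ⟨x * f / (e * g), div_mul_cancel₀ _ heg⟩
  have hy2 : y ^ 2 = 1 := by
    refine mul_right_cancel₀ (pow_ne_zero 2 heg) ?_
    linear_combination (y * (e * g) + x * f) * hy + x ^ 2 * hf + (e * g) ^ 2 * hx2
  obtain ⟨δ, hδ⟩ := exists_unit_cast hy2
  have hp' : p = y * (1 - e ^ 2) := mul_right_cancel₀ heg (by
    linear_combination hp - (1 - e ^ 2) * hy)
  refine ⟨ε, δ, by rw [hε], by rw [hε], ?_, ?_, ?_, ?_⟩ <;> rw [hδ]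
  · rw [hε]
    linear_combination -x * hy - f * hx2
  · exact hp'
  · refine mul_right_cancel₀ hg ?_
    linear_combination -hdet + f * hy
  · rw [hp']

lemma isRiseModel_crossing : IsRiseModel adjacentPairs outerPair 0 2 crossingBlock
    (fun ε _ σ => ![σ, σ, ε * σ, ε * σ]) (fun _ δ σ => ![σ, δ, -δ, σ])
    (fun M => ∃ α β γ : ℤˣ, M = crossingCovering α β γ) where
  isCellCircle := isCellCircle_crossing
  count_eq_or := by decide
  exists_of_block M hM := by
    have hsym := fun a b => congrFun (congrFun hM.transpose_eq a) b
    have s10 : M 1 0 = M 0 1 := hsym 0 1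
    have s20 : M 2 0 = M 0 2 := hsym 0 2
    have s21 : M 2 1 = M 1 2 := hsym 1 2
    have s30 : M 3 0 = M 0 3 := hsym 0 3
    have s31 : M 3 1 = M 1 3 := hsym 1 3
    have s32 : M 3 2 = M 2 3 := hsym 2 3
    have z00 : M 0 0 = 0 := hM.entry_eq_zero 0 0 (by unfold CornersAgree; decide) (by decide)
    have z33 : M 3 3 = 0 := hM.entry_eq_zero 3 3 (by unfold CornersAgree; decide) (by decide)
    have hsq := fun a b => congrFun (congrFun hM.sq_eq a) b
    simp only [Matrix.mul_apply, Fin.sum_univ_four] at hsq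
    have h00 := hsq 0 0
    have h01 := hsq 0 1
    have h02 := hsq 0 2
    have h03 := hsq 0 3
    have h33 := hsq 3 3
    have h32 := hsq 3 2
    simp [s10, s20, s21, s30, s31, s32, z00, z33] at h00 h01 h02 h03 h33 h32
    have he : M 0 1 ≠ 0 := by
      obtain ⟨x, hx, -, -, h1⟩ := hM.exists_lower 0
      simp [Matrix.mulVec, dotProduct, Fin.sum_univ_four, hx 1 (by decide), hx 2 (by decide),
        hx 3 (by decide), s10] at h1
      exact h1.1
    have hg : M 0 3 ≠ 0 := by
      obtain ⟨x, hx, -, -, h1⟩ := hM.exists_upper 0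
      simp [Matrix.mulVec, dotProduct, Fin.sum_univ_four, hx 1 (by decide), hx 2 (by decide),
        hx 3 (by decide), s30] at h1
      exact h1.1
    -- A combination of the first two columns, involving the second one, vanishes in rows 2 and 3.
    -- So the lower left `2 × 2` minor is zero, a condition which vanishing of entries does not
    -- supply.
    have hdet : M 0 2 * M 1 3 = M 1 2 * M 0 3 := by
      obtain ⟨x, hx, hx1, h1, -⟩ := hM.exists_upper 1
      have h2 := h1 2 (by decide)
      have h3 := h1 3 (by decide)
      simp [Matrix.mulVec, dotProduct, Fin.sum_univ_four, hx 2 (by decide), hx 3 (by decide), s20,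
        s21, s30, s31] at h2 h3
      refine mul_right_cancel₀ hx1 ?_
      linear_combination M 0 2 * h3 - M 0 3 * h2
    obtain ⟨ε, δ, hh, hk, hf, hp, hq, hr⟩ := exists_signs_of_crossing (e := M 0 1) (f := M 0 2)
      (g := M 0 3) (h := M 1 3) (k := M 2 3) (p := M 1 1) (q := M 1 2) (r := M 2 2)
      (by linarith) (by linarith) (by linarith) (by linarith) (by linarith) (by linarith)
      hdet he hg
    have hεε := unit_cast_mul_self ε
    have hδδ := unit_cast_mul_self δ
    obtain ⟨c, hc, hce⟩ := exists_crossingCoord (e := M 0 1) (g := M 0 3) (by grind)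
    refine ⟨ε, δ, c, M 0 3, hc, ?_⟩
    rw [crossingBlock, hce, ← hf]
    ext a b
    fin_cases a <;> fin_cases b <;>
      simp [crossingMatrix, s10, s20, s21, s30, s31, s32, z00, z33] <;> assumption
  eq_of_signs ε δ ε' δ' σ σ' τ τ' h h' := by
    have h0 : σ = σ' := congrFun h 0
    have h1 : ε * σ = ε' * σ' := congrFun h 2
    have h2 : δ = δ' := congrFun h' 1
    rw [h0, mul_left_inj] at h1
    rw [h1, h2]
  covering_iff α β hα hβ := by
    have hQ : ∀ α' β' γ' : ℤˣ, crossingCovering α' β' γ'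
        = signedPerm (adjacentPairs * outerPair) ![β', -(α' * β' * γ'), α', γ'] := by
      intro α' β' γ'
      ext a b
      fin_cases a <;> fin_cases b <;> simp [crossingCovering, signedPerm_apply]
    have h1 := hα 0
    have h2 := hα 2
    have h3 := hβ 0
    simp only [signedPerm_mul, hQ, signedPerm_inj, true_and, funext_iff, Fin.forall_fin_succ]
    simp at h1 h2 h3 ⊢
    rw [h1, h2, h3]
    generalize α 0 = a0
    generalize α 2 = a1
    generalize β 0 = b0
    generalize β 1 = b1
    generalize β 2 = b2
    revert a0 a1 b0 b1 b2
    decide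

/-! ### The block of a suitable rise -/

section Rise

variable {n : ℕ} {v w : Equiv.Perm (Fin n)} {i j : Fin n}

lemma strictMono_of_lt_succ {d : ℕ} {p : Fin (d + 1) → Fin n}
    (h : ∀ x : Fin d, p x.castSucc < p x.succ) : StrictMono p :=
  Fin.strictMono_iff_lt_succ.2 h

lemma isBlockPair_of {d : ℕ} {p : Fin d → Fin n} {vs ws : Equiv.Perm (Fin d)}
    (hp : StrictMono p) (hvv : v * v = 1) (hv : ∀ x, v (p x) = p (vs x))
    (hw : ∀ x, w (p x) = p (ws x)) (hoff : ∀ k, (∀ x, p x ≠ k) → w k = v k)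
    (hne : ∃ x, vs x ≠ ws x) : IsBlockPair p v w vs ws := by
  refine ⟨hp, hvv, hv, hw, hoff, ?_⟩
  rintro rfl
  obtain ⟨x, hx⟩ := hne
  exact hx (hp.injective (by rw [← hv, ← hw]))

lemma isBlockPair_ff (hvv : v * v = 1) (h : IsSuitableRise .ff v i j)
    (hw : w = v * coveringOp v i j .ff) :
    IsBlockPair ![i, j] v w 1 (Equiv.swap 0 1) := by
  obtain ⟨h1, h2, -, h3, h4⟩ := h
  subst hw
  refine isBlockPair_of (strictMono_of_lt_succ ?_) hvv ?_ ?_ ?_ ⟨0, by decide⟩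
  · simpa [Fin.forall_fin_succ] using h1
  · simp [Fin.forall_fin_succ, h3, h4]
  · simp [Fin.forall_fin_succ, coveringOp, h3, h4]
  · intro k hk
    simp [Fin.forall_fin_succ] at hk
    simp [coveringOp, Equiv.swap_apply_of_ne_of_ne (Ne.symm hk.1) (Ne.symm hk.2)]

lemma isBlockPair_fe (hvv : v * v = 1) (h : IsSuitableRise .fe v i j)
    (hw : w = v * coveringOp v i j .fe) :
    IsBlockPair ![i, j, v j] v w (Equiv.swap 1 2) (Equiv.swap 0 2) := by
  have hvk : ∀ k, v (v k) = k := fun k => by simpa using Equiv.congr_fun hvv k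
  obtain ⟨h1, h2, -, h3, h4⟩ := h
  subst hw
  have n1 := h1.ne
  have n2 := h4.ne
  have n3 := (h1.trans h4).ne
  refine isBlockPair_of (strictMono_of_lt_succ ?_) hvv ?_ ?_ ?_ ⟨0, by decide⟩
  · simp [Fin.forall_fin_succ, h1, h4]
  · have e : (Equiv.swap 1 2 : Equiv.Perm (Fin 3)) 0 = 0 := by decide
    simp [Fin.forall_fin_succ, h3, hvk, e]
  · simp [Fin.forall_fin_succ, coveringOp, h3, hvk, List.formPerm_cons_cons,
      Equiv.swap_apply_def, n1, n1.symm, n2.symm, n3, n3.symm]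
  · intro k hk
    simp [Fin.forall_fin_succ] at hk
    simp [coveringOp, List.formPerm_cons_cons, Equiv.swap_apply_def, Ne.symm hk.1,
      Ne.symm hk.2.1, Ne.symm hk.2.2]

lemma isBlockPair_ef (hvv : v * v = 1) (h : IsSuitableRise .ef v i j)
    (hw : w = v * coveringOp v i j .ef) :
    IsBlockPair ![i, v i, j] v w (Equiv.swap 0 1) (Equiv.swap 0 2) := by
  have hvk : ∀ k, v (v k) = k := fun k => by simpa using Equiv.congr_fun hvv k
  obtain ⟨h1, h2, -, h3, h4⟩ := h
  subst hw
  rw [h4] at h2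
  have n1 := h1.ne
  have n2 := h2.ne
  have n3 := h3.ne
  refine isBlockPair_of (strictMono_of_lt_succ ?_) hvv ?_ ?_ ?_ ⟨0, by decide⟩
  · simp [Fin.forall_fin_succ, h2, h3]
  · have e : (Equiv.swap 0 1 : Equiv.Perm (Fin 3)) 2 = 2 := by decide
    simp [Fin.forall_fin_succ, h4, hvk, e]
  · simp [Fin.forall_fin_succ, coveringOp, h4, hvk, List.formPerm_cons_cons,
      Equiv.swap_apply_def, n1, n1.symm, n2, n3, n3.symm]
  · intro k hk
    simp [Fin.forall_fin_succ] at hk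
    simp [coveringOp, List.formPerm_cons_cons, Equiv.swap_apply_def, Ne.symm hk.1,
      Ne.symm hk.2.1, Ne.symm hk.2.2]

lemma isBlockPair_ee (hvv : v * v = 1) (h : IsSuitableRise .eeNoncrossing v i j)
    (hw : w = v * coveringOp v i j .eeNoncrossing) :
    IsBlockPair ![i, j, v i, v j] v w crossingPairs nestedPairs := by
  have hvk : ∀ k, v (v k) = k := fun k => by simpa using Equiv.congr_fun hvv k
  obtain ⟨h1, -, -, -, h2, h3⟩ := h
  subst hw
  have n1 := h1.ne
  have n2 := h2.ne
  have n3 := (h1.trans h2).ne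
  have n4 := (h2.trans h3).ne
  have n5 := (h1.trans (h2.trans h3)).ne
  refine isBlockPair_of (strictMono_of_lt_succ ?_) hvv ?_ ?_ ?_ ⟨0, by decide⟩
  · simp [Fin.forall_fin_succ, h1, h2, h3]
  · simp [Fin.forall_fin_succ, hvk]
  · simp [Fin.forall_fin_succ, coveringOp, hvk, Equiv.swap_apply_def, n1.symm, n2, n2.symm, n3,
      n3.symm, n4, n4.symm, n5, n5.symm]
  · intro k hk
    simp [Fin.forall_fin_succ] at hk
    simp [coveringOp, Equiv.swap_apply_def, Ne.symm hk.1, Ne.symm hk.2.1, Ne.symm hk.2.2.1,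
      Ne.symm hk.2.2.2]

lemma isBlockPair_ed (hvv : v * v = 1) (h : IsSuitableRise .ed v i j)
    (hw : w = v * coveringOp v i j .ed) :
    IsBlockPair ![i, v i, v j, j] v w adjacentPairs crossingPairs := by
  have hvk : ∀ k, v (v k) = k := fun k => by simpa using Equiv.congr_fun hvv k
  obtain ⟨h1, h2, -, h3, h4⟩ := h
  subst hw
  have n1 := h1.ne
  have n2 := h3.ne
  have n3 := h4.ne
  have n4 := (h2.trans h4).ne
  have n5 := (h3.trans h2).ne
  refine isBlockPair_of (strictMono_of_lt_succ ?_) hvv ?_ ?_ ?_ ⟨0, by decide⟩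
  · simp [Fin.forall_fin_succ, h2, h3, h4]
  · simp [Fin.forall_fin_succ, hvk]
  · simp [Fin.forall_fin_succ, coveringOp, hvk, Equiv.swap_apply_def, n1.symm, n2, n2.symm, n3,
      n3.symm, n4, n4.symm, n5, n5.symm]
  · intro k hk
    simp [Fin.forall_fin_succ] at hk
    simp [coveringOp, Equiv.swap_apply_def, Ne.symm hk.1, Ne.symm hk.2.1, Ne.symm hk.2.2.1,
      Ne.symm hk.2.2.2]

lemma isBlockPair_crossing (hvv : v * v = 1) (h : IsSuitableRise .eeCrossing v i j)
    (hw : w = v * coveringOp v i j .eeCrossing) :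
    IsBlockPair ![i, v i, j, v j] v w adjacentPairs outerPair := by
  have hvk : ∀ k, v (v k) = k := fun k => by simpa using Equiv.congr_fun hvv k
  obtain ⟨h1, h2, -, h3, h4, h5⟩ := h
  subst hw
  have n1 := h1.ne
  have n2 := h3.ne
  have n3 := h4.ne
  have n4 := h5.ne
  have n5 := (h1.trans h5).ne
  refine isBlockPair_of (strictMono_of_lt_succ ?_) hvv ?_ ?_ ?_ ⟨0, by decide⟩
  · simp [Fin.forall_fin_succ, h3, h4, h5]
  · simp [Fin.forall_fin_succ, hvk]
  · simp [Fin.forall_fin_succ, coveringOp, List.formPerm_cons_cons, hvk, Equiv.swap_apply_def, n1,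
      n1.symm, n2, n2.symm, n3, n3.symm, n4, n4.symm, n5, n5.symm]
  · intro k hk
    simp [Fin.forall_fin_succ] at hk
    simp [coveringOp, List.formPerm_cons_cons, Equiv.swap_apply_def, Ne.symm hk.1, Ne.symm hk.2.1,
      Ne.symm hk.2.2.1, Ne.symm hk.2.2.2]

/-! ### The curves in terms of the models -/

lemma curves_ff : curves .ff v i j = blockCurves ![i, j] v fun _ _ => ffBlock := rfl

lemma curves_fe : curves .fe v i j = blockCurves ![i, j, v j] v fun ε _ => feBlock ε := rfl

lemma curves_ef : curves .ef v i j = blockCurves ![i, v i, j] v fun ε _ => efBlock ε := rfl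

lemma curves_ed : curves .ed v i j = blockCurves ![i, v i, v j, j] v fun ε _ => edBlock ε := rfl

/-- The model interchanges `c` and `s` so that the horizontal axis lies over `v`, as for the other
types. -/
lemma curves_ee :
    curves .eeNoncrossing v i j = blockCurves ![i, j, v i, v j] v fun ε _ => eeBlock ε := by
  have h : ∀ ε δ η, curve v i j ε δ η .eeNoncrossing
      = blockCurve ![i, j, v i, v j] v η (eeBlock ε) := by
    intro ε δ η
    ext x
    constructor
    · rintro ⟨c, s, h, rfl⟩
      exact ⟨s, c, by rw [add_comm]; exact h, rfl⟩
    · rintro ⟨c, s, h, rfl⟩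
      exact ⟨s, c, by rw [add_comm]; exact h, rfl⟩
  simp only [curves, blockCurves, h]

lemma curves_crossing :
    curves .eeCrossing v i j = blockCurves ![i, v i, j, v j] v crossingBlock := by
  have h : ∀ ε δ η, curve v i j ε δ η .eeCrossing
      = blockCurve ![i, v i, j, v j] v η (crossingBlock ε δ) := by
    intro ε δ η
    have hε := unit_cast_mul_self ε
    have hδ := unit_cast_mul_self δ
    ext x
    constructor
    -- The condition with the square root is redundant: the norm condition and `f = ε δ e g` give `g
    -- ^ 2 = (1 - e ^ 2) / (1 + e ^ 2)`, and the sign in it is free.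
    · rintro ⟨e, f, g, h1, -, h2, rfl⟩
      obtain ⟨c, hc, hce⟩ := exists_crossingCoord (e := e) (g := g) (by grind)
      refine ⟨c, g, hc, ?_⟩
      rw [crossingBlock, hce, ← h2]
      rfl
    · rintro ⟨c, g, h1, rfl⟩
      have h2 := crossingCoord_eq h1
      rw [crossingBlock]
      generalize crossingCoord c g = e at h2 ⊢
      refine ⟨e, (ε : ℤ) * (δ : ℤ) * e * g, g, by grind, ?_, rfl, rfl⟩
      have h3 : (1 - e ^ 2) / (1 + e ^ 2) = g ^ 2 := by
        rw [div_eq_iff (by positivity)]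
        linarith
      rw [h3, Real.sqrt_sq_eq_abs]
      rcases abs_choice g with hg | hg <;> rcases Int.units_eq_one_or ε with rfl | rfl <;>
        rcases Int.units_eq_one_or δ with rfl | rfl <;> rw [hg] <;> simp [mul_comm]
  simp only [curves, blockCurves, h]

/-- The conclusion for a rise whose block is described by a model. -/
lemma main_of_isRiseModel {d : ℕ} {p : Fin d → Fin n} {vs ws : Equiv.Perm (Fin d)} {I J : Fin d}
    {Φ : ℤˣ → ℤˣ → ℝ → ℝ → Matrix (Fin d) (Fin d) ℝ} {av aw : ℤˣ → ℤˣ → ℤˣ → Fin d → ℤˣ}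
    {Q : Matrix (Fin d) (Fin d) ℝ → Prop} {τ : RiseType}
    (hm : IsRiseModel vs ws I J Φ av aw Q) (hb : IsBlockPair p v w vs ws)
    (hrise : IsSuitableRise τ v i j) (hI : p I = i) (hJ : p J = j)
    (hcurves : curves τ v i j = blockCurves p v Φ)
    (hcov : ∀ S, IsSignedCoveringOp v i j S τ ↔ ∃ M, Q M ∧ S = blockEmbed p M 1) :
    (∀ a b : Fin n → ℤˣ,
      richardson (signedPerm v a) (signedPerm w b) = ⋃₀ curves τ v i j \ signedPerms n ∧
      closure (richardson (signedPerm v a) (signedPerm w b)) = ⋃₀ curves τ v i j) ∧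
    (∀ C ∈ curves τ v i j,
      Nonempty (C ≃ₜ Circle) ∧
      ∃ V V' W W' : Matrix (Fin n) (Fin n) ℝ,
        (∃ a, V = signedPerm v a) ∧ (∃ a, V' = signedPerm v a) ∧
        (∃ b, W = signedPerm w b) ∧ (∃ b, W' = signedPerm w b) ∧
        V ≠ V' ∧ W ≠ W' ∧
        C ∩ signedPerms n = {V, V', W, W'} ∧
        C = {V, V'} ∪ (C ∩ bruhatCell W) ∪ (C ∩ bruhatCell W') ∧
        IsConnected (C ∩ bruhatCell W) ∧
        IsConnected (C ∩ bruhatCell W') ∧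
        closure (C ∩ bruhatCell W) = (C ∩ bruhatCell W) ∪ {V, V'} ∧
        closure (C ∩ bruhatCell W') = (C ∩ bruhatCell W') ∪ {V, V'}) ∧
    (∀ a b : Fin n → ℤˣ,
      signedPerm v a * signedPerm v a = 1 → signedPerm w b * signedPerm w b = 1 →
      (IsSignedCoveringOp v i j (signedPerm v a * signedPerm w b) τ ↔
        ∃! C : Set (Matrix (Fin n) (Fin n) ℝ), C ∈ curves τ v i j ∧
          signedPerm v a ∈ C ∧ signedPerm w b ∈ C)) := by
  have hrise' : ¬ ∃ k, p I < k ∧ k < p J ∧ v (p I) < v k ∧ v k < v (p J) := by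
    rw [hI, hJ]
    exact hrise.2.2.1
  rw [hcurves]
  refine ⟨fun a b => ⟨richardson_eq hm hb hrise' a b, closure_richardson hm hb hrise' a b⟩, ?_,
    fun a b ha hbb => ?_⟩
  · rintro C ⟨ε, δ, η, hη, rfl⟩
    exact blockCurve_structure (hm.isCellCircle ε δ) hb hη
  · rw [hcov]
    exact covering_iff_existsUnique hm hb ha hbb

end Rise

end BruhatGrassmann

/-! ### Assembly over the six types of rises -/

theorem mainTheorem7 (n : ℕ) (v w : Equiv.Perm (Fin n)) (hv : v * v = 1)
    (τ : BruhatGrassmann.RiseType) (i j : Fin n)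
    (hrise : BruhatGrassmann.IsSuitableRise τ v i j)
    (hw : w = v * BruhatGrassmann.coveringOp v i j τ) :
    -- the variety, and its closure, for arbitrary signs of `v` and `w`
    (∀ a b : Fin n → ℤˣ,
      BruhatGrassmann.richardson (BruhatGrassmann.signedPerm v a) (BruhatGrassmann.signedPerm w b)
          = ⋃₀ BruhatGrassmann.curves τ v i j \ BruhatGrassmann.signedPerms n ∧
      closure (BruhatGrassmann.richardson
          (BruhatGrassmann.signedPerm v a) (BruhatGrassmann.signedPerm w b))
          = ⋃₀ BruhatGrassmann.curves τ v i j) ∧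
    -- each curve is a circle through two signed versions of `v` and two signed versions of `w`
    (∀ C ∈ BruhatGrassmann.curves τ v i j,
      Nonempty (C ≃ₜ Circle) ∧
      ∃ V V' W W' : Matrix (Fin n) (Fin n) ℝ,
        (∃ a, V = BruhatGrassmann.signedPerm v a) ∧ (∃ a, V' = BruhatGrassmann.signedPerm v a) ∧
        (∃ b, W = BruhatGrassmann.signedPerm w b) ∧ (∃ b, W' = BruhatGrassmann.signedPerm w b) ∧
        V ≠ V' ∧ W ≠ W' ∧
        C ∩ BruhatGrassmann.signedPerms n = {V, V', W, W'} ∧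
        C = {V, V'} ∪ (C ∩ BruhatGrassmann.bruhatCell W) ∪ (C ∩ BruhatGrassmann.bruhatCell W') ∧
        IsConnected (C ∩ BruhatGrassmann.bruhatCell W) ∧
        IsConnected (C ∩ BruhatGrassmann.bruhatCell W') ∧
        closure (C ∩ BruhatGrassmann.bruhatCell W)
          = (C ∩ BruhatGrassmann.bruhatCell W) ∪ {V, V'} ∧
        closure (C ∩ BruhatGrassmann.bruhatCell W')
          = (C ∩ BruhatGrassmann.bruhatCell W') ∪ {V, V'}) ∧
    -- exactly the signed covering relations are joined, each by a unique curve
    (∀ a b : Fin n → ℤˣ,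
      BruhatGrassmann.signedPerm v a * BruhatGrassmann.signedPerm v a = 1 →
      BruhatGrassmann.signedPerm w b * BruhatGrassmann.signedPerm w b = 1 →
      (BruhatGrassmann.IsSignedCoveringOp v i j
          (BruhatGrassmann.signedPerm v a * BruhatGrassmann.signedPerm w b) τ ↔
        ∃! C : Set (Matrix (Fin n) (Fin n) ℝ), C ∈ BruhatGrassmann.curves τ v i j ∧
          BruhatGrassmann.signedPerm v a ∈ C ∧ BruhatGrassmann.signedPerm w b ∈ C)) := by
  open BruhatGrassmann in
  cases τ with
  | ff =>
    refine main_of_isRiseModel isRiseModel_ff (isBlockPair_ff hv hrise hw) hrise rfl rfl curves_ff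
      fun S => ⟨?_, ?_⟩
    · rintro ⟨α, h⟩
      exact ⟨_, ⟨α, rfl⟩, h⟩
    · rintro ⟨_, ⟨α, rfl⟩, h⟩
      exact ⟨α, h⟩
  | fe =>
    refine main_of_isRiseModel isRiseModel_fe (isBlockPair_fe hv hrise hw) hrise rfl rfl curves_fe
      fun S => ⟨?_, ?_⟩
    · rintro ⟨α, β, h⟩
      exact ⟨_, ⟨α, β, rfl⟩, h⟩
    · rintro ⟨_, ⟨α, β, rfl⟩, h⟩
      exact ⟨α, β, h⟩
  | ef =>
    refine main_of_isRiseModel isRiseModel_ef (isBlockPair_ef hv hrise hw) hrise rfl rfl curves_ef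
      fun S => ⟨?_, ?_⟩
    · rintro ⟨α, β, h⟩
      exact ⟨_, ⟨α, β, rfl⟩, h⟩
    · rintro ⟨_, ⟨α, β, rfl⟩, h⟩
      exact ⟨α, β, h⟩
  | eeNoncrossing =>
    refine main_of_isRiseModel isRiseModel_ee (isBlockPair_ee hv hrise hw) hrise rfl rfl curves_ee
      fun S => ⟨?_, ?_⟩
    · rintro ⟨α, β, h⟩
      exact ⟨_, ⟨α, β, rfl⟩, h⟩
    · rintro ⟨_, ⟨α, β, rfl⟩, h⟩
      exact ⟨α, β, h⟩
  | eeCrossing =>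
    refine main_of_isRiseModel isRiseModel_crossing (isBlockPair_crossing hv hrise hw) hrise rfl rfl
      curves_crossing fun S => ⟨?_, ?_⟩
    · rintro ⟨α, β, γ, h⟩
      exact ⟨_, ⟨α, β, γ, rfl⟩, h⟩
    · rintro ⟨_, ⟨α, β, γ, rfl⟩, h⟩
      exact ⟨α, β, γ, h⟩
  | ed =>
    refine main_of_isRiseModel isRiseModel_ed (isBlockPair_ed hv hrise hw) hrise rfl rfl curves_ed
      fun S => ⟨?_, ?_⟩
    · rintro ⟨α, β, h⟩
      exact ⟨_, ⟨α, β, rfl⟩, h⟩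
    · rintro ⟨_, ⟨α, β, rfl⟩, h⟩
      exact ⟨α, β, h⟩
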